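/- **Setup.** Fix a weight $\lambda\in(0,1)$. Individuals $i=1,2,\dots$ have willingness to pay $v_i$, i.i.d. from a distribution $\mu$ on $[0,1]$. In period $i$ a policy $x_i$ is chosen, only $y_i=\mathbf 1(x_i\le v_i)$ is observed, and the welfare is $w_i(x_i)$, where $w_i(x)=x\,\mathbf 1(x\le v_i)+\lambda\max(v_i-x,0)$. Let $G(x)=\mu([x,\infty))$ be the demand function and $W(x)=xG(x)+\lambda\int_x^1G(z)\,dz$ the expected social welfare. The cumulative expected regret is $\mathcal R_T=\sup_{x\in[0,1]}E\big[\sum_{i\le T}w_i(x)-\sum_{i\le T}w_i(x_i)\big]$. **Algorithm (Dyadic Search for Social Welfare, confidence parameter $\delta$).** After $t$ periods let $n_t(x)=\#\{i\le t:x_i=x\}$ and $\widehat G_t(x)=\frac1{n_t(x)}\sum_{i\le t}y_i\mathbf 1(x_i=x)$ (which is $0$ if $n_t(x)=0$). For $a<b$ let $s=s(a,b,t)$ be the largest $s\in\{0,\dots,t\}$ such that $1+\#\{i\le s:x_i\in(a,b)\}$ is a power of $2$ (with $1=2^0$ included), and let $n_t(a,b)=\#\{i\le s:x_i\in(a,b)\}$,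 $\widehat G_t(a,b)=\frac1{n_t(a,b)+1}\sum_{i\le s}y_i\mathbf 1(x_i\in(a,b))$. Put $$\Gamma_t(x)=x\sqrt{\tfrac{\log(2/\delta)}{2n_t(x)}}\ \ (=+\infty\text{ if }n_t(x)=0),\qquad \Gamma_t(a,b)=\lambda(b-a)\Big(\sqrt{\tfrac{\log(2/\delta)}{2(n_t(a,b)+1)}}+\tfrac{2}{n_t(a,b)+1}\Big).$$ For $(a,b)\in\{(l,c),(c,r)\}$ let $\widehat\Delta_t(a,b)=b\,\widehat G_t(b)-a\,\widehat G_t(a)-\lambda(b-a)\widehat G_t(a,b)$ and $J_t(a,b)=\widehat\Delta_t(a,b)\pm(\Gamma_t(b)+\Gamma_t(a)+\Gamma_t(a,b))$; moreover let $J_t(l,r)=\widehat\Delta_t(l,c)+\widehat\Delta_t(c,r)\pm(\Gamma_t(r)+\Gamma_t(l)+\Gamma_t(l,c)+\Gamma_t(c,r))$. Start with active interval $I_1=[0,1]$ and $k=0$. In epoch $\tau=1,2,\dots$ let $c$ be the midpoint and $d$ the length of $I_\tau$, and set $l=c-\rho d$, $r=c+\rho d$ with $\rho=\frac14$ for odd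 $\tau$ and $\rho=\frac16$ for even $\tau$. In each period $t$ of the epoch: 1. Choose $u\in\{l,c,r,(l,c),(c,r)\}$ maximizing $\Gamma_{t-1}(u)$, ties broken in this order. If $u$ is a point, set $x_t=u$. If $u=(a,b)$, set $x_t=a+(b-a)\frac{k+1/2}{n_{t-1}(a,b)+1}$ and then replace $k$ by $(k+1)\bmod(n_{t-1}(a,b)+1)$. 2. Observe $y_t$. If $\inf J_t(l,c)\ge0$ or $\inf J_t(l,r)\ge0$, set $I_{\tau+1}=I_\tau\cap[l,1]$ and start epoch $\tau+1$ with the next period; otherwise, if $\sup J_t(c,r)\le0$ or $\sup J_t(l,r)\le0$, set $I_{\tau+1}=I_\tau\cap[0,r]$ and start epoch $\tau+1$ with the next period. **Theorem.** There are constants $C>0$ and $p\ge0$ such that for every $\lambda\in(0,1)$, every probability distribution $\mu$ on $[0,1]$ whose expected social welfare $W$ is concave on $[0,1]$, and every time horizon $T\ge1$, Dyadic Search for Social Welfare run with $\delta=T^{-5/2}$ satisfies $$\mathcal R_T\le C\,\sqrt T\,(1+\log T)^p .$$ -/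

import Mathlib

noncomputable section

namespace DyadicSearch

/-! ### Setup: welfare, demand, regret -/

/-- The binary decision `1(x ≤ v)` of an individual with willingness to pay `v` facing tax `x`. -/
def decision (v x : ℝ) : ℝ := if x ≤ v then 1 else 0

/-- Realized social welfare: public revenue plus `lam` times private welfare. -/
def welfare (lam v x : ℝ) : ℝ := x * decision v x + lam * max (v - x) 0

/-- Demand function `x ↦ P(v ≥ x)` of a distribution `μ` of willingness to pay. -/
def demand (μ : MeasureTheory.Measure ℝ) (x : ℝ) : ℝ := μ.real (Set.Ici x)

/-- Expected social welfare. -/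
def expWelfare (lam : ℝ) (μ : MeasureTheory.Measure ℝ) (x : ℝ) : ℝ :=
  x * demand μ x + lam * ∫ z in x..1, demand μ z

/-- Cumulative expected regret over the first `T` periods of the policies `pol`, against the best
constant policy in `[0, 1]`.  Index `i` of the sequences `v`, `pol` is the `(i + 1)`-st period. -/
def regret {Ω : Type*} [MeasurableSpace Ω] (P : MeasureTheory.Measure Ω) (lam : ℝ)
    (v pol : ℕ → Ω → ℝ) (T : ℕ) : ℝ :=
  ⨆ x : Set.Icc (0 : ℝ) 1,
    ∫ ω, ((∑ i ∈ Finset.range T, welfare lam (v i ω) (x : ℝ))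
      - ∑ i ∈ Finset.range T, welfare lam (v i ω) (pol i ω)) ∂P

/-! ### Estimators, as functions of the observed history

A history after `t` periods is the chronological list of the `t` pairs (policy, decision). -/

/-- Observed history. -/
abbrev History := List (ℝ × ℝ)

/-- Number of past periods in which the policy was exactly `x`. -/
def numAt (h : History) (x : ℝ) : ℕ := h.countP (fun p => decide (p.1 = x))

/-- Average decision at `x` (it is `0` when `x` was never chosen). -/
def demAt (h : History) (x : ℝ) : ℝ :=
  ((h.filter (fun p => decide (p.1 = x))).map Prod.snd).sum / (numAt h x : ℝ)

/-- Number of past periods in which the policy was in the open interval `(a, b)`. -/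
def rawNum (h : History) (a b : ℝ) : ℕ := h.countP (fun p => decide (a < p.1 ∧ p.1 < b))

open Classical in
/-- The truncated time index: the largest `s ≤ t` such that the base-2 logarithm of one plus the
number of policies in `(a, b)` among the first `s` periods is a natural number. -/
def truncTime (h : History) (a b : ℝ) : ℕ :=
  Nat.findGreatest (fun s => ∃ m : ℕ, 1 + rawNum (h.take s) a b = 2 ^ m) h.length

/-- Number of policies in `(a, b)` up to the truncated time index. -/
def numIn (h : History) (a b : ℝ) : ℕ := rawNum (h.take (truncTime h a b)) a b

/-- Estimate of the average demand over `(a, b)`. -/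
def demIn (h : History) (a b : ℝ) : ℝ :=
  (((h.take (truncTime h a b)).filter (fun p => decide (a < p.1 ∧ p.1 < b))).map Prod.snd).sum
    / ((numIn h a b : ℝ) + 1)

/-- Half-length `x √(log (2/δ) / (2 n))` for the revenue at `x`, infinite when `n = 0`. -/
def radAt (δ : ℝ) (h : History) (x : ℝ) : EReal :=
  if numAt h x = 0 then ⊤
  else ((x * Real.sqrt (1 / (2 * (numAt h x : ℝ)) * Real.log (2 / δ)) : ℝ) : EReal)

/-- Half-length for the private welfare difference between `b` and `a`. -/
def radIn (lam δ : ℝ) (h : History) (a b : ℝ) : EReal :=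
  ((lam * (b - a) *
    (Real.sqrt (1 / (2 * ((numIn h a b : ℝ) + 1)) * Real.log (2 / δ))
      + 2 / ((numIn h a b : ℝ) + 1)) : ℝ) : EReal)

/-- Estimate of the welfare difference between `b` and `a` for adjacent points `a < b`
of the current triple. -/
def diffAdj (lam : ℝ) (h : History) (a b : ℝ) : ℝ :=
  b * demAt h b - a * demAt h a - lam * (b - a) * demIn h a b

/-- Half-length of the confidence interval for adjacent points of the current triple. -/
def radAdj (lam δ : ℝ) (h : History) (a b : ℝ) : EReal :=
  radAt δ h b + radAt δ h a + radIn lam δ h a b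

/-- Estimate of the welfare difference between the outer points `r` and `l`. -/
def diffOuter (lam : ℝ) (h : History) (l c r : ℝ) : ℝ :=
  diffAdj lam h l c + diffAdj lam h c r

/-- Half-length of the confidence interval for the outer points. -/
def radOuter (lam δ : ℝ) (h : History) (l c r : ℝ) : EReal :=
  radAt δ h r + radAt δ h l + radIn lam δ h l c + radIn lam δ h c r

/-! ### The algorithm -/

/-- The five sampling options: the points `l`, `c`, `r` and the intervals `(l, c)`, `(c, r)`. -/
inductive Arm where
  | l | c | r | lc | cr

/-- Internal state between two periods: the number of the current epoch, the active interval
`[lo, hi]`, the counter `k`, and the observed history. -/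
structure State where
  epoch : ℕ
  lo : ℝ
  hi : ℝ
  k : ℕ
  hist : History

/-- Initial state: epoch `1`, active interval `[0, 1]`, `k = 0`, nothing observed. -/
def State.init : State := ⟨1, 0, 1, 0, []⟩

/-- Center of the active interval. -/
def State.ctr (S : State) : ℝ := (S.hi + S.lo) / 2

/-- Distance of `l` and `r` from the center: a quarter of the length of the active interval in odd
epochs, a sixth of it in even epochs. -/
def State.gap (S : State) : ℝ :=
  if Odd S.epoch then (S.hi - S.lo) / 4 else (S.hi - S.lo) / 6

/-- Left point of the current triple. -/
def State.left (S : State) : ℝ := S.ctr - S.gap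

/-- Right point of the current triple. -/
def State.right (S : State) : ℝ := S.ctr + S.gap

/-- Half-length attached to each sampling option. -/
def State.armRad (lam δ : ℝ) (S : State) : Arm → EReal
  | .l => radAt δ S.hist S.left
  | .c => radAt δ S.hist S.ctr
  | .r => radAt δ S.hist S.right
  | .lc => radIn lam δ S.hist S.left S.ctr
  | .cr => radIn lam δ S.hist S.ctr S.right

open Classical in
/-- The option of largest half-length, ties broken in the order `l, c, r, (l, c), (c, r)`. -/
def State.arm (lam δ : ℝ) (S : State) : Arm :=
  let g := S.armRad lam δ
  if ∀ b, g b ≤ g .l then .l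
  else if ∀ b, g b ≤ g .c then .c
  else if ∀ b, g b ≤ g .r then .r
  else if ∀ b, g b ≤ g .lc then .lc
  else .cr

/-- Policy queried inside `(a, b)`. -/
def State.sweep (S : State) (a b : ℝ) : ℝ :=
  a + (b - a) * (((S.k : ℝ) + 1 / 2) / ((numIn S.hist a b : ℝ) + 1))

/-- The policy chosen in the next period. -/
def State.policy (lam δ : ℝ) (S : State) : ℝ :=
  match S.arm lam δ with
  | .l => S.left
  | .c => S.ctr
  | .r => S.right
  | .lc => S.sweep S.left S.ctr
  | .cr => S.sweep S.ctr S.right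

/-- The counter `k` after the next choice. -/
def State.nextK (lam δ : ℝ) (S : State) : ℕ :=
  match S.arm lam δ with
  | .lc => (S.k + 1) % (numIn S.hist S.left S.ctr + 1)
  | .cr => (S.k + 1) % (numIn S.hist S.ctr S.right + 1)
  | _ => S.k

/-- Test for discarding the points left of `l` after history `h`: the confidence interval for
`(l, c)` or the one for `(l, r)` has nonnegative infimum. -/
def State.dropLeft (lam δ : ℝ) (S : State) (h : History) : Prop :=
  0 ≤ (diffAdj lam h S.left S.ctr : EReal) - radAdj lam δ h S.left S.ctr ∨
  0 ≤ (diffOuter lam h S.left S.ctr S.right : EReal) - radOuter lam δ h S.left S.ctr S.right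

/-- Test for discarding the points right of `r` after history `h`: the confidence interval for
`(c, r)` or the one for `(l, r)` has nonpositive supremum. -/
def State.dropRight (lam δ : ℝ) (S : State) (h : History) : Prop :=
  (diffAdj lam h S.ctr S.right : EReal) + radAdj lam δ h S.ctr S.right ≤ 0 ∨
  (diffOuter lam h S.left S.ctr S.right : EReal) + radOuter lam δ h S.left S.ctr S.right ≤ 0

open Classical in
/-- One period: choose a policy, observe the decision of an individual with willingness to pay `v`,
update the confidence intervals, and possibly shrink the active interval and open a new epoch. -/
def State.step (lam δ : ℝ) (S : State) (v : ℝ) : State :=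
  let x := S.policy lam δ
  let h := S.hist ++ [(x, decision v x)]
  let k := S.nextK lam δ
  if S.dropLeft lam δ h then ⟨S.epoch + 1, S.left, S.hi, k, h⟩
  else if S.dropRight lam δ h then ⟨S.epoch + 1, S.lo, S.right, k, h⟩
  else ⟨S.epoch, S.lo, S.hi, k, h⟩

/-- State after `t` periods, when the individuals have willingness to pay `v 0, v 1, …`. -/
def run (lam δ : ℝ) (v : ℕ → ℝ) : ℕ → State
  | 0 => State.init
  | t + 1 => (run lam δ v t).step lam δ (v t)

/-- Policy that Dyadic Search for Social Welfare chooses for individual number `t + 1`. -/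
def policy (lam δ : ℝ) (v : ℕ → ℝ) (t : ℕ) : ℝ := (run lam δ v t).policy lam δ

end DyadicSearch

end

/-! ### The experiment as a function of bits, and concentration along predictable selections. -/

noncomputable section

namespace DyadicSearch

open MeasureTheory ProbabilityTheory
open scoped ENNReal

/-! ### Adaptive binary experiments

The outcome of an adaptive experiment is a list of bits, the newest first; `pol` maps the bits seen
so far to the next threshold. -/

/-! Write L = log(2/δ). The algorithm sees the individuals only through the bits y_t, so its next
policy is a deterministic function `polOf` of the past bits, and v_t is independent of those bits.
Conditioning on them replaces realized by expected welfare exactly: the regret against x is the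
expectation of the sum of W(x) - W(x_t). It suffices to bound this sum on an event of high
probability (`integral_regret_le_of_good`).

Concentration. For a selection of periods decided by the earlier bits, Hoeffding's lemma yields an
exponential supermartingale. Hence, for each value n of the count, the summed deviation reaches
√(nL/2) with probability at most 2e^{-L} = δ (`measure_selDev_le`). The points and intervals
examined are random, but each one that contains an observation is determined by the period of its
first visit: it is that policy, or the dyadic interval centred at it (`Linked`, `newborn_center`).
So 2T selections and T values of n suffice, the failure probability is at most 2T²δ, and a failure
costs at most T·2T²δ = 2√T.

Bias. After a complete sweep the policies inside an interval form a dyadic grid, each point used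
once (`Cell`). As the demand is monotone with values in [0,1], the grid average is within 1/N of the
mean demand (`grid_sum_bounds`). This needs every epoch to end between sweeps. During a sweep the
truncated statistics are frozen, hence so are the radii, the chosen option and the tests. The one
danger is the first period of an epoch, when the tests have not been evaluated on the new triple.
But then some point of the triple has been chosen at most once, and its radius beats that of every
interval refined at least once. An interval chosen at that moment therefore has no observation, and
its sweep is a single point (`Inv.exists_mid`, `Inv.cons`).

Regret. On the good event concavity makes the tests safe: the active interval keeps a point x' at
least as good as x (`exists_mem_interval_ge`). If no test passes and all radii are at most γ,
concavity bounds the loss of the period by 16γ (`concave_loss_le`). The option of largest radius is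
the one sampled, and its radius is of order √L/√n after n observations, so an epoch costs O(√L √T)
by telescoping square roots (`Inv.radius`).

Number of epochs. In an active interval of length d the loss is at most d below x', since W gains at
most b - a from a to b; above x' it is at most d/(1 - x'), by concavity and 0 ≤ W ≤ 1
(`Inv.loss_le_epochLoss`). Since d decays geometrically, only O(log T) epochs, uniformly in x', can
lose more than 1/T per period (`card_epochLoss_le`). The other epochs lose at most 1 altogether. -/

instance instMeasurableSpaceBits : MeasurableSpace (List Bool) := ⊤

instance instDiscreteBits : DiscreteMeasurableSpace (List Bool) := ⟨fun _ => trivial⟩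

/-- Numerical value of a bit. -/
def bitVal (b : Bool) : ℝ := if b then 1 else 0

open Classical in
/-- The bits observed in the first `t` periods. -/
def bits (pol : List Bool → ℝ) (v : ℕ → ℝ) : ℕ → List Bool
  | 0 => []
  | t + 1 => decide (pol (bits pol v t) ≤ v t) :: bits pol v t

theorem bits_length (pol : List Bool → ℝ) (v : ℕ → ℝ) (t : ℕ) : (bits pol v t).length = t := by
  induction t with
  | zero => rfl
  | succ t ih => simp [bits, ih]

theorem bitVal_decide (x z : ℝ) [Decidable (x ≤ z)] : bitVal (decide (x ≤ z)) = decision z x := by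
  unfold bitVal decision
  by_cases h : x ≤ z <;> simp [h]

theorem measurable_decision (x : ℝ) : Measurable fun z => decision z x := by
  unfold decision
  exact Measurable.ite measurableSet_Ici measurable_const measurable_const

theorem decision_mem (z x : ℝ) : decision z x ∈ Set.Icc (0 : ℝ) 1 := by
  unfold decision; split_ifs <;> simp

/-- Only the valuations before `t` are required to be measurable. This lets the lemma be applied
with the σ-algebra they generate in place of the ambient one, which is how adaptedness is obtained
in `indepFun_bits`. The discrete σ-algebra on the countable type of bit lists makes `pol` itself
harmless. -/
theorem measurable_bits {Ω : Type*} [MeasurableSpace Ω] (pol : List Bool → ℝ) (v : ℕ → Ω → ℝ)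
    (t : ℕ) (hv : ∀ i < t, Measurable (v i)) :
    Measurable fun ω => bits pol (fun i => v i ω) t := by
  classical
  induction t with
  | zero => exact measurable_const
  | succ t ih =>
    have h1 := ih fun i hi => hv i (by omega)
    have hF : Measurable fun p : List Bool × ℝ => (decide (pol p.1 ≤ p.2) :: p.1 : List Bool) := by
      refine measurable_from_prod_countable_right fun b => ?_
      have : (fun y : ℝ => (decide (pol b ≤ y) :: b : List Bool))
          = fun y => if y ∈ Set.Ici (pol b) then (true :: b) else (false :: b) := by
        funext y; by_cases h : pol b ≤ y <;> simp [h]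
      rw [this]
      exact Measurable.ite measurableSet_Ici measurable_const measurable_const
    exact hF.comp (h1.prodMk (hv t (by omega)))

theorem indepFun_bits {Ω : Type*} [MeasurableSpace Ω] {P : Measure Ω} [IsProbabilityMeasure P]
    (pol : List Bool → ℝ) {v : ℕ → Ω → ℝ} (hv : ∀ i, Measurable (v i)) (hi : iIndepFun v P)
    (t : ℕ) : IndepFun (fun ω => bits pol (fun i => v i ω) t) (v t) P := by
  have h := indep_iSup_of_disjoint (m := fun i => MeasurableSpace.comap (v i) inferInstance)
    (fun i => (hv i).comap_le) hi (S := Set.Iio t) (T := {t}) (by simp)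
  have h2 : Indep (MeasurableSpace.comap (fun ω => bits pol (fun i => v i ω) t) inferInstance)
      (MeasurableSpace.comap (v t) inferInstance) P := by
    refine indep_of_indep_of_le_left (indep_of_indep_of_le_right h ?_) ?_
    · simp
    · rw [← measurable_iff_comap_le]
      refine @measurable_bits Ω (_) pol v t fun i hi => ?_
      rw [measurable_iff_comap_le]
      exact le_iSup₂_of_le i hi le_rfl
  exact h2

theorem map_bits_prod {Ω : Type*} [MeasurableSpace Ω] {P : Measure Ω} [IsProbabilityMeasure P]
    (pol : List Bool → ℝ) {v : ℕ → Ω → ℝ} (hv : ∀ i, Measurable (v i)) (hi : iIndepFun v P)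
    {μ : Measure ℝ} (hμ : ∀ i, P.map (v i) = μ) (t : ℕ) :
    P.map (fun ω => (bits pol (fun i => v i ω) t, v t ω))
      = (P.map fun ω => bits pol (fun i => v i ω) t).prod μ := by
  rw [← hμ t]
  exact (indepFun_iff_map_prod_eq_prod_map_map (measurable_bits pol v t fun i _ => hv i).aemeasurable
    (hv t).aemeasurable).1 (indepFun_bits pol hv hi t)

/-- Freezing: by independence the joint law of the past bits and the next valuation is a product, so
the next valuation can be integrated out with the past held fixed. -/
theorem lintegral_bits {Ω : Type*} [MeasurableSpace Ω] {P : Measure Ω} [IsProbabilityMeasure P]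
    (pol : List Bool → ℝ) {v : ℕ → Ω → ℝ} (hv : ∀ i, Measurable (v i)) (hi : iIndepFun v P)
    {μ : Measure ℝ} [IsProbabilityMeasure μ] (hμ : ∀ i, P.map (v i) = μ) (t : ℕ)
    (f : List Bool → ℝ → ℝ≥0∞) (hf : ∀ b, Measurable (f b)) :
    ∫⁻ ω, f (bits pol (fun i => v i ω) t) (v t ω) ∂P
      = ∫⁻ ω, ∫⁻ z, f (bits pol (fun i => v i ω) t) z ∂μ ∂P := by
  have hb := measurable_bits pol v t fun i _ => hv i
  have hF : Measurable fun p : List Bool × ℝ => f p.1 p.2 :=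
    measurable_from_prod_countable_right hf
  calc _ = ∫⁻ p, f p.1 p.2 ∂(P.map fun ω => (bits pol (fun i => v i ω) t, v t ω)) :=
        (lintegral_map hF (hb.prodMk (hv t))).symm
    _ = _ := by
        rw [map_bits_prod pol hv hi hμ t, lintegral_prod _ hF.aemeasurable, lintegral_map _ hb]
        exact measurable_of_countable _

theorem integrable_bits {Ω : Type*} [MeasurableSpace Ω] {P : Measure Ω} [IsProbabilityMeasure P]
    (pol : List Bool → ℝ) {v : ℕ → Ω → ℝ} (hv : ∀ i, Measurable (v i)) {t : ℕ}
    {f : List Bool → ℝ → ℝ} (hf : ∀ b, Measurable (f b)) {M : ℝ}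
    (hM : ∀ᵐ ω ∂P, ‖f (bits pol (fun i => v i ω) t) (v t ω)‖ ≤ M) :
    Integrable (fun ω => f (bits pol (fun i => v i ω) t) (v t ω)) P := by
  have hb := measurable_bits pol v t fun i _ => hv i
  have hF : Measurable fun p : List Bool × ℝ => f p.1 p.2 :=
    measurable_from_prod_countable_right hf
  exact Integrable.of_bound (hF.comp (hb.prodMk (hv t))).aestronglyMeasurable M hM

theorem integral_bits {Ω : Type*} [MeasurableSpace Ω] {P : Measure Ω} [IsProbabilityMeasure P]
    (pol : List Bool → ℝ) {v : ℕ → Ω → ℝ} (hv : ∀ i, Measurable (v i)) (hi : iIndepFun v P)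
    {μ : Measure ℝ} [IsProbabilityMeasure μ] (hμ : ∀ i, P.map (v i) = μ) (t : ℕ)
    {f : List Bool → ℝ → ℝ} (hf : ∀ b, Measurable (f b)) {M : ℝ}
    (hM : ∀ᵐ ω ∂P, ‖f (bits pol (fun i => v i ω) t) (v t ω)‖ ≤ M) :
    ∫ ω, f (bits pol (fun i => v i ω) t) (v t ω) ∂P
      = ∫ ω, ∫ z, f (bits pol (fun i => v i ω) t) z ∂μ ∂P := by
  have hb := measurable_bits pol v t fun i _ => hv i
  have hF : Measurable fun p : List Bool × ℝ => f p.1 p.2 :=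
    measurable_from_prod_countable_right hf
  have hint := integrable_bits pol hv hf hM
  have hm := hb.prodMk (hv t)
  have hI : Integrable (fun p : List Bool × ℝ => f p.1 p.2)
      (P.map fun ω => (bits pol (fun i => v i ω) t, v t ω)) :=
    (integrable_map_measure hF.aestronglyMeasurable hm.aemeasurable).2 hint
  calc _ = ∫ p, f p.1 p.2 ∂(P.map fun ω => (bits pol (fun i => v i ω) t, v t ω)) :=
        (integral_map hm.aemeasurable hF.aestronglyMeasurable).symm
    _ = _ := by
        rw [map_bits_prod pol hv hi hμ t] at hI ⊢
        rw [integral_prod _ hI, integral_map hb.aemeasurable]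
        exact (measurable_of_countable _).aestronglyMeasurable

/-! ### Concentration for predictable selections -/

open Classical in
/-- Number of selected periods. -/
def selCount (sel : List Bool → Prop) : List Bool → ℕ
  | [] => 0
  | _ :: bs => selCount sel bs + if sel bs then 1 else 0

open Classical in
/-- Sum of the centered decisions over the selected periods. -/
def selDev (pol : List Bool → ℝ) (G : ℝ → ℝ) (sel : List Bool → Prop) : List Bool → ℝ
  | [] => 0
  | b :: bs => selDev pol G sel bs + if sel bs then bitVal b - G (pol bs) else 0

theorem selCount_le_length (sel : List Bool → Prop) (bs : List Bool) :
    selCount sel bs ≤ bs.length := by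
  induction bs with
  | nil => simp [selCount]
  | cons b bs ih => simp only [selCount, List.length_cons]; split_ifs <;> omega

theorem demand_eq_integral (μ : Measure ℝ) (x : ℝ) : demand μ x = ∫ z, decision z x ∂μ := by
  have : (fun z => decision z x) = (Set.Ici x).indicator 1 := by
    funext z; simp [decision, Set.indicator_apply]
  rw [this, integral_indicator_one measurableSet_Ici]; rfl

/-- Hoeffding's lemma: a variable with values in an interval of length 1 is sub-Gaussian with
variance proxy 1/4, whence θ²/8. -/
theorem lintegral_exp_decision_le (μ : Measure ℝ) [IsProbabilityMeasure μ] (θ x : ℝ) :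
    ∫⁻ z, ENNReal.ofReal (Real.exp (θ * (decision z x - demand μ x) - θ ^ 2 / 8)) ∂μ ≤ 1 := by
  have h := hasSubgaussianMGF_of_mem_Icc (μ := μ) (X := fun z => decision z x) (a := 0) (b := 1)
    (measurable_decision x).aemeasurable (Filter.Eventually.of_forall fun z => decision_mem z x)
  rw [← demand_eq_integral] at h
  have h2 := h.mgf_le θ
  have hsplit : ∀ z, ENNReal.ofReal (Real.exp (θ * (decision z x - demand μ x) - θ ^ 2 / 8))
      = ENNReal.ofReal (Real.exp (-(θ ^ 2 / 8))) *
        ENNReal.ofReal (Real.exp (θ * (decision z x - demand μ x))) := by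
    intro z
    rw [← ENNReal.ofReal_mul (Real.exp_pos _).le, ← Real.exp_add]; congr 2; ring
  simp_rw [hsplit]
  rw [lintegral_const_mul' _ _ ENNReal.ofReal_ne_top,
    ← ofReal_integral_eq_lintegral_ofReal (h.integrable_exp_mul θ)
      (Filter.Eventually.of_forall fun z => (Real.exp_pos _).le),
    ← ENNReal.ofReal_mul (Real.exp_pos _).le]
  refine ENNReal.ofReal_le_one.2 ?_
  calc _ ≤ Real.exp (-(θ ^ 2 / 8)) * Real.exp (θ ^ 2 / 8) := by
        refine mul_le_mul_of_nonneg_left (h2.trans (le_of_eq ?_)) (Real.exp_pos _).le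
        congr 1
        simp
        ring
    _ = 1 := by rw [← Real.exp_add]; simp

/-- The integrand is a supermartingale. Whether a period is selected depends on earlier bits only,
so given the past the new factor is either 1 or has mean at most 1. -/
theorem lintegral_exp_selDev_le {Ω : Type*} [MeasurableSpace Ω] {P : Measure Ω}
    [IsProbabilityMeasure P]
    (pol : List Bool → ℝ) {v : ℕ → Ω → ℝ} (hv : ∀ i, Measurable (v i)) (hi : iIndepFun v P)
    {μ : Measure ℝ} [IsProbabilityMeasure μ] (hμ : ∀ i, P.map (v i) = μ)
    (sel : List Bool → Prop) (θ : ℝ) (t : ℕ) :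
    ∫⁻ ω, ENNReal.ofReal (Real.exp (θ * selDev pol (demand μ) sel (bits pol (fun i => v i ω) t)
      - θ ^ 2 / 8 * selCount sel (bits pol (fun i => v i ω) t))) ∂P ≤ 1 := by
  classical
  induction t with
  | zero => simp [bits, selDev, selCount]
  | succ t ih =>
    let F : List Bool → ℝ → ℝ≥0∞ := fun b z =>
      ENNReal.ofReal (Real.exp (θ * selDev pol (demand μ) sel b - θ ^ 2 / 8 * selCount sel b)) *
        (if sel b then
          ENNReal.ofReal (Real.exp (θ * (decision z (pol b) - demand μ (pol b)) - θ ^ 2 / 8))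
          else 1)
    have hF : ∀ b, Measurable (F b) := by
      intro b
      refine Measurable.const_mul ?_ _
      split_ifs
      · have := measurable_decision (pol b)
        fun_prop
      · exact measurable_const
    calc _ = ∫⁻ ω, F (bits pol (fun i => v i ω) t) (v t ω) ∂P := by
          refine lintegral_congr fun ω => ?_
          by_cases h : sel (bits pol (fun i => v i ω) t)
          · simp only [F, bits, selDev, selCount, h, if_true, bitVal_decide]
            rw [← ENNReal.ofReal_mul (Real.exp_pos _).le, ← Real.exp_add]
            congr 2; push_cast; ring
          · simp [F, bits, selDev, selCount, h]
      _ = ∫⁻ ω, ∫⁻ z, F (bits pol (fun i => v i ω) t) z ∂μ ∂P := lintegral_bits pol hv hi hμ t F hF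
      _ ≤ _ := lintegral_mono fun ω => ?_
      _ ≤ 1 := ih
    dsimp only [F]
    rw [lintegral_const_mul' _ _ ENNReal.ofReal_ne_top]
    refine mul_le_of_le_one_right zero_le ?_
    split_ifs with h
    · exact lintegral_exp_decision_le μ θ _
    · simp

theorem measure_selDev_le {Ω : Type*} [MeasurableSpace Ω] {P : Measure Ω}
    [IsProbabilityMeasure P]
    (pol : List Bool → ℝ) {v : ℕ → Ω → ℝ} (hv : ∀ i, Measurable (v i)) (hi : iIndepFun v P)
    {μ : Measure ℝ} [IsProbabilityMeasure μ] (hμ : ∀ i, P.map (v i) = μ)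
    (sel : List Bool → Prop) {L : ℝ} (hL : 0 ≤ L) {n : ℕ} (hn : 0 < n) (t : ℕ) :
    P {ω | selCount sel (bits pol (fun i => v i ω) t) = n ∧
      √(n * (L / 2)) ≤ |selDev pol (demand μ) sel (bits pol (fun i => v i ω) t)|}
      ≤ ENNReal.ofReal (2 * Real.exp (-L)) := by
  have hn' : (0 : ℝ) < n := by exact_mod_cast hn
  set ε := √(n * (L / 2)) with hε
  have hε2 : ε ^ 2 = n * (L / 2) := Real.sq_sqrt (by positivity)
  -- Chernoff with θ = ±4ε/n, the optimal choice: θε - θ²n/8 = 2ε²/n = L. Only θ² enters the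
  -- compensator, so both signs are treated at once.
  have key : ∀ θ : ℝ, θ ^ 2 = (4 * ε / n) ^ 2 →
      P {ω | selCount sel (bits pol (fun i => v i ω) t) = n ∧
        4 * ε / n * ε ≤ θ * selDev pol (demand μ) sel (bits pol (fun i => v i ω) t)}
      ≤ ENNReal.ofReal (Real.exp (-L)) := by
    intro θ hθ
    have h1 := lintegral_exp_selDev_le pol hv hi hμ sel θ t
    have hm : Measurable fun ω => ENNReal.ofReal (Real.exp
        (θ * selDev pol (demand μ) sel (bits pol (fun i => v i ω) t)
        - θ ^ 2 / 8 * selCount sel (bits pol (fun i => v i ω) t))) :=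
      (measurable_of_countable fun b : List Bool => ENNReal.ofReal (Real.exp
        (θ * selDev pol (demand μ) sel b - θ ^ 2 / 8 * selCount sel b))).comp
        (measurable_bits pol v t fun i _ => hv i)
    have h2 := mul_meas_ge_le_lintegral (μ := P) hm (ENNReal.ofReal (Real.exp L))
    have h3 := (ENNReal.le_div_iff_mul_le (Or.inl (by simp [Real.exp_pos]))
      (Or.inl ENNReal.ofReal_ne_top)).2 ((mul_comm _ _).trans_le (h2.trans h1))
    have h4 : ENNReal.ofReal (Real.exp (-L)) = 1 / ENNReal.ofReal (Real.exp L) := by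
      rw [Real.exp_neg, ENNReal.ofReal_inv_of_pos (Real.exp_pos _), one_div]
    rw [h4]
    refine le_trans (measure_mono ?_) h3
    rintro ω ⟨hc, hd⟩
    refine ENNReal.ofReal_le_ofReal (Real.exp_le_exp.2 ?_)
    rw [hc, hθ]
    have e1 : (4 * ε / n) ^ 2 / 8 * n = 2 * ε ^ 2 / n := by field_simp; ring
    have e2 : 4 * ε / n * ε = 4 * ε ^ 2 / n := by ring
    rw [e1]; rw [e2] at hd
    have e3 : ε ^ 2 / n = L / 2 := by rw [hε2]; field_simp
    have : 4 * ε ^ 2 / n = 4 * (ε ^ 2 / n) := by ring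
    have : 2 * ε ^ 2 / n = 2 * (ε ^ 2 / n) := by ring
    linarith
  calc _ ≤ P ({ω | selCount sel (bits pol (fun i => v i ω) t) = n ∧
        4 * ε / n * ε ≤ (4 * ε / n) * selDev pol (demand μ) sel (bits pol (fun i => v i ω) t)} ∪
        {ω | selCount sel (bits pol (fun i => v i ω) t) = n ∧
        4 * ε / n * ε ≤ (-(4 * ε / n)) * selDev pol (demand μ) sel (bits pol (fun i => v i ω) t)}) := by
        refine measure_mono ?_
        rintro ω ⟨hc, hd⟩
        have hpos : 0 ≤ 4 * ε / n := by positivity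
        rcases le_abs.1 hd with h | h
        · exact Or.inl ⟨hc, mul_le_mul_of_nonneg_left h hpos⟩
        · refine Or.inr ⟨hc, ?_⟩
          have := mul_le_mul_of_nonneg_left h hpos
          linarith
    _ ≤ _ := measure_union_le _ _
    _ ≤ ENNReal.ofReal (Real.exp (-L)) + ENNReal.ofReal (Real.exp (-L)) :=
        add_le_add (key _ rfl) (key _ (by ring))
    _ = _ := by
        rw [← ENNReal.ofReal_add (Real.exp_pos _).le (Real.exp_pos _).le, two_mul]

/-- A selection stopped after `n` hits is again decided by the past. Its deviation at the horizon
equals that of the original selection when the count was `n`, so control at all times reduces to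
control at time `T` for each `n`. -/
theorem selCount_truncate (sel : List Bool → Prop) (n : ℕ) (bs : List Bool) :
    selCount (fun b => sel b ∧ selCount sel b < n) bs = min (selCount sel bs) n := by
  classical
  induction bs with
  | nil => simp [selCount]
  | cons b bs ih =>
    simp only [selCount, ih]
    split_ifs <;> simp_all <;> omega

theorem selDev_truncate_of_le (pol : List Bool → ℝ) (G : ℝ → ℝ) (sel : List Bool → Prop) (n : ℕ)
    (bs : List Bool) (h : selCount sel bs ≤ n) :
    selDev pol G (fun b => sel b ∧ selCount sel b < n) bs = selDev pol G sel bs := by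
  classical
  induction bs with
  | nil => simp [selDev]
  | cons b bs ih =>
    simp only [selCount] at h
    simp only [selDev, ih (by omega)]
    by_cases hs : sel bs
    · simp only [hs, if_true] at h
      simp [hs, show selCount sel bs < n by omega]
    · simp [hs]

theorem selDev_truncate_of_suffix (pol : List Bool → ℝ) (G : ℝ → ℝ) (sel : List Bool → Prop) (n : ℕ)
    {bs cs : List Bool} (hs : bs <:+ cs) (h : selCount sel bs = n) :
    selDev pol G (fun b => sel b ∧ selCount sel b < n) cs = selDev pol G sel bs := by
  classical
  obtain ⟨ds, rfl⟩ := hs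
  have : selDev pol G (fun b => sel b ∧ selCount sel b < n) (ds ++ bs) = selDev pol G sel bs ∧
      n ≤ selCount sel (ds ++ bs) := by
    induction ds with
    | nil => exact ⟨selDev_truncate_of_le pol G sel n bs h.le, h.ge⟩
    | cons d ds ih =>
      simp only [List.cons_append, selDev, selCount, ih.1]
      refine ⟨?_, by omega⟩
      simp [show ¬ selCount sel (ds ++ bs) < n by omega]
  exact this.1

/-- All the deviations of a selection are within the confidence radius. -/
def SelGood (pol : List Bool → ℝ) (G : ℝ → ℝ) (L : ℝ) (sel : List Bool → Prop)
    (bs : List Bool) : Prop :=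
  |selDev pol G sel bs| ≤ √(selCount sel bs * (L / 2))

/-- The union bound runs over the value of the count rather than over the period. -/
theorem measure_not_selGood_le {Ω : Type*} [MeasurableSpace Ω] {P : Measure Ω}
    [IsProbabilityMeasure P]
    (pol : List Bool → ℝ) {v : ℕ → Ω → ℝ} (hv : ∀ i, Measurable (v i)) (hi : iIndepFun v P)
    {μ : Measure ℝ} [IsProbabilityMeasure μ] (hμ : ∀ i, P.map (v i) = μ)
    (sel : List Bool → Prop) {L : ℝ} (hL : 0 ≤ L) (T : ℕ) :
    P {ω | ∃ bs, bs <:+ bits pol (fun i => v i ω) T ∧ ¬ SelGood pol (demand μ) L sel bs}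
      ≤ ENNReal.ofReal (T * (2 * Real.exp (-L))) := by
  calc _ ≤ P (⋃ n ∈ Finset.Icc 1 T, {ω | selCount (fun b => sel b ∧ selCount sel b < n)
        (bits pol (fun i => v i ω) T) = n ∧ √(n * (L / 2)) ≤
          |selDev pol (demand μ) (fun b => sel b ∧ selCount sel b < n)
            (bits pol (fun i => v i ω) T)|}) := by
        refine measure_mono ?_
        rintro ω ⟨bs, hs, hb⟩
        simp only [Set.mem_iUnion, Set.mem_ofPred_eq, Finset.mem_Icc]
        have hmono : selCount sel bs ≤ selCount sel (bits pol (fun i => v i ω) T) := by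
          obtain ⟨ds, hds⟩ := hs
          rw [← hds]
          clear hds hb
          induction ds with
          | nil => simp
          | cons d ds ih => simp only [List.cons_append, selCount]; omega
        refine ⟨selCount sel bs, ⟨?_, ?_⟩, ?_, ?_⟩
        -- With nothing selected the deviation is 0, so a failure forces a count of at least 1.
        · by_contra h0
          have h0' : selCount sel bs = 0 := by omega
          have : selDev pol (demand μ) sel bs = 0 := by
            clear hb hs hmono h0
            induction bs with
            | nil => rfl
            | cons b bs ih =>
              simp only [selCount] at h0'
              have h1 : ¬ sel bs := by intro h; simp [h] at h0'
              simp [selDev, ih (by omega), h1]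
          exact hb (by simp [SelGood, h0', this])
        · have := selCount_le_length sel bs
          have h2 := hs.length_le
          rw [bits_length] at h2
          omega
        · rw [selCount_truncate]; omega
        · rw [selDev_truncate_of_suffix pol (demand μ) sel _ hs rfl]
          exact (not_le.1 hb).le
    _ ≤ ∑ n ∈ Finset.Icc 1 T, ENNReal.ofReal (2 * Real.exp (-L)) := by
        refine (measure_biUnion_finset_le _ _).trans (Finset.sum_le_sum fun n hn => ?_)
        exact measure_selDev_le pol hv hi hμ _ hL (Finset.mem_Icc.1 hn).1 T
    _ = _ := by
        rw [Finset.sum_const, Nat.card_Icc, nsmul_eq_mul, ENNReal.ofReal_mul (by positivity)]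
        simp

end DyadicSearch

end

/-! ### Expected welfare, and reduction of the regret to a loss on good runs. -/

noncomputable section

namespace DyadicSearch

open MeasureTheory ProbabilityTheory
open scoped ENNReal

/-! ### Demand and welfare -/

theorem ae_mem_unit {μ : Measure ℝ} [IsProbabilityMeasure μ] (h : μ (Set.Icc (0 : ℝ) 1) = 1) :
    ∀ᵐ z ∂μ, z ∈ Set.Icc (0 : ℝ) 1 := by
  rw [← prob_compl_eq_zero_iff measurableSet_Icc] at h
  exact h

theorem demand_antitone (μ : Measure ℝ) [IsProbabilityMeasure μ] : Antitone (demand μ) :=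
  fun _ _ h => measureReal_mono (Set.Ici_subset_Ici.2 h)

theorem demand_nonneg (μ : Measure ℝ) (x : ℝ) : 0 ≤ demand μ x := measureReal_nonneg

theorem demand_le_one (μ : Measure ℝ) [IsProbabilityMeasure μ] (x : ℝ) : demand μ x ≤ 1 :=
  measureReal_le_one

theorem demand_intervalIntegrable (μ : Measure ℝ) [IsProbabilityMeasure μ] (a b : ℝ) :
    IntervalIntegrable (demand μ) volume a b :=
  (demand_antitone μ).intervalIntegrable

theorem measurable_welfare (lam x : ℝ) : Measurable fun z => welfare lam z x := by
  unfold welfare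
  have := measurable_decision x
  fun_prop

/-- Layer-cake formula, translated by `x`; the tail beyond 1 vanishes because the valuations lie in
[0, 1]. -/
theorem integral_max_sub {μ : Measure ℝ} [IsProbabilityMeasure μ] (h : μ (Set.Icc (0 : ℝ) 1) = 1)
    {x : ℝ} (hx : x ∈ Set.Icc (0 : ℝ) 1) :
    ∫ z, max (z - x) 0 ∂μ = ∫ z in x..1, demand μ z := by
  have hae := ae_mem_unit h
  have hint : Integrable (fun z => max (z - x) 0) μ := by
    refine Integrable.of_bound (by fun_prop) 1 ?_
    filter_upwards [hae] with z hz
    rw [Real.norm_eq_abs, abs_of_nonneg (le_max_right _ _)]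
    exact max_le (by linarith [hz.2, hx.1]) zero_le_one
  rw [hint.integral_eq_integral_meas_le (Filter.Eventually.of_forall fun z => le_max_right _ _)]
  have h1 : ∀ t ∈ Set.Ioi (0 : ℝ), μ.real {a | t ≤ max (a - x) 0} = demand μ (x + t) := by
    intro t ht
    unfold demand
    congr 1
    ext a
    have ht' : 0 < t := ht
    simp only [Set.mem_ofPred_eq, Set.mem_Ici, le_max_iff]
    constructor
    · rintro (h | h) <;> linarith
    · intro h; left; linarith
  rw [setIntegral_congr_fun measurableSet_Ioi h1]
  have h2 : ∫ t in Set.Ioi (0 : ℝ), demand μ (x + t) = ∫ t in Set.Ioi x, demand μ t := by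
    rw [← integral_indicator measurableSet_Ioi, ← integral_indicator measurableSet_Ioi,
      ← integral_add_left_eq_self (fun t => (Set.Ioi x).indicator (demand μ) t) x]
    congr 1
    funext t
    simp [Set.indicator_apply]
  rw [h2, intervalIntegral.integral_of_le hx.2]
  refine (setIntegral_eq_of_subset_of_forall_sdiff_eq_zero measurableSet_Ioi Set.Ioc_subset_Ioi_self
    ?_)
  rintro t ⟨ht1, ht2⟩
  have ht : 1 < t := by
    by_contra hc
    exact ht2 ⟨ht1, not_lt.1 hc⟩
  unfold demand
  rw [measureReal_eq_zero_iff]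
  refine measure_mono_null ?_ (mem_ae_iff.1 hae)
  intro z hz hz'
  exact absurd hz'.2 (not_le.2 (lt_of_lt_of_le ht hz))

theorem integral_welfare {μ : Measure ℝ} [IsProbabilityMeasure μ] (h : μ (Set.Icc (0 : ℝ) 1) = 1)
    (lam : ℝ) {x : ℝ} (hx : x ∈ Set.Icc (0 : ℝ) 1) :
    ∫ z, welfare lam z x ∂μ = expWelfare lam μ x := by
  unfold welfare expWelfare
  rw [integral_add, integral_const_mul, integral_const_mul, integral_max_sub h hx,
    demand_eq_integral]
  · refine Integrable.const_mul (Integrable.of_bound (measurable_decision x).aestronglyMeasurable 1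
      (Filter.Eventually.of_forall fun z => ?_)) _
    have := decision_mem z x
    rw [Real.norm_eq_abs, abs_of_nonneg this.1]
    exact this.2
  · refine Integrable.const_mul (Integrable.of_bound (by fun_prop) 1 ?_) _
    filter_upwards [ae_mem_unit h] with z hz
    rw [Real.norm_eq_abs, abs_of_nonneg (le_max_right _ _)]
    exact max_le (by linarith [hz.2, hx.1]) zero_le_one

theorem welfare_nonneg {lam : ℝ} (hlam : 0 ≤ lam) {x : ℝ} (hx : 0 ≤ x) (z : ℝ) :
    0 ≤ welfare lam z x :=
  add_nonneg (mul_nonneg hx (decision_mem z x).1) (mul_nonneg hlam (le_max_right _ _))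

theorem welfare_le_one {lam : ℝ} (hlam : lam ≤ 1) {x z : ℝ}
    (hz : z ∈ Set.Icc (0 : ℝ) 1) : welfare lam z x ≤ 1 := by
  unfold welfare decision
  split_ifs with h
  · rw [max_eq_left (by linarith)]
    nlinarith [hz.2]
  · rw [max_eq_right (by linarith)]
    simp

theorem expWelfare_mem {μ : Measure ℝ} [IsProbabilityMeasure μ] (h : μ (Set.Icc (0 : ℝ) 1) = 1)
    {lam : ℝ} (hlam0 : 0 ≤ lam) (hlam : lam ≤ 1) {x : ℝ} (hx : x ∈ Set.Icc (0 : ℝ) 1) :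
    expWelfare lam μ x ∈ Set.Icc (0 : ℝ) 1 := by
  rw [← integral_welfare h lam hx]
  have hae := ae_mem_unit h
  refine ⟨integral_nonneg fun z => welfare_nonneg hlam0 hx.1 z, ?_⟩
  calc _ ≤ ∫ _, (1 : ℝ) ∂μ := by
        refine integral_mono_of_nonneg (Filter.Eventually.of_forall fun z =>
          welfare_nonneg hlam0 hx.1 z) (integrable_const _) ?_
        filter_upwards [hae] with z hz using welfare_le_one hlam hz
    _ = 1 := by simp

theorem expWelfare_sub (lam : ℝ) (μ : Measure ℝ) [IsProbabilityMeasure μ] (a b : ℝ) :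
    expWelfare lam μ b - expWelfare lam μ a
      = b * demand μ b - a * demand μ a - lam * ∫ z in a..b, demand μ z := by
  unfold expWelfare
  rw [← intervalIntegral.integral_add_adjacent_intervals (demand_intervalIntegrable μ a b)
    (demand_intervalIntegrable μ b 1)]
  ring

/-- One-sided Lipschitz bound: raising the tax lowers the demand and the private welfare, so the
gain is at most the extra tax (b - a) G(b). No uniform bound holds downwards, where the demand may
jump; this is why losses to the right of the optimum need concavity instead. -/
theorem expWelfare_sub_le {lam : ℝ} (hlam0 : 0 ≤ lam) (μ : Measure ℝ) [IsProbabilityMeasure μ]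
    {a b : ℝ} (ha : 0 ≤ a) (hab : a ≤ b) :
    expWelfare lam μ b - expWelfare lam μ a ≤ b - a := by
  rw [expWelfare_sub]
  have h1 : 0 ≤ ∫ z in a..b, demand μ z :=
    intervalIntegral.integral_nonneg hab fun z _ => demand_nonneg μ z
  have h2 := demand_antitone μ hab
  have h3 := demand_le_one μ b
  have h4 := demand_nonneg μ b
  nlinarith [mul_nonneg hlam0 h1, mul_nonneg ha (sub_nonneg.2 h2),
    mul_nonneg (sub_nonneg.2 hab) (sub_nonneg.2 h3)]

/-! ### Reduction of the regret -/

/-- Cumulative loss of expected welfare along a list of bits, compared with the level `w`. -/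
def lossSum (W : ℝ → ℝ) (w : ℝ) (pol : List Bool → ℝ) : List Bool → ℝ
  | [] => 0
  | _ :: bs => lossSum W w pol bs + (w - W (pol bs))

theorem sum_range_loss (W : ℝ → ℝ) (w : ℝ) (pol : List Bool → ℝ) (v : ℕ → ℝ) (T : ℕ) :
    ∑ i ∈ Finset.range T, (w - W (pol (bits pol v i))) = lossSum W w pol (bits pol v T) := by
  induction T with
  | zero => rfl
  | succ T ih => rw [Finset.sum_range_succ, ih]; rfl

section Reduction

variable {Ω : Type*} [MeasurableSpace Ω] {P : Measure Ω}
  {pol : List Bool → ℝ} {v : ℕ → Ω → ℝ} {μ : Measure ℝ} [IsProbabilityMeasure μ] {lam : ℝ}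

theorem ae_welfare_norm_le (hv : ∀ i, Measurable (v i)) (hμ : ∀ i, P.map (v i) = μ)
    (h : μ (Set.Icc (0 : ℝ) 1) = 1) (hlam0 : 0 ≤ lam) (hlam : lam ≤ 1)
    (hpol : ∀ bs, 0 ≤ pol bs) (t : ℕ) :
    ∀ᵐ ω ∂P, ‖welfare lam (v t ω) (pol (bits pol (fun i => v i ω) t))‖ ≤ 1 := by
  have hae := ae_mem_unit h
  rw [← hμ t] at hae
  filter_upwards [ae_of_ae_map (hv t).aemeasurable hae] with ω hω
  rw [Real.norm_eq_abs, abs_of_nonneg (welfare_nonneg hlam0 (hpol _) _)]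
  exact welfare_le_one hlam hω

theorem ae_welfare_const_norm_le (hv : ∀ i, Measurable (v i)) (hμ : ∀ i, P.map (v i) = μ)
    (h : μ (Set.Icc (0 : ℝ) 1) = 1) (hlam0 : 0 ≤ lam) (hlam : lam ≤ 1)
    {x : ℝ} (hx : 0 ≤ x) (t : ℕ) : ∀ᵐ ω ∂P, ‖welfare lam (v t ω) x‖ ≤ 1 := by
  have hae := ae_mem_unit h
  rw [← hμ t] at hae
  filter_upwards [ae_of_ae_map (hv t).aemeasurable hae] with ω hω
  rw [Real.norm_eq_abs, abs_of_nonneg (welfare_nonneg hlam0 hx _)]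
  exact welfare_le_one hlam hω

variable [IsProbabilityMeasure P]

/-- Serves the short horizons, for which the invariant of the algorithm is not established;
nonnegative policies are all it needs. -/
theorem integral_regret_le_horizon (hv : ∀ i, Measurable (v i))
    (hμ : ∀ i, P.map (v i) = μ) (h : μ (Set.Icc (0 : ℝ) 1) = 1) (hlam0 : 0 ≤ lam) (hlam : lam ≤ 1)
    (hpol : ∀ bs, 0 ≤ pol bs) {x : ℝ} (hx : x ∈ Set.Icc (0 : ℝ) 1) (T : ℕ) :
    ∫ ω, ((∑ i ∈ Finset.range T, welfare lam (v i ω) x)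
      - ∑ i ∈ Finset.range T, welfare lam (v i ω) (pol (bits pol (fun i => v i ω) i))) ∂P ≤ T := by
  have i1 : ∀ t, Integrable (fun ω => welfare lam (v t ω) x) P := fun t =>
    Integrable.of_bound ((measurable_welfare lam x).comp (hv t)).aestronglyMeasurable 1
      (ae_welfare_const_norm_le hv hμ h hlam0 hlam hx.1 t)
  have i2 : ∀ t, Integrable
      (fun ω => welfare lam (v t ω) (pol (bits pol (fun i => v i ω) t))) P := fun t =>
    integrable_bits pol hv (f := fun b z => welfare lam z (pol b))
      (fun b => measurable_welfare lam _) (ae_welfare_norm_le hv hμ h hlam0 hlam hpol t)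
  rw [integral_sub (integrable_finsetSum _ fun t _ => i1 t)
    (integrable_finsetSum _ fun t _ => i2 t), integral_finsetSum _ fun t _ => i1 t]
  have h2 : 0 ≤ ∫ ω, ∑ i ∈ Finset.range T,
      welfare lam (v i ω) (pol (bits pol (fun i => v i ω) i)) ∂P :=
    integral_nonneg fun ω => Finset.sum_nonneg fun t _ => welfare_nonneg hlam0 (hpol _) _
  have h1 : ∑ i ∈ Finset.range T, ∫ ω, welfare lam (v i ω) x ∂P ≤ ∑ i ∈ Finset.range T, (1 : ℝ) := by
    refine Finset.sum_le_sum fun t _ => ?_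
    calc _ ≤ ∫ _, (1 : ℝ) ∂P := by
          refine integral_mono_ae (i1 t) (integrable_const _) ?_
          filter_upwards [ae_welfare_const_norm_le hv hμ h hlam0 hlam hx.1 t] with ω hω
          exact (le_abs_self _).trans hω
      _ = 1 := by simp
  simp only [Finset.sum_const, Finset.card_range, nsmul_eq_mul, mul_one] at h1
  linarith

/-- Conditioning on the past bits turns realized welfare into expected welfare exactly, so no
concentration of the welfare itself is needed. Off the good event each of the `T` periods loses at
most 1. -/
theorem integral_regret_le_of_good (hv : ∀ i, Measurable (v i)) (hi : iIndepFun v P)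
    (hμ : ∀ i, P.map (v i) = μ) (h : μ (Set.Icc (0 : ℝ) 1) = 1) (hlam0 : 0 ≤ lam) (hlam : lam ≤ 1)
    (hpol : ∀ bs, pol bs ∈ Set.Icc (0 : ℝ) 1) {x : ℝ} (hx : x ∈ Set.Icc (0 : ℝ) 1) (T : ℕ)
    (good : List Bool → Prop) {B p : ℝ} (hB : 0 ≤ B) (hp : 0 ≤ p)
    (hgood : ∀ bs, bs.length = T → good bs →
      lossSum (expWelfare lam μ) (expWelfare lam μ x) pol bs ≤ B)
    (hbad : P {ω | ¬ good (bits pol (fun i => v i ω) T)} ≤ ENNReal.ofReal p) :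
    ∫ ω, ((∑ i ∈ Finset.range T, welfare lam (v i ω) x)
      - ∑ i ∈ Finset.range T, welfare lam (v i ω) (pol (bits pol (fun i => v i ω) i))) ∂P
      ≤ B + T * p := by
  classical
  set W := expWelfare lam μ with hW
  have i1 : ∀ t, Integrable (fun ω => welfare lam (v t ω) x) P := fun t =>
    Integrable.of_bound ((measurable_welfare lam x).comp (hv t)).aestronglyMeasurable 1
      (ae_welfare_const_norm_le hv hμ h hlam0 hlam hx.1 t)
  have i2 : ∀ t, Integrable
      (fun ω => welfare lam (v t ω) (pol (bits pol (fun i => v i ω) t))) P := fun t =>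
    integrable_bits pol hv (f := fun b z => welfare lam z (pol b))
      (fun b => measurable_welfare lam _)
      (ae_welfare_norm_le hv hμ h hlam0 hlam (fun bs => (hpol bs).1) t)
  have hWb : ∀ bs, W (pol bs) ∈ Set.Icc (0 : ℝ) 1 := fun bs =>
    expWelfare_mem h hlam0 hlam (hpol bs)
  have i3 : ∀ t, Integrable (fun ω => W (pol (bits pol (fun i => v i ω) t))) P := fun t =>
    Integrable.of_bound ((measurable_of_countable (fun b : List Bool => W (pol b))).comp
      (measurable_bits pol v t fun i _ => hv i)).aestronglyMeasurable 1
      (Filter.Eventually.of_forall fun ω => by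
        rw [Real.norm_eq_abs, abs_of_nonneg (hWb _).1]; exact (hWb _).2)
  have e1 : ∀ t, ∫ ω, welfare lam (v t ω) x ∂P = W x := fun t => by
    rw [hW, ← integral_welfare h lam hx, ← hμ t,
      integral_map (hv t).aemeasurable (measurable_welfare lam x).aestronglyMeasurable]
  have e2 : ∀ t, ∫ ω, welfare lam (v t ω) (pol (bits pol (fun i => v i ω) t)) ∂P
      = ∫ ω, W (pol (bits pol (fun i => v i ω) t)) ∂P := fun t => by
    rw [integral_bits pol hv hi hμ t (f := fun b z => welfare lam z (pol b))
      (fun b => measurable_welfare lam _)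
      (ae_welfare_norm_le hv hμ h hlam0 hlam (fun bs => (hpol bs).1) t)]
    exact integral_congr_ae (Filter.Eventually.of_forall fun ω => integral_welfare h lam (hpol _))
  rw [integral_sub (integrable_finsetSum _ fun t _ => i1 t)
    (integrable_finsetSum _ fun t _ => i2 t), integral_finsetSum _ fun t _ => i1 t,
    integral_finsetSum _ fun t _ => i2 t, Finset.sum_congr rfl fun t _ => e1 t,
    Finset.sum_congr rfl fun t _ => e2 t, ← integral_finsetSum _ fun t _ => i3 t]
  have hm : MeasurableSet {ω | ¬ good (bits pol (fun i => v i ω) T)} :=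
    (measurable_bits pol v T fun i _ => hv i) (MeasurableSet.of_discrete (s := {b | ¬ good b}))
  have hconst : ∑ _i ∈ Finset.range T, W x = ∫ _, ∑ _i ∈ Finset.range T, W x ∂P := by simp
  rw [hconst, ← integral_sub (integrable_const _) (integrable_finsetSum _ fun t _ => i3 t)]
  have hle : ∀ ω, (∑ _i ∈ Finset.range T, W x -
      ∑ i ∈ Finset.range T, W (pol (bits pol (fun i => v i ω) i)))
      ≤ B + {ω | ¬ good (bits pol (fun i => v i ω) T)}.indicator (fun _ => (T : ℝ)) ω := by
    intro ω
    rw [← Finset.sum_sub_distrib]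
    by_cases hg : good (bits pol (fun i => v i ω) T)
    · have := hgood _ (bits_length _ _ _) hg
      rw [← sum_range_loss] at this
      simpa [Set.indicator_apply, hg] using this
    · rw [Set.indicator_of_mem hg]
      have : ∑ i ∈ Finset.range T, (W x - W (pol (bits pol (fun i => v i ω) i)))
          ≤ ∑ i ∈ Finset.range T, (1 : ℝ) := by
        refine Finset.sum_le_sum fun t _ => ?_
        have h1 := expWelfare_mem h hlam0 hlam hx
        have h2 := hWb (bits pol (fun i => v i ω) t)
        linarith [h1.2, h2.1]
      simp only [Finset.sum_const, Finset.card_range, nsmul_eq_mul, mul_one] at this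
      linarith
  have hind : Integrable ({ω | ¬ good (bits pol (fun i => v i ω) T)}.indicator
      (fun _ => (T : ℝ))) P := (integrable_const _).indicator hm
  calc _ ≤ ∫ ω, (B + {ω | ¬ good (bits pol (fun i => v i ω) T)}.indicator
        (fun _ => (T : ℝ)) ω) ∂P :=
        integral_mono ((integrable_const _).sub (integrable_finsetSum _ fun t _ => i3 t))
          ((integrable_const _).add hind) hle
    _ = B + P.real {ω | ¬ good (bits pol (fun i => v i ω) T)} * T := by
        rw [integral_add (integrable_const _) hind, integral_indicator_const _ hm]
        simp
    _ ≤ B + p * T := by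
        gcongr
        exact ENNReal.toReal_le_of_le_ofReal hp hbad
    _ = _ := by ring

end Reduction

end DyadicSearch

end

/-! ### Statistics of a history and the dyadic structure of the sweeps. -/

noncomputable section

namespace DyadicSearch

/-! ### Histories -/

theorem numAt_append (h : History) (p : ℝ × ℝ) (x : ℝ) :
    numAt (h ++ [p]) x = numAt h x + if p.1 = x then 1 else 0 := by
  simp [numAt, List.countP_append, List.countP_cons]

theorem rawNum_append (h : History) (p : ℝ × ℝ) (a b : ℝ) :
    rawNum (h ++ [p]) a b = rawNum h a b + if a < p.1 ∧ p.1 < b then 1 else 0 := by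
  simp [rawNum, List.countP_append, List.countP_cons]

/-- Sum of the decisions at policies in `(a, b)`. -/
def sumIn (h : History) (a b : ℝ) : ℝ :=
  ((h.filter (fun p => decide (a < p.1 ∧ p.1 < b))).map Prod.snd).sum

theorem sumIn_append_of_not_mem (h : History) {p : ℝ × ℝ} {a b : ℝ} (hp : ¬ (a < p.1 ∧ p.1 < b)) :
    sumIn (h ++ [p]) a b = sumIn h a b := by
  simp [sumIn, List.filter_append, hp]

theorem demAt_append_of_ne (h : History) {p : ℝ × ℝ} {x : ℝ} (hp : p.1 ≠ x) :
    demAt (h ++ [p]) x = demAt h x := by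
  simp [demAt, numAt_append, List.filter_append, hp]

theorem numAt_append_of_ne (h : History) {p : ℝ × ℝ} {x : ℝ} (hp : p.1 ≠ x) :
    numAt (h ++ [p]) x = numAt h x := by
  simp [numAt_append, hp]

theorem findGreatest_congr {P Q : ℕ → Prop} {_ : DecidablePred P} {_ : DecidablePred Q} (n : ℕ)
    (h : ∀ k ≤ n, P k ↔ Q k) : Nat.findGreatest P n = Nat.findGreatest Q n := by
  induction n with
  | zero => rfl
  | succ n ih =>
    rw [Nat.findGreatest_succ, Nat.findGreatest_succ, ih fun k hk => h k (by omega)]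
    by_cases hP : P (n + 1)
    · simp [hP, (h _ le_rfl).1 hP]
    · simp [hP, mt (h _ le_rfl).2 hP]

open Classical in
theorem truncTime_of_pow (h : History) (a b : ℝ) (hp : ∃ m : ℕ, 1 + rawNum h a b = 2 ^ m) :
    truncTime h a b = h.length := by
  unfold truncTime
  refine Nat.findGreatest_eq ?_
  rwa [List.take_length]

open Classical in
theorem truncTime_append_of_not_pow (h : History) (p : ℝ × ℝ) (a b : ℝ)
    (hp : ¬ ∃ m : ℕ, 1 + rawNum (h ++ [p]) a b = 2 ^ m) :
    truncTime (h ++ [p]) a b = truncTime h a b := by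
  unfold truncTime
  have hl : (h ++ [p]).length = h.length + 1 := by simp
  have : (h ++ [p]).take (h.length + 1) = h ++ [p] := by rw [← hl, List.take_length]
  rw [hl, Nat.findGreatest_succ, if_neg (by rwa [this])]
  apply findGreatest_congr
  intro k hk
  rw [List.take_append_of_le_length hk]

open Classical in
theorem truncTime_le (h : History) (a b : ℝ) : truncTime h a b ≤ h.length :=
  Nat.findGreatest_le _

theorem numIn_of_pow (h : History) (a b : ℝ) (hp : ∃ m : ℕ, 1 + rawNum h a b = 2 ^ m) :
    numIn h a b = rawNum h a b := by
  rw [numIn, truncTime_of_pow h a b hp, List.take_length]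

theorem demIn_of_pow (h : History) (a b : ℝ) (hp : ∃ m : ℕ, 1 + rawNum h a b = 2 ^ m) :
    demIn h a b = sumIn h a b / (rawNum h a b + 1) := by
  rw [demIn, numIn_of_pow h a b hp, truncTime_of_pow h a b hp, List.take_length, sumIn]

theorem numIn_append_of_not_pow (h : History) (p : ℝ × ℝ) (a b : ℝ)
    (hp : ¬ ∃ m : ℕ, 1 + rawNum (h ++ [p]) a b = 2 ^ m) :
    numIn (h ++ [p]) a b = numIn h a b := by
  rw [numIn, truncTime_append_of_not_pow h p a b hp,
    List.take_append_of_le_length (truncTime_le h a b), numIn]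

theorem demIn_append_of_not_pow (h : History) (p : ℝ × ℝ) (a b : ℝ)
    (hp : ¬ ∃ m : ℕ, 1 + rawNum (h ++ [p]) a b = 2 ^ m) :
    demIn (h ++ [p]) a b = demIn h a b := by
  rw [demIn, numIn_append_of_not_pow h p a b hp, truncTime_append_of_not_pow h p a b hp,
    List.take_append_of_le_length (truncTime_le h a b), demIn]

/-- The truncation time may well move to the new period, when one plus the count is a power of 2,
but the policies counted are the same. -/
theorem numIn_append_of_not_mem (h : History) {p : ℝ × ℝ} {a b : ℝ} (hp : ¬ (a < p.1 ∧ p.1 < b)) :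
    numIn (h ++ [p]) a b = numIn h a b := by
  by_cases hq : ∃ m : ℕ, 1 + rawNum (h ++ [p]) a b = 2 ^ m
  · rw [numIn_of_pow _ a b hq]
    rw [rawNum_append, if_neg hp, add_zero] at hq ⊢
    rw [numIn_of_pow _ a b hq]
  · exact numIn_append_of_not_pow h p a b hq

theorem demIn_append_of_not_mem (h : History) {p : ℝ × ℝ} {a b : ℝ} (hp : ¬ (a < p.1 ∧ p.1 < b)) :
    demIn (h ++ [p]) a b = demIn h a b := by
  by_cases hq : ∃ m : ℕ, 1 + rawNum (h ++ [p]) a b = 2 ^ m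
  · rw [demIn_of_pow _ a b hq, sumIn_append_of_not_mem h hp]
    rw [rawNum_append, if_neg hp, add_zero] at hq ⊢
    rw [demIn_of_pow _ a b hq]
  · exact demIn_append_of_not_pow h p a b hq

open Classical in
/-- Number of past periods with policy in `U`. -/
def countIn (U : Set ℝ) (h : History) : ℕ := h.countP fun p => decide (p.1 ∈ U)

open Classical in
/-- Sum of the centered decisions over the periods with policy in `U`. -/
def devIn (G : ℝ → ℝ) (U : Set ℝ) (h : History) : ℝ :=
  (h.map fun p => if p.1 ∈ U then p.2 - G p.1 else 0).sum

open Classical in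
theorem countIn_append (U : Set ℝ) (h : History) (p : ℝ × ℝ) :
    countIn U (h ++ [p]) = countIn U h + if p.1 ∈ U then 1 else 0 := by
  simp [countIn, List.countP_append, List.countP_cons]

open Classical in
theorem devIn_append (G : ℝ → ℝ) (U : Set ℝ) (h : History) (p : ℝ × ℝ) :
    devIn G U (h ++ [p]) = devIn G U h + if p.1 ∈ U then p.2 - G p.1 else 0 := by
  simp [devIn]

theorem countIn_singleton (h : History) (x : ℝ) : countIn {x} h = numAt h x := by
  simp [countIn, numAt]

theorem countIn_Ioo (h : History) (a b : ℝ) : countIn (Set.Ioo a b) h = rawNum h a b := by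
  simp [countIn, rawNum]

theorem devIn_singleton (G : ℝ → ℝ) (h : History) (x : ℝ) :
    devIn G {x} h
      = ((h.filter (fun p => decide (p.1 = x))).map Prod.snd).sum - numAt h x * G x := by
  induction h with
  | nil => simp [devIn, numAt]
  | cons p h ih =>
    simp only [devIn, numAt, List.map_cons, List.sum_cons, List.filter_cons, List.countP_cons,
      Set.mem_singleton_iff] at ih ⊢
    rw [ih]
    by_cases hp : p.1 = x
    · simp [hp]; ring
    · simp [hp]

theorem devIn_Ioo (G : ℝ → ℝ) (h : History) (a b : ℝ) :
    devIn G (Set.Ioo a b) h = sumIn h a b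
      - ((h.filter (fun p => decide (a < p.1 ∧ p.1 < b))).map fun p => G p.1).sum := by
  induction h with
  | nil => simp [devIn, sumIn]
  | cons p h ih =>
    simp only [devIn, sumIn, List.map_cons, List.sum_cons, List.filter_cons, Set.mem_Ioo]
      at ih ⊢
    rw [ih]
    by_cases hp : a < p.1 ∧ p.1 < b
    · simp [hp]; ring
    · simp [hp]

/-! ### Dyadic grids -/

/-- The points of the dyadic subdivision of `(a, b)` of depth `m`. -/
def OnGrid (a b : ℝ) (m : ℕ) (x : ℝ) : Prop := ∃ q : ℤ, x = a + (b - a) * (q / 2 ^ m)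

/-- The first `k` midpoints of the dyadic subdivision of `(a, b)` of depth `m`. -/
def InSweep (a b : ℝ) (m k : ℕ) (x : ℝ) : Prop :=
  ∃ q : ℕ, q < k ∧ x = a + (b - a) * ((q + 1 / 2) / 2 ^ m)

open Classical in
/-- The policies in `(a, b)` are the dyadic points of depth `m` followed by the first `k` points of
the sweep of depth `m + 1`, each of them chosen once. -/
structure Cell (h : History) (a b : ℝ) (m k : ℕ) : Prop where
  count : ∀ x, a < x → x < b → numAt h x = if OnGrid a b m x ∨ InSweep a b m k x then 1 else 0
  raw : rawNum h a b + 1 = 2 ^ m + k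
  num : numIn h a b + 1 = 2 ^ m
  lt : k < 2 ^ m

theorem not_inSweep_zero (a b : ℝ) (m : ℕ) (x : ℝ) : ¬ InSweep a b m 0 x := by
  rintro ⟨q, hq, -⟩; omega

/-- The counts identify the multiset of policies in the interval with the interior grid. Applied to
`f = 1` this gives the number of samples, applied to the demand it gives the Riemann sum that
governs the bias. -/
theorem sum_filter_eq_of_count {h : History} {a b : ℝ} (hab : a < b) {m : ℕ}
    (hc : ∀ x, a < x → x < b → (OnGrid a b m x → numAt h x = 1) ∧ (¬ OnGrid a b m x → numAt h x = 0))
    (f : ℝ → ℝ) :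
    ((h.filter (fun p => decide (a < p.1 ∧ p.1 < b))).map fun p => f p.1).sum
      = ∑ q ∈ Finset.range (2 ^ m - 1), f (a + (b - a) * ((q + 1 : ℕ) / 2 ^ m)) := by
  classical
  set l := (h.filter (fun p => decide (a < p.1 ∧ p.1 < b))).map Prod.fst with hl
  have h2 : (0 : ℝ) < 2 ^ m := by positivity
  have hcount : ∀ x, a < x → x < b → l.count x = numAt h x := by
    intro x hx1 hx2
    rw [hl, numAt, List.count, List.countP_map, List.countP_filter]
    refine List.countP_congr fun p _ => ?_
    simp only [Function.comp, beq_iff_eq, decide_eq_true_eq, Bool.and_eq_true]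
    constructor
    · rintro ⟨h1, -⟩; exact h1
    · rintro rfl; exact ⟨rfl, hx1, hx2⟩
  have hmem : ∀ x ∈ l, a < x ∧ x < b := by
    intro x hx
    rw [hl, List.mem_map] at hx
    obtain ⟨p, hp, rfl⟩ := hx
    simpa using (List.mem_filter.1 hp).2
  have hset : l.toFinset = (Finset.range (2 ^ m - 1)).image
      fun q : ℕ => a + (b - a) * (((q + 1 : ℕ) : ℝ) / 2 ^ m) := by
    ext x
    simp only [List.mem_toFinset, Finset.mem_image, Finset.mem_range]
    constructor
    · intro hx
      obtain ⟨hx1, hx2⟩ := hmem x hx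
      have hpos := List.count_pos_iff.2 hx
      rw [hcount x hx1 hx2] at hpos
      by_cases hg : OnGrid a b m x
      · obtain ⟨q, rfl⟩ := hg
        have q1 : (0 : ℝ) < q := by
          by_contra hq
          have : (q : ℝ) / 2 ^ m ≤ 0 := div_nonpos_of_nonpos_of_nonneg (not_lt.1 hq) h2.le
          nlinarith
        have q2 : (q : ℝ) < 2 ^ m := by
          by_contra hq
          have : 1 ≤ (q : ℝ) / 2 ^ m := (one_le_div h2).2 (not_lt.1 hq)
          nlinarith
        have q1' : 0 < q := by exact_mod_cast q1
        have q2' : q < 2 ^ m := by exact_mod_cast q2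
        refine ⟨(q - 1).toNat, ?_, ?_⟩
        · have : ((2 ^ m : ℕ) : ℤ) = 2 ^ m := by push_cast; rfl
          omega
        · have : (((q - 1).toNat + 1 : ℕ) : ℝ) = q := by
            have : (((q - 1).toNat + 1 : ℕ) : ℤ) = q := by omega
            exact_mod_cast this
          rw [this]
      · rw [(hc x hx1 hx2).2 hg] at hpos; omega
    · rintro ⟨q, hq, rfl⟩
      have q2 : ((q + 1 : ℕ) : ℝ) < 2 ^ m := by
        have : q + 1 < 2 ^ m := by omega
        exact_mod_cast this
      have q1 : (0 : ℝ) < (q + 1 : ℕ) := by positivity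
      have r1 : (0 : ℝ) < (q + 1 : ℕ) / 2 ^ m := by positivity
      have r2 : ((q + 1 : ℕ) : ℝ) / 2 ^ m < 1 := (div_lt_one h2).2 q2
      have hx1 : a < a + (b - a) * (((q + 1 : ℕ) : ℝ) / 2 ^ m) := by nlinarith
      have hx2 : a + (b - a) * (((q + 1 : ℕ) : ℝ) / 2 ^ m) < b := by nlinarith
      rw [← List.count_pos_iff, hcount _ hx1 hx2, (hc _ hx1 hx2).1 ⟨(q + 1 : ℕ), by push_cast; rfl⟩]
      exact one_pos
  have hmap : ((h.filter (fun p => decide (a < p.1 ∧ p.1 < b))).map fun p => f p.1) = l.map f := by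
    rw [hl, List.map_map]; rfl
  rw [hmap, Finset.sum_list_map_count, hset, Finset.sum_image]
  · refine Finset.sum_congr rfl fun q hq => ?_
    have hq' : a + (b - a) * (((q + 1 : ℕ) : ℝ) / 2 ^ m) ∈ l := by
      rw [← List.mem_toFinset, hset]
      exact Finset.mem_image_of_mem _ hq
    obtain ⟨hx1, hx2⟩ := hmem _ hq'
    rw [hcount _ hx1 hx2, (hc _ hx1 hx2).1 ⟨(q + 1 : ℕ), by push_cast; rfl⟩, one_smul]
  · intro q _ q' _ hqq
    have hba : b - a ≠ 0 := by linarith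
    have := mul_left_cancel₀ hba (add_left_cancel hqq)
    have h3 : ((q + 1 : ℕ) : ℝ) = (q' + 1 : ℕ) := by
      field_simp at this; exact this
    have : q + 1 = q' + 1 := by exact_mod_cast h3
    omega

theorem cell_zero_of_count {h : History} {a b : ℝ} (hab : a < b) {m : ℕ}
    (hc : ∀ x, a < x → x < b → (OnGrid a b m x → numAt h x = 1) ∧
      (¬ OnGrid a b m x → numAt h x = 0)) : Cell h a b m 0 := by
  have hraw : rawNum h a b + 1 = 2 ^ m := by
    have := sum_filter_eq_of_count hab hc fun _ => 1
    simp only [List.map_const', List.sum_replicate, Finset.sum_const, Finset.card_range,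
      nsmul_eq_mul, mul_one] at this
    have h2 : (h.filter (fun p => decide (a < p.1 ∧ p.1 < b))).length = 2 ^ m - 1 := by
      exact_mod_cast this
    rw [rawNum, List.countP_eq_length_filter, h2]
    have : 0 < 2 ^ m := by positivity
    omega
  refine ⟨fun x hx1 hx2 => ?_, by simpa using hraw, ?_, by positivity⟩
  · by_cases hg : OnGrid a b m x
    · simp [hg, (hc x hx1 hx2).1 hg]
    · simp [hg, (hc x hx1 hx2).2 hg, not_inSweep_zero]
  · rw [numIn_of_pow h a b ⟨m, by omega⟩, hraw]

theorem Cell.grid_count {h : History} {a b : ℝ} {m : ℕ} (hc : Cell h a b m 0) (x : ℝ) (h1 : a < x)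
    (h2 : x < b) : (OnGrid a b m x → numAt h x = 1) ∧ (¬ OnGrid a b m x → numAt h x = 0) := by
  have := hc.count x h1 h2
  constructor <;> intro hg <;> simpa [hg, not_inSweep_zero] using this

theorem Cell.numAt_le_one {h : History} {a b : ℝ} {m k : ℕ} (hc : Cell h a b m k) {x : ℝ}
    (h1 : a < x) (h2 : x < b) : numAt h x ≤ 1 := by
  rw [hc.count x h1 h2]; split_ifs <;> omega

theorem Cell.left_half {h : History} {a b c : ℝ} (hab : a < b) (hcm : c = (a + b) / 2) {m : ℕ}
    (hc : Cell h a b m 0) : ∃ m', Cell h a c m' 0 := by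
  -- The subtraction is truncated on purpose: at depth 0 the interval has no interior grid point,
  -- and neither has its half.
  refine ⟨m - 1, cell_zero_of_count (by linarith) fun x hx1 hx2 => ?_⟩
  have h3 := hc.grid_count x hx1 (by linarith)
  suffices h : OnGrid a b m x ↔ OnGrid a c (m - 1) x by rwa [h] at h3
  rcases m with _ | m
  · constructor
    · rintro ⟨q, hq⟩
      simp only [pow_zero, div_one] at hq
      exfalso
      have q1 : (0 : ℝ) < q := by by_contra hq'; nlinarith
      have q2 : (q : ℝ) < 1 := by by_contra hq'; nlinarith
      have q1' : 0 < q := by exact_mod_cast q1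
      have q2' : q < 1 := by exact_mod_cast q2
      omega
    · rintro ⟨q, hq⟩
      simp only [Nat.zero_sub, pow_zero, div_one] at hq
      exfalso
      have q1 : (0 : ℝ) < q := by by_contra hq'; nlinarith
      have q2 : (q : ℝ) < 1 := by by_contra hq'; nlinarith
      have q1' : 0 < q := by exact_mod_cast q1
      have q2' : q < 1 := by exact_mod_cast q2
      omega
  · have e : ∀ q : ℤ, a + (b - a) * ((q : ℝ) / 2 ^ (m + 1)) = a + (c - a) * (q / 2 ^ m) := by
      intro q; rw [hcm, pow_succ]; field_simp; ring
    simp only [OnGrid, e, Nat.add_sub_cancel]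

theorem Cell.right_half {h : History} {a b c : ℝ} (hab : a < b) (hcm : c = (a + b) / 2) {m : ℕ}
    (hc : Cell h a b m 0) : ∃ m', Cell h c b m' 0 := by
  refine ⟨m - 1, cell_zero_of_count (by linarith) fun x hx1 hx2 => ?_⟩
  have h3 := hc.grid_count x (by linarith) hx2
  suffices h : OnGrid a b m x ↔ OnGrid c b (m - 1) x by rwa [h] at h3
  rcases m with _ | m
  · constructor
    · rintro ⟨q, hq⟩
      simp only [pow_zero, div_one] at hq
      exfalso
      have q1 : (0 : ℝ) < q := by by_contra hq'; nlinarith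
      have q2 : (q : ℝ) < 1 := by by_contra hq'; nlinarith
      have q1' : 0 < q := by exact_mod_cast q1
      have q2' : q < 1 := by exact_mod_cast q2
      omega
    · rintro ⟨q, hq⟩
      simp only [Nat.zero_sub, pow_zero, div_one] at hq
      exfalso
      have q1 : (0 : ℝ) < q := by by_contra hq'; nlinarith
      have q2 : (q : ℝ) < 1 := by by_contra hq'; nlinarith
      have q1' : 0 < q := by exact_mod_cast q1
      have q2' : q < 1 := by exact_mod_cast q2
      omega
  · have e : ∀ q : ℤ, a + (b - a) * (((q + 2 ^ m : ℤ) : ℝ) / 2 ^ (m + 1))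
        = c + (b - c) * (q / 2 ^ m) := by
      intro q; rw [hcm, pow_succ]; push_cast; field_simp; ring
    simp only [OnGrid, Nat.add_sub_cancel]
    constructor
    · rintro ⟨q, hq⟩
      exact ⟨q - 2 ^ m, by rw [← e, hq, sub_add_cancel]⟩
    · rintro ⟨q, hq⟩
      exact ⟨q + 2 ^ m, by rw [e, hq]⟩

theorem Cell.append_of_not_mem {h : History} {a b : ℝ} {m k : ℕ} (hc : Cell h a b m k)
    {p : ℝ × ℝ} (hp : ¬ (a < p.1 ∧ p.1 < b)) : Cell (h ++ [p]) a b m k := by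
  refine ⟨fun x h1 h2 => ?_, ?_, ?_, hc.lt⟩
  · rw [numAt_append_of_ne h (by rintro rfl; exact hp ⟨h1, h2⟩)]; exact hc.count x h1 h2
  · rw [rawNum_append, if_neg hp]; exact hc.raw
  · rw [numIn_append_of_not_mem h hp]; exact hc.num

/-- Next point of the sweep of a cell. -/
def sweepPt (a b : ℝ) (m k : ℕ) : ℝ := a + (b - a) * ((k + 1 / 2) / 2 ^ m)

theorem sweepPt_mem {a b : ℝ} (hab : a < b) {m k : ℕ} (hk : k < 2 ^ m) :
    a < sweepPt a b m k ∧ sweepPt a b m k < b := by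
  have h2 : (0 : ℝ) < 2 ^ m := by positivity
  have hk' : (k : ℝ) + 1 ≤ 2 ^ m := by exact_mod_cast hk
  have r1 : (0 : ℝ) < (k + 1 / 2) / 2 ^ m := by positivity
  have r2 : ((k : ℝ) + 1 / 2) / 2 ^ m < 1 := (div_lt_one h2).2 (by linarith)
  unfold sweepPt
  constructor <;> nlinarith

/-- In units of (b - a)/2^m the new point is the half-integer k + 1/2: not an integer, and different
from the earlier q + 1/2. -/
theorem sweepPt_not_old {a b : ℝ} (hab : a < b) {m k : ℕ} :
    ¬ (OnGrid a b m (sweepPt a b m k) ∨ InSweep a b m k (sweepPt a b m k)) := by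
  have hba : b - a ≠ 0 := by linarith
  have h2 : (2 : ℝ) ^ m ≠ 0 := by positivity
  rintro (⟨q, hq⟩ | ⟨q, hq1, hq⟩)
  · have := mul_left_cancel₀ hba (add_left_cancel hq)
    have h3 : (k : ℝ) + 1 / 2 = q := by field_simp at this; field_simp; linarith
    have h4 : ((2 * k + 1 : ℤ) : ℝ) = ((2 * q : ℤ) : ℝ) := by push_cast; linarith
    have h5 : (2 * k + 1 : ℤ) = 2 * q := by exact_mod_cast h4
    omega
  · have := mul_left_cancel₀ hba (add_left_cancel hq)
    have h3 : (k : ℝ) = q := by field_simp at this; linarith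
    have : k = q := by exact_mod_cast h3
    omega

theorem inSweep_succ (a b : ℝ) (m k : ℕ) (x : ℝ) :
    InSweep a b m (k + 1) x ↔ InSweep a b m k x ∨ x = sweepPt a b m k := by
  constructor
  · rintro ⟨q, hq, rfl⟩
    rcases Nat.lt_succ_iff_lt_or_eq.1 hq with h | rfl
    · exact Or.inl ⟨q, h, rfl⟩
    · exact Or.inr rfl
  · rintro (⟨q, hq, rfl⟩ | rfl)
    · exact ⟨q, by omega, rfl⟩
    · exact ⟨k, by omega, rfl⟩

theorem Cell.count_append {h : History} {a b : ℝ} (hab : a < b) {m k : ℕ} (hc : Cell h a b m k)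
    (y x : ℝ) (h1 : a < x) (h2 : x < b) :
    ((OnGrid a b m x ∨ InSweep a b m (k + 1) x) → numAt (h ++ [(sweepPt a b m k, y)]) x = 1) ∧
    (¬ (OnGrid a b m x ∨ InSweep a b m (k + 1) x) →
      numAt (h ++ [(sweepPt a b m k, y)]) x = 0) := by
  rw [numAt_append, hc.count x h1 h2, inSweep_succ, ← or_assoc]
  by_cases hx : sweepPt a b m k = x
  · subst hx
    simp [if_neg (sweepPt_not_old hab)]
  · have hx' : x ≠ sweepPt a b m k := fun h => hx h.symm
    simp only [hx, hx', or_false, if_false, add_zero]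
    constructor <;> intro h <;> simp [h]

theorem not_pow_of_lt {m n : ℕ} (h1 : 2 ^ m < n) (h2 : n < 2 ^ (m + 1)) : ¬ ∃ q, n = 2 ^ q := by
  rintro ⟨q, rfl⟩
  have := (Nat.pow_lt_pow_iff_right (by norm_num : 1 < 2)).1 h1
  have := (Nat.pow_lt_pow_iff_right (by norm_num : 1 < 2)).1 h2
  omega

/-- Inside a sweep one plus the count lies strictly between 2^m and 2^(m+1), so the truncation time
does not move. This is what freezes the interval statistics until the sweep is complete. -/
theorem Cell.not_pow_append {h : History} {a b : ℝ} (hab : a < b) {m k : ℕ} (hc : Cell h a b m k)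
    (hk : k + 1 < 2 ^ m) (y : ℝ) :
    ¬ ∃ q : ℕ, 1 + rawNum (h ++ [(sweepPt a b m k, y)]) a b = 2 ^ q := by
  have hr := hc.raw
  rw [rawNum_append, if_pos (sweepPt_mem hab hc.lt)]
  exact not_pow_of_lt (m := m) (by omega) (by rw [pow_succ]; omega)

theorem Cell.append_partial {h : History} {a b : ℝ} (hab : a < b) {m k : ℕ} (hc : Cell h a b m k)
    (hk : k + 1 < 2 ^ m) (y : ℝ) : Cell (h ++ [(sweepPt a b m k, y)]) a b m (k + 1) := by
  refine ⟨fun x h1 h2 => ?_, ?_, ?_, hk⟩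
  · have := hc.count_append hab y x h1 h2
    split_ifs with hg
    · exact this.1 hg
    · exact this.2 hg
  · have hr := hc.raw
    rw [rawNum_append, if_pos (sweepPt_mem hab hc.lt)]; omega
  · rw [numIn_append_of_not_pow _ _ _ _ (hc.not_pow_append hab hk y)]; exact hc.num

/-- Even multiples of the finer mesh are the old grid points and odd ones the midpoints. A completed
sweep thus refines the grid by one level. -/
theorem onGrid_succ_iff {a b : ℝ} (hab : a < b) {m : ℕ} {x : ℝ} (h1 : a < x) (h2 : x < b) :
    OnGrid a b (m + 1) x ↔ OnGrid a b m x ∨ InSweep a b m (2 ^ m) x := by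
  have hp : (0 : ℝ) < 2 ^ m := by positivity
  constructor
  · rintro ⟨q, hq⟩
    rcases Int.even_or_odd' q with ⟨r, rfl | rfl⟩
    · left
      refine ⟨r, ?_⟩
      rw [hq, pow_succ]; push_cast; field_simp
    · right
      have e : x = a + (b - a) * ((r + 1 / 2) / 2 ^ m) := by
        rw [hq, pow_succ]; push_cast; field_simp
      have r1 : 0 ≤ r := by
        by_contra hr
        have hr' : (r : ℝ) ≤ -1 := by exact_mod_cast (by omega : r ≤ -1)
        have : ((r : ℝ) + 1 / 2) / 2 ^ m ≤ 0 := div_nonpos_of_nonpos_of_nonneg (by linarith) hp.le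
        nlinarith
      have r2 : r < 2 ^ m := by
        by_contra hr
        have hr' : (2 : ℝ) ^ m ≤ r := by exact_mod_cast (not_lt.1 hr)
        have : 1 ≤ ((r : ℝ) + 1 / 2) / 2 ^ m := (one_le_div hp).2 (by linarith)
        nlinarith
      lift r to ℕ using r1
      exact ⟨r, by exact_mod_cast r2, by simpa using e⟩
  · rintro (⟨q, hq⟩ | ⟨q, hq, hx⟩)
    · refine ⟨2 * q, ?_⟩
      rw [hq, pow_succ]; push_cast; field_simp
    · refine ⟨2 * q + 1, ?_⟩
      rw [hx, pow_succ]; push_cast; field_simp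

theorem Cell.append_complete {h : History} {a b : ℝ} (hab : a < b) {m k : ℕ} (hc : Cell h a b m k)
    (hk : k + 1 = 2 ^ m) (y : ℝ) : Cell (h ++ [(sweepPt a b m k, y)]) a b (m + 1) 0 := by
  refine cell_zero_of_count hab fun x h1 h2 => ?_
  rw [onGrid_succ_iff hab h1 h2, ← hk]
  exact hc.count_append hab y x h1 h2

end DyadicSearch

end

/-! ### Predictable streams of observations, and bias of the interval estimates. -/

noncomputable section

namespace DyadicSearch

open MeasureTheory

/-! ### The algorithm as a function of the observed bits -/

open Classical in
/-- One period, as a function of the observed decision. -/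
def State.stepBit (lam δ : ℝ) (S : State) (y : ℝ) : State :=
  let x := S.policy lam δ
  let h := S.hist ++ [(x, y)]
  let k := S.nextK lam δ
  if S.dropLeft lam δ h then ⟨S.epoch + 1, S.left, S.hi, k, h⟩
  else if S.dropRight lam δ h then ⟨S.epoch + 1, S.lo, S.right, k, h⟩
  else ⟨S.epoch, S.lo, S.hi, k, h⟩

/-- State after observing the given bits (the newest first). -/
def stateOf (lam δ : ℝ) : List Bool → State
  | [] => State.init
  | b :: bs => (stateOf lam δ bs).stepBit lam δ (bitVal b)

/-- Policy chosen after observing the given bits. -/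
def polOf (lam δ : ℝ) (bs : List Bool) : ℝ := (stateOf lam δ bs).policy lam δ

theorem run_eq_stateOf (lam δ : ℝ) (v : ℕ → ℝ) (t : ℕ) :
    run lam δ v t = stateOf lam δ (bits (polOf lam δ) v t) := by
  induction t with
  | zero => rfl
  | succ t ih =>
    simp only [run, bits, stateOf, bitVal_decide]
    rw [ih]
    rfl

theorem policy_eq_polOf (lam δ : ℝ) (v : ℕ → ℝ) (t : ℕ) :
    policy lam δ v t = polOf lam δ (bits (polOf lam δ) v t) := by
  unfold policy polOf
  rw [run_eq_stateOf]; rfl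

/-- History after one more period. -/
def State.histNext (lam δ : ℝ) (S : State) (y : ℝ) : History := S.hist ++ [(S.policy lam δ, y)]

theorem State.stepBit_cases (lam δ : ℝ) (S : State) (y : ℝ) :
    (S.dropLeft lam δ (S.histNext lam δ y) ∧
      S.stepBit lam δ y
        = ⟨S.epoch + 1, S.left, S.hi, S.nextK lam δ, S.histNext lam δ y⟩) ∨
    (S.dropRight lam δ (S.histNext lam δ y) ∧
      S.stepBit lam δ y
        = ⟨S.epoch + 1, S.lo, S.right, S.nextK lam δ, S.histNext lam δ y⟩) ∨
    ((¬ S.dropLeft lam δ (S.histNext lam δ y) ∧ ¬ S.dropRight lam δ (S.histNext lam δ y)) ∧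
      S.stepBit lam δ y = ⟨S.epoch, S.lo, S.hi, S.nextK lam δ, S.histNext lam δ y⟩) := by
  unfold State.stepBit State.histNext
  dsimp only
  split_ifs with h1 h2
  · exact Or.inl ⟨h1, rfl⟩
  · exact Or.inr (Or.inl ⟨h2, rfl⟩)
  · exact Or.inr (Or.inr ⟨⟨h1, h2⟩, rfl⟩)

theorem State.hist_stepBit (lam δ : ℝ) (S : State) (y : ℝ) :
    (S.stepBit lam δ y).hist = S.histNext lam δ y := by
  rcases S.stepBit_cases lam δ y with ⟨-, h⟩ | ⟨-, h⟩ | ⟨-, h⟩ <;> rw [h]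

theorem hist_cons (lam δ : ℝ) (b : Bool) (bs : List Bool) :
    (stateOf lam δ (b :: bs)).hist = (stateOf lam δ bs).hist ++ [(polOf lam δ bs, bitVal b)] :=
  State.hist_stepBit lam δ _ _

instance : Finite Arm := by
  refine Finite.of_surjective (fun n : Fin 5 => match n with
    | 0 => Arm.l | 1 => Arm.c | 2 => Arm.r | 3 => Arm.lc | 4 => Arm.cr) fun u => ?_
  cases u
  · exact ⟨0, rfl⟩
  · exact ⟨1, rfl⟩
  · exact ⟨2, rfl⟩
  · exact ⟨3, rfl⟩
  · exact ⟨4, rfl⟩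

theorem State.le_armRad_arm (lam δ : ℝ) (S : State) (u : Arm) :
    S.armRad lam δ u ≤ S.armRad lam δ (S.arm lam δ) := by
  have : Nonempty Arm := ⟨.l⟩
  obtain ⟨w, hw⟩ := Finite.exists_max (S.armRad lam δ)
  unfold State.arm
  dsimp only
  split_ifs with h1 h2 h3 h4
  · exact h1 u
  · exact h2 u
  · exact h3 u
  · exact h4 u
  · cases w
    · exact absurd hw h1
    · exact absurd hw h2
    · exact absurd hw h3
    · exact absurd hw h4
    · exact hw u

theorem State.arm_congr {lam δ : ℝ} {S S' : State} (h : S.armRad lam δ = S'.armRad lam δ) :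
    S.arm lam δ = S'.arm lam δ := by
  unfold State.arm; rw [h]

/-! ### Streams of observations -/

/-- Half the distance between neighbouring points of the sweep in progress. -/
def State.cellRad (lam δ : ℝ) (S : State) : ℝ :=
  match S.arm lam δ with
  | .lc => S.gap / (2 * ((numIn S.hist S.left S.ctr : ℝ) + 1))
  | .cr => S.gap / (2 * ((numIn S.hist S.ctr S.right : ℝ) + 1))
  -- The region is then an empty open interval: a period spent on a point of the triple starts no
  -- interval stream.
  | _ => 0

/-- The set of policies attached to a period: the policy itself, or the dyadic interval of which
it is the center. -/
def State.region (lam δ : ℝ) (S : State) : Bool → Set ℝ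
  | false => {S.policy lam δ}
  | true => Set.Ioo (S.policy lam δ - S.cellRad lam δ) (S.policy lam δ + S.cellRad lam δ)

/-- Region attached to the period that follows the first `s` ones. -/
def regionAt (lam δ : ℝ) (κ : Bool) (s : ℕ) (bs : List Bool) : Set ℝ :=
  -- Bits are stored newest first, so what remains after dropping is the first `s` of them. The
  -- region is therefore known from period `s + 1` on.
  (stateOf lam δ (bs.drop (bs.length - s))).region lam δ κ

/-- Selection of the periods after the first `s` ones whose policy is in the region attached to
period `s + 1`. -/
def streamSel (lam δ : ℝ) (κ : Bool) (s : ℕ) (bs : List Bool) : Prop :=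
  s ≤ bs.length ∧ polOf lam δ bs ∈ regionAt lam δ κ s bs

/-- All the streams are within their confidence radius at all times. -/
def GoodRun (lam δ : ℝ) (G : ℝ → ℝ) (bs : List Bool) : Prop :=
  ∀ κ s, s < bs.length → ∀ cs, cs <:+ bs →
    SelGood (polOf lam δ) G (Real.log (2 / δ)) (streamSel lam δ κ s) cs

theorem GoodRun.of_suffix {lam δ : ℝ} {G : ℝ → ℝ} {bs cs : List Bool} (h : GoodRun lam δ G bs)
    (hs : cs <:+ bs) : GoodRun lam δ G cs :=
  fun κ s hs' ds hds => h κ s (hs'.trans_le hs.length_le) ds (hds.trans hs)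

theorem regionAt_cons {lam δ : ℝ} {κ : Bool} {s : ℕ} {b : Bool} {bs : List Bool}
    (h : s ≤ bs.length) : regionAt lam δ κ s (b :: bs) = regionAt lam δ κ s bs := by
  unfold regionAt
  rw [List.length_cons, show bs.length + 1 - s = (bs.length - s) + 1 by omega, List.drop_succ_cons]

theorem regionAt_length (lam δ : ℝ) (κ : Bool) (bs : List Bool) :
    regionAt lam δ κ bs.length bs = (stateOf lam δ bs).region lam δ κ := by
  simp [regionAt]

theorem stream_of_length_le {lam δ : ℝ} {G : ℝ → ℝ} {κ : Bool} {s : ℕ} {bs : List Bool}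
    (h : bs.length ≤ s) :
    selCount (streamSel lam δ κ s) bs = 0 ∧ selDev (polOf lam δ) G (streamSel lam δ κ s) bs = 0 := by
  induction bs with
  | nil => exact ⟨rfl, rfl⟩
  | cons b bs ih =>
    rw [List.length_cons] at h
    obtain ⟨h1, h2⟩ := ih (by omega)
    have : ¬ streamSel lam δ κ s bs := fun hs => by have := hs.1; omega
    simp [selCount, selDev, h1, h2, this]

/-- The observations with policies in `U` are exactly those of one of the streams. -/
def Linked (lam δ : ℝ) (G : ℝ → ℝ) (κ : Bool) (U : Set ℝ) (bs : List Bool) : Prop :=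
  (countIn U (stateOf lam δ bs).hist = 0 ∧ devIn G U (stateOf lam δ bs).hist = 0) ∨
  ∃ s < bs.length, regionAt lam δ κ s bs = U ∧
    selCount (streamSel lam δ κ s) bs = countIn U (stateOf lam δ bs).hist ∧
    selDev (polOf lam δ) G (streamSel lam δ κ s) bs = devIn G U (stateOf lam δ bs).hist

theorem linked_nil (lam δ : ℝ) (G : ℝ → ℝ) (κ : Bool) (U : Set ℝ) : Linked lam δ G κ U [] :=
  Or.inl ⟨rfl, rfl⟩

/-- The first observation in `U` creates the stream, and `hnew` asks that the region attached to
that period be `U` itself. From then on membership in `U` and selection by the stream are the same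
condition. -/
theorem Linked.cons {lam δ : ℝ} {G : ℝ → ℝ} {κ : Bool} {U : Set ℝ} {bs : List Bool}
    (h : Linked lam δ G κ U bs) (b : Bool)
    (hnew : countIn U (stateOf lam δ bs).hist = 0 → polOf lam δ bs ∈ U →
      (stateOf lam δ bs).region lam δ κ = U) : Linked lam δ G κ U (b :: bs) := by
  classical
  rcases h with ⟨h1, h2⟩ | ⟨s, hs, hr, h1, h2⟩
  · by_cases hU : polOf lam δ bs ∈ U
    · right
      refine ⟨bs.length, by simp, ?_, ?_, ?_⟩
      · rw [regionAt_cons le_rfl, regionAt_length, hnew h1 hU]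
      all_goals
        have hsel : streamSel lam δ κ bs.length bs :=
          ⟨le_rfl, by rw [regionAt_length, hnew h1 hU]; exact hU⟩
        obtain ⟨e1, e2⟩ := stream_of_length_le (lam := lam) (δ := δ) (G := G) (κ := κ)
          (le_refl bs.length)
      · rw [hist_cons, countIn_append, h1, selCount, e1]; simp [hU, hsel]
      · rw [hist_cons, devIn_append, h2, selDev, e2]; simp [hU, hsel]
    · left
      rw [hist_cons, countIn_append, devIn_append, h1, h2]
      simp [hU]
  · right
    refine ⟨s, by simp; omega, ?_, ?_, ?_⟩
    · rw [regionAt_cons hs.le, hr]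
    all_goals
      have hsel : streamSel lam δ κ s bs ↔ polOf lam δ bs ∈ U := by
        unfold streamSel
        rw [hr]
        exact and_iff_right hs.le
    · rw [hist_cons, countIn_append, selCount, h1]; simp [hsel]
    · rw [hist_cons, devIn_append, selDev, h2]; simp [hsel]

theorem linked_singleton (lam δ : ℝ) (G : ℝ → ℝ) (x : ℝ) (bs : List Bool) :
    Linked lam δ G false {x} bs := by
  induction bs with
  | nil => exact linked_nil _ _ _ _ _
  | cons b bs ih =>
    refine ih.cons b fun _ hx => ?_
    rw [Set.mem_singleton_iff] at hx
    rw [← hx]; rfl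

/-- Here a data-dependent set inherits the bound of one of the deterministically indexed streams, so
no union over all possible sets is needed. -/
theorem Linked.abs_devIn_le {lam δ : ℝ} {G : ℝ → ℝ} {κ : Bool} {U : Set ℝ} {bs : List Bool}
    (h : Linked lam δ G κ U bs) (hg : GoodRun lam δ G bs) :
    |devIn G U (stateOf lam δ bs).hist|
      ≤ √(countIn U (stateOf lam δ bs).hist * (Real.log (2 / δ) / 2)) := by
  rcases h with ⟨h1, h2⟩ | ⟨s, hs, -, h1, h2⟩
  · simp [h1, h2]
  · rw [← h1, ← h2]
    exact hg κ s hs bs (List.suffix_refl _)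

theorem abs_demAt_sub_le {lam δ : ℝ} {G : ℝ → ℝ} {bs : List Bool} (hg : GoodRun lam δ G bs)
    {x : ℝ} (hx : numAt (stateOf lam δ bs).hist x ≠ 0) :
    |demAt (stateOf lam δ bs).hist x - G x|
      ≤ √(1 / (2 * (numAt (stateOf lam δ bs).hist x : ℝ)) * Real.log (2 / δ)) := by
  have h := (linked_singleton lam δ G x bs).abs_devIn_le hg
  rw [devIn_singleton, countIn_singleton] at h
  set n := numAt (stateOf lam δ bs).hist x
  have hn : (0 : ℝ) < n := by exact_mod_cast Nat.pos_of_ne_zero hx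
  have e : demAt (stateOf lam δ bs).hist x - G x
      = (((((stateOf lam δ bs).hist).filter (fun p => decide (p.1 = x))).map Prod.snd).sum
          - n * G x) / n := by
    rw [sub_div, mul_div_cancel_left₀ _ hn.ne']
    rfl
  rw [e, abs_div, abs_of_pos hn, div_le_iff₀ hn]
  refine h.trans (le_of_eq ?_)
  have : (n : ℝ) = √(n ^ 2) := (Real.sqrt_sq hn.le).symm
  conv_rhs => rw [this]
  rw [← Real.sqrt_mul' _ (by positivity)]
  congr 1
  rw [Real.sqrt_sq hn.le]
  field_simp

/-! ### Bias of the dyadic averages -/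

/-- Monotonicity sandwiches the sum s over the N - 1 interior points. After rescaling to [0, N], the
integral is at least s (drop the nonnegative value at the right end) and at most s + 1 (add the
value at the left end, at most 1). -/
theorem grid_sum_bounds {G : ℝ → ℝ} (hG : Antitone G) (h0 : ∀ x, 0 ≤ G x) (h1 : ∀ x, G x ≤ 1)
    {a b : ℝ} (hab : a < b) {N : ℕ} (hN : 0 < N) :
    |(b - a) * ((∑ q ∈ Finset.range (N - 1), G (a + (b - a) * ((q + 1 : ℕ) / N))) / N)
      - ∫ z in a..b, G z| ≤ (b - a) * (1 / N) := by
  have hN' : (0 : ℝ) < N := by exact_mod_cast hN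
  have hba : 0 < b - a := by linarith
  set f : ℝ → ℝ := fun u => G (a + (b - a) / N * u) with hf
  have hfa : Antitone f := fun u v huv => hG (by
    have : 0 < (b - a) / N := by positivity
    nlinarith)
  have e1 : ∫ u in (0 : ℝ)..0 + N, f u = N / (b - a) * ∫ z in a..b, G z := by
    have := intervalIntegral.integral_comp_add_mul (a := 0) (b := 0 + N) G
      (c := (b - a) / N) (by positivity) a
    rw [hf, this]
    rw [smul_eq_mul, inv_div]
    congr 2
    · ring
    · field_simp; ring
  have i1 := (hfa.antitoneOn (Set.Icc 0 (0 + (N : ℝ)))).integral_le_sum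
  have i2 := (hfa.antitoneOn (Set.Icc 0 (0 + (N : ℝ)))).sum_le_integral
  rw [e1] at i1 i2
  obtain ⟨n, rfl⟩ : ∃ n, N = n + 1 := ⟨N - 1, by omega⟩
  rw [Finset.sum_range_succ'] at i1
  rw [Finset.sum_range_succ] at i2
  have e2 : ∑ q ∈ Finset.range (n + 1 - 1), G (a + (b - a) * ((q + 1 : ℕ) / (n + 1 : ℕ)))
      = ∑ q ∈ Finset.range n, f (0 + (q + 1 : ℕ)) := by
    refine Finset.sum_congr (by simp) fun q _ => ?_
    simp only [hf]
    congr 1; ring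
  rw [e2]
  set s := ∑ q ∈ Finset.range n, f (0 + (q + 1 : ℕ))
  set I := ∫ z in a..b, G z
  have j2 : 0 ≤ f (0 + (n + 1 : ℕ)) := h0 _
  set M : ℝ := ((n + 1 : ℕ) : ℝ)
  have k1 : M / (b - a) * I ≤ s + 1 := i1.trans (by gcongr; exact h1 _)
  have k2 : s ≤ M / (b - a) * I := by linarith
  have e3 : (b - a) * (s / M) - I = (b - a) / M * (s - M / (b - a) * I) := by field_simp
  have e4 : (b - a) * (1 / M) = (b - a) / M * 1 := by ring
  rw [e3, e4, abs_mul, abs_of_pos (by positivity)]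
  refine mul_le_mul_of_nonneg_left ?_ (by positivity)
  rw [abs_le]; constructor <;> linarith

/-- The estimate of the average demand on `(a, b)` is within its confidence radius. -/
def Conf (δ : ℝ) (G : ℝ → ℝ) (h : History) (a b : ℝ) : Prop :=
  |(b - a) * demIn h a b - ∫ z in a..b, G z|
    ≤ (b - a) * (√(1 / (2 * ((numIn h a b : ℝ) + 1)) * Real.log (2 / δ))
      + 2 / ((numIn h a b : ℝ) + 1))

/-- The error splits into the deviation of the N - 1 decisions, divided by N, and the bias of the
grid average. -/
theorem Cell.conf {δ : ℝ} {G : ℝ → ℝ} (hG : Antitone G) (h0 : ∀ x, 0 ≤ G x) (h1 : ∀ x, G x ≤ 1)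
    {h : History} {a b : ℝ} (hab : a < b) {m : ℕ} (hc : Cell h a b m 0)
    (hL : 0 ≤ Real.log (2 / δ))
    (hd : |devIn G (Set.Ioo a b) h| ≤ √(countIn (Set.Ioo a b) h * (Real.log (2 / δ) / 2))) :
    Conf δ G h a b := by
  have hba : 0 < b - a := by linarith
  have hraw : rawNum h a b + 1 = 2 ^ m := by simpa using hc.raw
  have hpow : ∃ m : ℕ, 1 + rawNum h a b = 2 ^ m := ⟨m, by omega⟩
  set N := rawNum h a b + 1 with hN
  have hNr : (rawNum h a b : ℝ) + 1 = N := by rw [hN]; push_cast; rfl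
  have hNpos : (0 : ℝ) < N := by rw [← hNr]; positivity
  unfold Conf
  rw [demIn_of_pow h a b hpow, numIn_of_pow h a b hpow, hNr]
  rw [devIn_Ioo, countIn_Ioo, sum_filter_eq_of_count hab hc.grid_count] at hd
  have hg := grid_sum_bounds hG h0 h1 hab (N := N) (by omega)
  have hcast : (2 : ℝ) ^ m = N := by rw [hraw]; push_cast; rfl
  rw [← hraw, hcast] at hd
  set s := ∑ q ∈ Finset.range (N - 1), G (a + (b - a) * ((q + 1 : ℕ) / N))
  have hd2 : √((rawNum h a b : ℝ) * (Real.log (2 / δ) / 2))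
      ≤ N * √(1 / (2 * (N : ℝ)) * Real.log (2 / δ)) := by
    have : (N : ℝ) = √(N ^ 2) := (Real.sqrt_sq hNpos.le).symm
    conv_rhs => rw [this, Real.sqrt_sq hNpos.le]
    calc _ ≤ √((N : ℝ) * (Real.log (2 / δ) / 2)) := by
          apply Real.sqrt_le_sqrt
          refine mul_le_mul_of_nonneg_right ?_ (by positivity)
          linarith
      _ = √((N : ℝ) ^ 2 * (1 / (2 * (N : ℝ)) * Real.log (2 / δ))) := by
          congr 1; field_simp
      _ = _ := by rw [Real.sqrt_mul (by positivity), Real.sqrt_sq hNpos.le]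
  have hd3 : |sumIn h a b / N - s / N| ≤ √(1 / (2 * (N : ℝ)) * Real.log (2 / δ)) := by
    rw [← sub_div, abs_div, abs_of_pos hNpos, div_le_iff₀ hNpos, mul_comm]
    exact hd.trans hd2
  calc _ = |(b - a) * (sumIn h a b / N - s / N) + ((b - a) * (s / N) - ∫ z in a..b, G z)| := by
        congr 1; ring
    _ ≤ |(b - a) * (sumIn h a b / N - s / N)| + |(b - a) * (s / N) - ∫ z in a..b, G z| :=
        abs_add_le _ _
    _ ≤ (b - a) * √(1 / (2 * (N : ℝ)) * Real.log (2 / δ)) + (b - a) * (1 / N) := by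
        rw [abs_mul, abs_of_pos hba]
        exact add_le_add (mul_le_mul_of_nonneg_left hd3 hba.le) hg
    -- The bias uses 1/N only; the radius allows 2/N.
    _ ≤ _ := by
        rw [mul_add]
        gcongr
        norm_num

end DyadicSearch

end

/-! ### Geometry of the triples and the invariant of the algorithm. -/

noncomputable section

namespace DyadicSearch

open MeasureTheory

/-! ### Geometry of the active interval -/

/-- Length of the active interval in a given epoch. -/
def epochLen : ℕ → ℝ
  -- A fictitious epoch 0, chosen so that epoch 1 has length 3/2 · 2/3 = 1.
  | 0 => 3 / 2
  | n + 1 => epochLen n * if Odd n then 3 / 4 else 2 / 3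

/-- The triple of the state consists of the consecutive multiples `i g`, `(i + 1) g`, `(i + 2) g`
of the spacing `g`, and the active interval is symmetric around it. -/
structure Geo (S : State) (g : ℝ) (i : ℕ) : Prop where
  pos : 0 < g
  shape : (Odd S.epoch ∧ 1 ≤ i ∧ S.lo = (i - 1) * g ∧ S.hi = (i + 3) * g) ∨
    (Even S.epoch ∧ 2 ≤ i ∧ Even i ∧ S.lo = (i - 2) * g ∧ S.hi = (i + 4) * g)
  hi_le : S.hi ≤ 1
  len : S.hi - S.lo = epochLen S.epoch

section Geo

variable {S : State} {g : ℝ} {i : ℕ}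

theorem Geo.gap (h : Geo S g i) : S.gap = g := by
  unfold State.gap
  rcases h.shape with ⟨h1, -, h3, h4⟩ | ⟨h1, -, -, h3, h4⟩
  · rw [if_pos h1, h3, h4]; ring
  · rw [if_neg (Nat.not_odd_iff_even.2 h1), h3, h4]; ring

theorem Geo.ctr (h : Geo S g i) : S.ctr = (i + 1) * g := by
  unfold State.ctr
  rcases h.shape with ⟨h1, -, h3, h4⟩ | ⟨h1, -, -, h3, h4⟩ <;> rw [h3, h4] <;> ring

theorem Geo.left (h : Geo S g i) : S.left = i * g := by
  unfold State.left; rw [h.ctr, h.gap]; ring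

theorem Geo.right (h : Geo S g i) : S.right = (i + 2) * g := by
  unfold State.right; rw [h.ctr, h.gap]; ring

theorem Geo.one_le (h : Geo S g i) : 1 ≤ i := by
  rcases h.shape with ⟨-, h1, -⟩ | ⟨-, h1, -⟩ <;> omega

theorem Geo.lo_nonneg (h : Geo S g i) : 0 ≤ S.lo := by
  have := h.pos
  rcases h.shape with ⟨-, h1, h3, -⟩ | ⟨-, h1, -, h3, -⟩
  · have : (1 : ℝ) ≤ i := by exact_mod_cast h1
    rw [h3]; nlinarith
  · have : (2 : ℝ) ≤ i := by exact_mod_cast h1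
    rw [h3]; nlinarith

theorem Geo.lo_le (h : Geo S g i) : S.left - 2 * g ≤ S.lo ∧ S.lo ≤ S.left - g := by
  have := h.pos
  rw [h.left]
  rcases h.shape with ⟨-, -, h3, -⟩ | ⟨-, -, -, h3, -⟩ <;> rw [h3] <;> constructor <;> nlinarith

theorem Geo.le_hi (h : Geo S g i) : S.right + g ≤ S.hi ∧ S.hi ≤ S.right + 2 * g := by
  have := h.pos
  rw [h.right]
  rcases h.shape with ⟨-, -, -, h3⟩ | ⟨-, -, -, -, h3⟩ <;> rw [h3] <;> constructor <;> nlinarith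

/-- In an odd epoch the active interval has four spacings; removing one leaves three, that is, six
half spacings. The new centre is 2i + 3 half spacings, hence the even index 2i + 2. -/
theorem Geo.dropLeft_odd (h : Geo S g i) (he : Odd S.epoch) (k : ℕ) (hist : History) :
    Geo ⟨S.epoch + 1, S.left, S.hi, k, hist⟩ (g / 2) (2 * i + 2) := by
  have hp := h.pos
  rcases h.shape with ⟨-, h1, h3, h4⟩ | ⟨h2, -⟩
  · refine ⟨by linarith, Or.inr ⟨he.add_one, by omega, ⟨i + 1, by ring⟩, ?_, ?_⟩, h.hi_le, ?_⟩
    · dsimp only; rw [h.left]; push_cast; ring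
    · dsimp only; rw [h4]; push_cast; ring
    · dsimp only
      rw [epochLen, ← h.len, if_pos he, h.left, h3, h4]; ring
  · exact absurd he (Nat.not_odd_iff_even.2 h2)

/-- In an even epoch two spacings out of six are removed, so the spacing can be kept and the triple
shifts by one. -/
theorem Geo.dropLeft_even (h : Geo S g i) (he : Even S.epoch) (k : ℕ) (hist : History) :
    Geo ⟨S.epoch + 1, S.left, S.hi, k, hist⟩ g (i + 1) := by
  have hp := h.pos
  rcases h.shape with ⟨h2, -⟩ | ⟨-, h1, -, h3, h4⟩
  · exact absurd h2 (Nat.not_odd_iff_even.2 he)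
  · refine ⟨hp, Or.inl ⟨he.add_one, by omega, ?_, ?_⟩, h.hi_le, ?_⟩
    · dsimp only; rw [h.left]; push_cast; ring
    · dsimp only; rw [h4]; push_cast; ring
    · dsimp only
      rw [epochLen, ← h.len, if_neg (Nat.not_odd_iff_even.2 he), h.left, h3, h4]; ring

theorem Geo.right_le_one (h : Geo S g i) : S.right ≤ 1 := by
  have := h.le_hi.1; have := h.hi_le; have := h.pos; linarith

theorem Geo.dropRight_odd (h : Geo S g i) (he : Odd S.epoch) (k : ℕ) (hist : History) :
    Geo ⟨S.epoch + 1, S.lo, S.right, k, hist⟩ (g / 2) (2 * i) := by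
  have hp := h.pos
  rcases h.shape with ⟨-, h1, h3, h4⟩ | ⟨h2, -⟩
  · refine ⟨by linarith, Or.inr ⟨he.add_one, by omega, ⟨i, by ring⟩, ?_, ?_⟩, h.right_le_one, ?_⟩
    · dsimp only; rw [h3]; push_cast; ring
    · dsimp only; rw [h.right]; push_cast; ring
    · dsimp only
      rw [epochLen, ← h.len, if_pos he, h.right, h3, h4]; ring
  · exact absurd he (Nat.not_odd_iff_even.2 h2)

theorem Geo.dropRight_even (h : Geo S g i) (he : Even S.epoch) (k : ℕ) (hist : History) :
    Geo ⟨S.epoch + 1, S.lo, S.right, k, hist⟩ g (i - 1) := by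
  have hp := h.pos
  rcases h.shape with ⟨h2, -⟩ | ⟨-, h1, -, h3, h4⟩
  · exact absurd h2 (Nat.not_odd_iff_even.2 he)
  · refine ⟨hp, Or.inl ⟨he.add_one, by omega, ?_, ?_⟩, h.right_le_one, ?_⟩
    · dsimp only; rw [h3, Nat.cast_sub (by omega)]; push_cast; ring
    · dsimp only; rw [h.right, Nat.cast_sub (by omega)]; push_cast; ring
    · dsimp only
      rw [epochLen, ← h.len, if_neg (Nat.not_odd_iff_even.2 he), h.right, h3, h4]; ring

end Geo

theorem not_mem_cell {g : ℝ} (hg : 0 < g) (q j : ℤ) : ¬ (j * g < q * g ∧ q * g < (j + 1) * g) := by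
  rintro ⟨h1, h2⟩
  have h1' := lt_of_mul_lt_mul_right h1 hg.le
  have h2' := lt_of_mul_lt_mul_right h2 hg.le
  have h3 : j < q := by exact_mod_cast h1'
  have h4 : q < j + 1 := by exact_mod_cast h2'
  omega

/-! ### Changes of the history that do not affect the tests -/

/-- Two histories with the same statistics on a triple of points. -/
structure SameStats (h h' : History) (l c r : ℝ) : Prop where
  num : numAt h' l = numAt h l ∧ numAt h' c = numAt h c ∧ numAt h' r = numAt h r
  dem : demAt h' l = demAt h l ∧ demAt h' c = demAt h c ∧ demAt h' r = demAt h r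
  numIn : numIn h' l c = numIn h l c ∧ numIn h' c r = numIn h c r
  demIn : demIn h' l c = demIn h l c ∧ demIn h' c r = demIn h c r

theorem SameStats.dropLeft {lam δ : ℝ} {S : State} {h h' : History}
    (hs : SameStats h h' S.left S.ctr S.right) :
    S.dropLeft lam δ h' ↔ S.dropLeft lam δ h := by
  simp only [State.dropLeft, diffAdj, diffOuter, radAdj, radOuter, radAt, radIn, hs.num.1,
    hs.num.2.1, hs.num.2.2, hs.dem.1, hs.dem.2.1, hs.dem.2.2, hs.numIn.1, hs.numIn.2, hs.demIn.1,
    hs.demIn.2]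

theorem SameStats.dropRight {lam δ : ℝ} {S : State} {h h' : History}
    (hs : SameStats h h' S.left S.ctr S.right) :
    S.dropRight lam δ h' ↔ S.dropRight lam δ h := by
  simp only [State.dropRight, diffAdj, diffOuter, radAdj, radOuter, radAt, radIn, hs.num.1,
    hs.num.2.1, hs.num.2.2, hs.dem.1, hs.dem.2.1, hs.dem.2.2, hs.numIn.1, hs.numIn.2, hs.demIn.1,
    hs.demIn.2]

theorem SameStats.arm {lam δ : ℝ} {S : State} {h' : History}
    (hs : SameStats S.hist h' S.left S.ctr S.right) (k : ℕ) :
    State.arm lam δ ⟨S.epoch, S.lo, S.hi, k, h'⟩ = S.arm lam δ := by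
  refine State.arm_congr ?_
  have e1 : State.left ⟨S.epoch, S.lo, S.hi, k, h'⟩ = S.left := rfl
  have e2 : State.ctr ⟨S.epoch, S.lo, S.hi, k, h'⟩ = S.ctr := rfl
  have e3 : State.right ⟨S.epoch, S.lo, S.hi, k, h'⟩ = S.right := rfl
  funext u
  cases u <;> simp only [State.armRad, e1, e2, e3, radAt, radIn, hs.num.1,
    hs.num.2.1, hs.num.2.2, hs.numIn.1, hs.numIn.2]

/-- An interval whose estimate has been refined at least once does not have the largest radius
when some point of the triple has been chosen at most once. -/
theorem numIn_eq_zero_of_radAt_le {lam δ : ℝ} (h0 : 0 < lam) (h1 : lam < 1)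
    (hL : 49 / 2 ≤ Real.log (2 / δ)) {h : History} {a b p g : ℝ} (hg : 0 < g) (hba : b - a = g)
    (hp : g ≤ p) (hn : numAt h p ≤ 1) (hle : radAt δ h p ≤ radIn lam δ h a b) :
    numIn h a b = 0 := by
  by_contra hN
  have hN1 : (1 : ℝ) ≤ numIn h a b := by exact_mod_cast Nat.one_le_iff_ne_zero.2 hN
  unfold radAt radIn at hle
  split_ifs at hle with hz
  · exact absurd (top_le_iff.1 hle) (EReal.coe_ne_top _)
  · have hn1 : numAt h p = 1 := by omega
    rw [EReal.coe_le_coe_iff, hn1, hba] at hle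
    set L := Real.log (2 / δ)
    set s := √(1 / (2 * ((1 : ℕ) : ℝ)) * L) with hs
    have hs2 : s ^ 2 = L / 2 := by rw [hs, Real.sq_sqrt (by positivity)]; push_cast; ring
    have hs0 : 0 ≤ s := Real.sqrt_nonneg _
    -- The threshold 49/2 gives s ≥ 7/2. A refined interval has radius at most g(0.7072 s + 1),
    -- where 0.7072 > 1/√2; this is below g s because 0.2928 · 7/2 > 1.
    have hs3 : 7 / 2 ≤ s := by nlinarith
    have hr : √(1 / (2 * ((numIn h a b : ℝ) + 1)) * L) ≤ 0.7072 * s := by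
      refine (Real.sqrt_le_left (by positivity)).2 ?_
      have : 1 / (2 * ((numIn h a b : ℝ) + 1)) ≤ 1 / 4 :=
        one_div_le_one_div_of_le (by norm_num) (by linarith)
      nlinarith
    have hq : 2 / ((numIn h a b : ℝ) + 1) ≤ 1 := (div_le_one (by positivity)).2 (by linarith)
    have h3 : lam * g * (√(1 / (2 * ((numIn h a b : ℝ) + 1)) * L) + 2 / ((numIn h a b : ℝ) + 1))
        ≤ g * (0.7072 * s + 1) := by
      have : lam * g ≤ g := by nlinarith
      refine mul_le_mul this (add_le_add hr hq) (by positivity) hg.le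
    have h4 : g * s ≤ p * s := mul_le_mul_of_nonneg_right hp hs0
    nlinarith

/-! ### The invariant of the algorithm -/

/-- Length of the sweep in progress in the cell `j`, when the left point of the triple is the
`i`-th multiple of the spacing. -/
def partOf (u : Arm) (k i j : ℕ) : ℕ :=
  match u with
  | .lc => if j = i then k else 0
  | .cr => if j = i + 1 then k else 0
  | _ => 0

theorem partOf_zero (u : Arm) (i j : ℕ) : partOf u 0 i j = 0 := by
  cases u <;> simp [partOf]

/-- The invariant of the algorithm, at spacing `g`. -/
structure Inv (lam δ : ℝ) (G : ℝ → ℝ) (bs : List Bool) (g : ℝ) (i : ℕ) (m : ℕ → ℕ) : Prop where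
  geo : Geo (stateOf lam δ bs) g i
  cell : ∀ j : ℕ, Cell (stateOf lam δ bs).hist (j * g) ((j + 1) * g) (m j)
    (partOf ((stateOf lam δ bs).arm lam δ) (stateOf lam δ bs).k i j)
  armk : (stateOf lam δ bs).k ≠ 0 →
    (stateOf lam δ bs).arm lam δ = .lc ∨ (stateOf lam δ bs).arm lam δ = .cr
  -- Either the epoch has just begun, and some point of the triple has been chosen at most once, or
  -- the tests have already failed on the present history.
  fresh : ((stateOf lam δ bs).k = 0 ∧ ∃ q : ℕ, (q = i ∨ q = i + 1 ∨ q = i + 2) ∧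
      numAt (stateOf lam δ bs).hist (q * g) ≤ 1) ∨
    (¬ (stateOf lam δ bs).dropLeft lam δ (stateOf lam δ bs).hist ∧
      ¬ (stateOf lam δ bs).dropRight lam δ (stateOf lam δ bs).hist)
  -- Reserves the rarely chosen point needed by `fresh` after an even epoch: odd multiples of the
  -- spacing were interior to the cells of the previous spacing, and only the centre i + 1 is
  -- sampled as a point during the epoch.
  odd : Even (stateOf lam δ bs).epoch → ∀ j : ℕ, Odd j → j ≠ i + 1 →
    numAt (stateOf lam δ bs).hist (j * g) ≤ 1
  -- All depths `e` are needed, because cells at later, smaller spacings reuse the observations made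
  -- now.
  linked : ∀ e j : ℕ, Linked lam δ G true (Set.Ioo (j * (g / 2 ^ e)) ((j + 1) * (g / 2 ^ e))) bs
  conf : GoodRun lam δ G bs → ∀ j : ℕ, Conf δ G (stateOf lam δ bs).hist (j * g) ((j + 1) * g)

section Inv

variable {lam δ : ℝ} {G : ℝ → ℝ} {bs : List Bool} {g : ℝ} {i : ℕ} {m : ℕ → ℕ}

theorem Inv.k_eq_zero (h : Inv lam δ G bs g i m) (h1 : (stateOf lam δ bs).arm lam δ ≠ .lc)
    (h2 : (stateOf lam δ bs).arm lam δ ≠ .cr) : (stateOf lam δ bs).k = 0 := by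
  by_contra hk
  rcases h.armk hk with h | h
  · exact h1 h
  · exact h2 h

/-- A period either queries a point of the triple or continues the sweep of one of its cells. -/
theorem Inv.sample (h : Inv lam δ G bs g i m) :
    (∃ q : ℕ, (q = i ∨ q = i + 1 ∨ q = i + 2) ∧ polOf lam δ bs = q * g ∧
      (stateOf lam δ bs).k = 0 ∧ (stateOf lam δ bs).nextK lam δ = 0 ∧
      (stateOf lam δ bs).armRad lam δ ((stateOf lam δ bs).arm lam δ)
        = radAt δ (stateOf lam δ bs).hist (q * g)) ∨
    (∃ j₀ : ℕ, (j₀ = i ∨ j₀ = i + 1) ∧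
      ((stateOf lam δ bs).arm lam δ = .lc ∨ (stateOf lam δ bs).arm lam δ = .cr) ∧
      (∀ k j, partOf ((stateOf lam δ bs).arm lam δ) k i j = if j = j₀ then k else 0) ∧
      polOf lam δ bs = sweepPt (j₀ * g) ((j₀ + 1) * g) (m j₀) (stateOf lam δ bs).k ∧
      (stateOf lam δ bs).nextK lam δ = ((stateOf lam δ bs).k + 1) % 2 ^ m j₀ ∧
      (stateOf lam δ bs).cellRad lam δ = g / (2 * 2 ^ m j₀) ∧
      (stateOf lam δ bs).armRad lam δ ((stateOf lam δ bs).arm lam δ)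
        = radIn lam δ (stateOf lam δ bs).hist (j₀ * g) ((j₀ + 1) * g)) := by
  have hgeo := h.geo
  have hk := h.k_eq_zero
  have hcell := h.cell
  unfold polOf
  set S := stateOf lam δ bs
  have e2 : S.ctr = ((i + 1 : ℕ) : ℝ) * g := by rw [hgeo.ctr]; push_cast; ring
  have e3 : S.right = ((i + 2 : ℕ) : ℝ) * g := by rw [hgeo.right]; push_cast; ring
  have e4 : S.right = (((i + 1 : ℕ) : ℝ) + 1) * g := by rw [hgeo.right]; push_cast; ring
  rcases harm : S.arm lam δ with _ | _ | _ | _ | _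
  · refine Or.inl ⟨i, by simp, ?_, hk (by simp [harm]) (by simp [harm]), ?_, ?_⟩
    · rw [State.policy, harm]; exact hgeo.left
    · rw [State.nextK, harm]; exact hk (by simp [harm]) (by simp [harm])
    · simp only [State.armRad]; rw [hgeo.left]
  · refine Or.inl ⟨i + 1, by simp, ?_, hk (by simp [harm]) (by simp [harm]), ?_, ?_⟩
    · rw [State.policy, harm]; exact e2
    · rw [State.nextK, harm]; exact hk (by simp [harm]) (by simp [harm])
    · simp only [State.armRad]; rw [e2]
  · refine Or.inl ⟨i + 2, by simp, ?_, hk (by simp [harm]) (by simp [harm]), ?_, ?_⟩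
    · rw [State.policy, harm]; exact e3
    · rw [State.nextK, harm]; exact hk (by simp [harm]) (by simp [harm])
    · simp only [State.armRad]; rw [e3]
  · have hn := (hcell i).num
    rw [← hgeo.left, ← hgeo.ctr] at hn
    have hn' : (numIn S.hist S.left S.ctr : ℝ) + 1 = 2 ^ m i := by exact_mod_cast hn
    refine Or.inr ⟨i, by simp, by simp, fun k j => rfl, ?_, ?_, ?_, ?_⟩
    · rw [State.policy, harm, sweepPt, State.sweep, hn', hgeo.left, hgeo.ctr]
    · rw [State.nextK, harm, hn]
    · rw [State.cellRad, harm, hn', hgeo.gap]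
    · simp only [State.armRad]; rw [hgeo.left, hgeo.ctr]
  · have hn := (hcell (i + 1)).num
    rw [← e4, ← e2] at hn
    have hn' : (numIn S.hist S.ctr S.right : ℝ) + 1 = 2 ^ m (i + 1) := by exact_mod_cast hn
    refine Or.inr ⟨i + 1, by simp, by simp, fun k j => rfl, ?_, ?_, ?_, ?_⟩
    · rw [State.policy, harm, sweepPt, ← e4, ← e2]
      dsimp only
      rw [State.sweep, hn']
    · rw [State.nextK, harm, hn]
    · rw [State.cellRad, harm, hn', hgeo.gap]
    · simp only [State.armRad]; rw [← e4, ← e2]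

end Inv

/-- A sweep point that is the first one in a dyadic subinterval is its center. -/
theorem newborn_center {h : History} {g : ℝ} (hg : 0 < g) {j₀ m k e j : ℕ}
    (hc : Cell h (j₀ * g) ((j₀ + 1) * g) m k)
    (h1 : j * (g / 2 ^ e) < sweepPt (j₀ * g) ((j₀ + 1) * g) m k)
    (h2 : sweepPt (j₀ * g) ((j₀ + 1) * g) m k < (j + 1) * (g / 2 ^ e))
    (h0 : rawNum h (j * (g / 2 ^ e)) ((j + 1) * (g / 2 ^ e)) = 0) :
    Set.Ioo (sweepPt (j₀ * g) ((j₀ + 1) * g) m k - g / (2 * 2 ^ m))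
      (sweepPt (j₀ * g) ((j₀ + 1) * g) m k + g / (2 * 2 ^ m))
      = Set.Ioo (j * (g / 2 ^ e)) ((j + 1) * (g / 2 ^ e)) := by
  have hpm : (0 : ℝ) < 2 ^ m := by positivity
  have hpe : (0 : ℝ) < 2 ^ e := by positivity
  have hx : sweepPt (j₀ * g) ((j₀ + 1) * g) m k
      = ((j₀ * 2 ^ (m + 1) + 2 * k + 1 : ℕ) : ℝ) * (g / 2 ^ (m + 1)) := by
    unfold sweepPt
    push_cast
    rw [pow_succ]
    field_simp
    ring
  set o := j₀ * 2 ^ (m + 1) + 2 * k + 1 with ho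
  -- The sweep point is an odd multiple `o` of g/2^(m+1). At any depth e > m it would be an endpoint
  -- of dyadic intervals and interior to none.
  have hem : e ≤ m := by
    by_contra hlt
    obtain ⟨d, rfl⟩ : ∃ d, e = m + 1 + d := ⟨e - (m + 1), by omega⟩
    have hx' : (o : ℝ) * (g / 2 ^ (m + 1)) = ((o * 2 ^ d : ℕ) : ℤ) * (g / 2 ^ (m + 1 + d)) := by
      push_cast; rw [pow_add _ (m + 1)]; field_simp
    rw [hx, hx'] at h1 h2
    have hg' : 0 < g / 2 ^ (m + 1 + d) := by positivity
    exact not_mem_cell hg' ((o * 2 ^ d : ℕ) : ℤ) (j : ℤ)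
      ⟨by exact_mod_cast h1, by exact_mod_cast h2⟩
  obtain ⟨d, rfl⟩ : ∃ d, m = e + d := ⟨m - e, by omega⟩
  have hge : 0 < g / 2 ^ e := by positivity
  -- integer inequalities for the position of the point
  have i1 : j * 2 ^ (d + 1) < o := by
    rw [hx] at h1
    have : ((j * 2 ^ (d + 1) : ℕ) : ℝ) * (g / 2 ^ (e + d + 1)) < o * (g / 2 ^ (e + d + 1)) := by
      refine lt_of_eq_of_lt ?_ h1
      push_cast
      rw [show e + d + 1 = e + (d + 1) by ring, pow_add _ e]; field_simp
    exact_mod_cast lt_of_mul_lt_mul_right this (by positivity)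
  have i2 : o < (j + 1) * 2 ^ (d + 1) := by
    rw [hx] at h2
    have : (o : ℝ) * (g / 2 ^ (e + d + 1))
        < (((j + 1) * 2 ^ (d + 1) : ℕ) : ℝ) * (g / 2 ^ (e + d + 1)) := by
      refine lt_of_lt_of_eq h2 ?_
      push_cast
      rw [show e + d + 1 = e + (d + 1) by ring, pow_add _ e]; field_simp
    exact_mod_cast lt_of_mul_lt_mul_right this (by positivity)
  rcases Nat.eq_zero_or_pos d with rfl | hd
  · have hoj : o = 2 * j + 1 := by omega
    rw [hx, hoj]
    simp only [add_zero]
    congr 1 <;> (push_cast; rw [pow_succ]; field_simp; ring)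
  -- For e < m the midpoint y of the subinterval already belongs to the grid of depth m. It has been
  -- chosen before, against the assumption that the subinterval was unvisited.
  · exfalso
    obtain ⟨d, rfl⟩ : ∃ d', d = d' + 1 := ⟨d - 1, by omega⟩
    have hk : k < 2 ^ (e + (d + 1)) := hc.lt
    -- the subinterval lies in the cell
    have hp : 2 ^ (e + (d + 1) + 1) = 2 ^ e * 2 ^ (d + 1 + 1) := by rw [← pow_add]; congr 1
    have hpd : 0 < 2 ^ (d + 1 + 1) := by positivity
    have i3 : j₀ * 2 ^ e ≤ j := by
      have : j₀ * 2 ^ e * 2 ^ (d + 1 + 1) < (j + 1) * 2 ^ (d + 1 + 1) := by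
        calc _ = j₀ * 2 ^ (e + (d + 1) + 1) := by rw [hp]; ring
          _ ≤ o := by omega
          _ < _ := i2
      exact Nat.lt_succ_iff.1 (Nat.lt_of_mul_lt_mul_right this)
    have i4 : j + 1 ≤ (j₀ + 1) * 2 ^ e := by
      have : j * 2 ^ (d + 1 + 1) < (j₀ + 1) * 2 ^ e * 2 ^ (d + 1 + 1) := by
        calc _ < o := i1
          _ ≤ j₀ * 2 ^ (e + (d + 1) + 1) + 2 ^ (e + (d + 1) + 1) := by
              have : 2 ^ (e + (d + 1) + 1) = 2 * 2 ^ (e + (d + 1)) := by ring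
              omega
          _ = _ := by rw [hp]; ring
      exact Nat.lt_of_mul_lt_mul_right this
    set y : ℝ := (j + 1 / 2) * (g / 2 ^ e) with hy
    have y1 : j * (g / 2 ^ e) < y := by rw [hy]; nlinarith
    have y2 : y < (j + 1) * (g / 2 ^ e) := by rw [hy]; nlinarith
    have y3 : j₀ * g < y := by
      refine lt_of_le_of_lt ?_ y1
      have : ((j₀ * 2 ^ e : ℕ) : ℝ) ≤ j := by exact_mod_cast i3
      calc (j₀ : ℝ) * g = ((j₀ * 2 ^ e : ℕ) : ℝ) * (g / 2 ^ e) := by push_cast; field_simp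
        _ ≤ _ := mul_le_mul_of_nonneg_right this hge.le
    have y4 : y < (j₀ + 1) * g := by
      refine lt_of_lt_of_le y2 ?_
      have : ((j + 1 : ℕ) : ℝ) ≤ ((j₀ + 1) * 2 ^ e : ℕ) := by exact_mod_cast i4
      calc ((j : ℝ) + 1) * (g / 2 ^ e) = ((j + 1 : ℕ) : ℝ) * (g / 2 ^ e) := by push_cast; ring
        _ ≤ (((j₀ + 1) * 2 ^ e : ℕ) : ℝ) * (g / 2 ^ e) := mul_le_mul_of_nonneg_right this hge.le
        _ = _ := by push_cast; field_simp
    have hgrid : OnGrid (j₀ * g) ((j₀ + 1) * g) (e + (d + 1)) y := by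
      refine ⟨((2 * j + 1) * 2 ^ d - j₀ * 2 ^ (e + (d + 1)) : ℤ), ?_⟩
      rw [hy]; push_cast
      rw [pow_add, pow_succ 2 d]
      field_simp
      ring
    have hcnt := hc.count y y3 y4
    rw [if_pos (Or.inl hgrid)] at hcnt
    have hle : numAt h y ≤ rawNum h (j * (g / 2 ^ e)) ((j + 1) * (g / 2 ^ e)) := by
      unfold numAt rawNum
      refine List.countP_mono_left fun p _ hp => ?_
      simp only [decide_eq_true_eq] at hp ⊢
      rw [hp]; exact ⟨y1, y2⟩
    omega

end DyadicSearch

end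

/-! ### Preservation of the invariant. -/

noncomputable section

namespace DyadicSearch

open MeasureTheory

theorem Conf.append_of_not_mem {δ : ℝ} {G : ℝ → ℝ} {h : History} {a b : ℝ} (hc : Conf δ G h a b)
    {p : ℝ × ℝ} (hp : ¬ (a < p.1 ∧ p.1 < b)) : Conf δ G (h ++ [p]) a b := by
  unfold Conf
  rw [numIn_append_of_not_mem h hp, demIn_append_of_not_mem h hp]
  exact hc

/-- The part of the invariant that holds between the observation and the test. -/
structure Mid (lam δ : ℝ) (G : ℝ → ℝ) (bs : List Bool) (b : Bool) (g : ℝ) (i : ℕ) (m : ℕ → ℕ) :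
    Prop where
  cell : ∀ j : ℕ, Cell ((stateOf lam δ bs).histNext lam δ (bitVal b)) (j * g) ((j + 1) * g) (m j)
    (partOf ((stateOf lam δ bs).arm lam δ) ((stateOf lam δ bs).nextK lam δ) i j)
  keep : (stateOf lam δ bs).nextK lam δ = 0 ∨
    ((¬ (stateOf lam δ bs).dropLeft lam δ ((stateOf lam δ bs).histNext lam δ (bitVal b)) ∧
      ¬ (stateOf lam δ bs).dropRight lam δ ((stateOf lam δ bs).histNext lam δ (bitVal b))) ∧
      ((stateOf lam δ bs).arm lam δ = .lc ∨ (stateOf lam δ bs).arm lam δ = .cr) ∧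
      ∀ k, State.arm lam δ ⟨(stateOf lam δ bs).epoch, (stateOf lam δ bs).lo, (stateOf lam δ bs).hi,
        k, (stateOf lam δ bs).histNext lam δ (bitVal b)⟩ = (stateOf lam δ bs).arm lam δ)
  odd : Even (stateOf lam δ bs).epoch → ∀ j : ℕ, Odd j → j ≠ i + 1 →
    numAt ((stateOf lam δ bs).histNext lam δ (bitVal b)) (j * g) ≤ 1
  linked : ∀ e j : ℕ,
    Linked lam δ G true (Set.Ioo (j * (g / 2 ^ e)) ((j + 1) * (g / 2 ^ e))) (b :: bs)
  conf : GoodRun lam δ G (b :: bs) → ∀ j : ℕ,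
    Conf δ G ((stateOf lam δ bs).histNext lam δ (bitVal b)) (j * g) ((j + 1) * g)

theorem not_mem_other_cell {g : ℝ} (hg : 0 < g) {j j₀ : ℕ} (hj : j ≠ j₀) {x : ℝ}
    (h1 : j₀ * g < x) (h2 : x < (j₀ + 1) * g) : ¬ (j * g < x ∧ x < (j + 1) * g) := by
  rintro ⟨h3, h4⟩
  have h5 := lt_of_mul_lt_mul_right (h1.trans h4) hg.le
  have h6 := lt_of_mul_lt_mul_right (h3.trans h2) hg.le
  have h5' : j₀ < j + 1 := by exact_mod_cast h5
  have h6' : j < j₀ + 1 := by exact_mod_cast h6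
  omega

section

variable {lam δ : ℝ} {G : ℝ → ℝ} {bs : List Bool} {g : ℝ} {i : ℕ} {m : ℕ → ℕ}

/-- A point of the triple is a multiple of the spacing, hence interior to no dyadic cell: the
structure and estimates of all cells are untouched. -/
theorem Inv.mid_of_point (h : Inv lam δ G bs g i m) (b : Bool) {q : ℕ}
    (hq : q = i ∨ q = i + 1 ∨ q = i + 2) (hp : polOf lam δ bs = q * g)
    (hk : (stateOf lam δ bs).k = 0) (hn : (stateOf lam δ bs).nextK lam δ = 0) :
    Mid lam δ G bs b g i m := by
  have hg := h.geo.pos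
  have hnot : ∀ (e j : ℕ), ¬ (j * (g / 2 ^ e) < polOf lam δ bs ∧
      polOf lam δ bs < (j + 1) * (g / 2 ^ e)) := by
    intro e j
    have hge : 0 < g / 2 ^ e := by positivity
    have := not_mem_cell hge ((q * 2 ^ e : ℕ) : ℤ) (j : ℤ)
    have e1 : (((q * 2 ^ e : ℕ) : ℤ) : ℝ) * (g / 2 ^ e) = q * g := by push_cast; field_simp
    rw [e1, ← hp] at this
    exact_mod_cast this
  have hnot' : ∀ j : ℕ, ¬ (j * g < polOf lam δ bs ∧ polOf lam δ bs < (j + 1) * g) := by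
    intro j
    simpa using hnot 0 j
  refine ⟨fun j => ?_, Or.inl hn, fun he j hj hji => ?_, fun e j => ?_, fun hgood j => ?_⟩
  · have := h.cell j
    rw [hk, partOf_zero] at this
    rw [hn, partOf_zero]
    exact this.append_of_not_mem (hnot' j)
  · unfold State.histNext
    rw [numAt_append_of_ne]
    · exact h.odd he j hj hji
    · change polOf lam δ bs ≠ j * g
      rw [hp]
      intro hqj
      have hqj' : q = j := by exact_mod_cast mul_right_cancel₀ hg.ne' hqj
      -- In even epochs i is even, so i + 1 is the only odd index of the triple, and it is excluded
      -- by `hji`.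
      have hi : Even i := by
        rcases h.geo.shape with ⟨ho, -⟩ | ⟨-, -, hi, -⟩
        · exact absurd ho (Nat.not_odd_iff_even.2 he)
        · exact hi
      rcases hq with rfl | rfl | rfl
      · exact (Nat.not_odd_iff_even.2 hi) (hqj' ▸ hj)
      · exact hji hqj'.symm
      · exact (Nat.not_odd_iff_even.2 (hi.add (by decide))) (hqj' ▸ hj)
  · exact (h.linked e j).cons b fun _ hmem => absurd hmem (hnot e j)
  · exact (h.conf (hgood.of_suffix (List.suffix_cons _ _)) j).append_of_not_mem (hnot' j)

/-- The heart of the invariant. A sweep step either leaves all statistics of the triple unchanged,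
and with them the chosen option and the failed tests, or completes a sweep and returns the counter
to 0. -/
theorem Inv.exists_mid (h : Inv lam δ G bs g i m) (h0 : 0 < lam) (h1 : lam < 1)
    (hL : 49 / 2 ≤ Real.log (2 / δ)) (hG : Antitone G) (hG0 : ∀ x, 0 ≤ G x) (hG1 : ∀ x, G x ≤ 1)
    (b : Bool) : ∃ m', Mid lam δ G bs b g i m' := by
  rcases h.sample with ⟨q, hq, hp, hk, hn, -⟩ | ⟨j₀, hj₀, harm, hpart, hp, hn, hrad, harmRad⟩
  · exact ⟨m, h.mid_of_point b hq hp hk hn⟩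
  have hg := h.geo.pos
  have hab : (j₀ : ℝ) * g < (j₀ + 1) * g := by nlinarith
  have hc := h.cell j₀
  rw [hpart, if_pos rfl] at hc
  obtain ⟨x1, x2⟩ := sweepPt_mem hab hc.lt
  have hnext : (stateOf lam δ bs).histNext lam δ (bitVal b) = (stateOf lam δ bs).hist ++
      [(sweepPt (j₀ * g) ((j₀ + 1) * g) (m j₀) (stateOf lam δ bs).k, bitVal b)] := by
    rw [← hp]; rfl
  have hother : ∀ j : ℕ, j ≠ j₀ →
      ¬ (j * g < sweepPt (j₀ * g) ((j₀ + 1) * g) (m j₀) (stateOf lam δ bs).k ∧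
        sweepPt (j₀ * g) ((j₀ + 1) * g) (m j₀) (stateOf lam δ bs).k < (j + 1) * g) :=
    fun j hj => not_mem_other_cell hg hj x1 x2
  have hne : ∀ j : ℕ, sweepPt (j₀ * g) ((j₀ + 1) * g) (m j₀) (stateOf lam δ bs).k ≠ j * g := by
    intro j hj
    rw [hj] at x1 x2
    exact not_mem_cell hg (j : ℤ) (j₀ : ℤ) ⟨by exact_mod_cast x1, by exact_mod_cast x2⟩
  have hodd : Even (stateOf lam δ bs).epoch → ∀ j : ℕ, Odd j → j ≠ i + 1 →
      numAt ((stateOf lam δ bs).histNext lam δ (bitVal b)) (j * g) ≤ 1 := by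
    intro he j hj hji
    rw [hnext, numAt_append_of_ne _ (hne j)]
    exact h.odd he j hj hji
  have hlinked : ∀ e j : ℕ,
      Linked lam δ G true (Set.Ioo (j * (g / 2 ^ e)) ((j + 1) * (g / 2 ^ e))) (b :: bs) := by
    intro e j
    refine (h.linked e j).cons b fun hcount hmem => ?_
    rw [countIn_Ioo] at hcount
    rw [hp] at hmem
    have := newborn_center hg hc hmem.1 hmem.2 hcount
    rw [← hrad, ← hp] at this
    exact this
  rcases Nat.lt_or_ge ((stateOf lam δ bs).k + 1) (2 ^ m j₀) with hlt | hge
  · rw [Nat.mod_eq_of_lt hlt] at hn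
    have hstat : ∀ j : ℕ,
        numIn ((stateOf lam δ bs).histNext lam δ (bitVal b)) (j * g) ((j + 1) * g)
          = numIn (stateOf lam δ bs).hist (j * g) ((j + 1) * g) ∧
        demIn ((stateOf lam δ bs).histNext lam δ (bitVal b)) (j * g) ((j + 1) * g)
          = demIn (stateOf lam δ bs).hist (j * g) ((j + 1) * g) := by
      intro j
      rw [hnext]
      by_cases hj : j = j₀
      · subst hj
        have := hc.not_pow_append hab hlt (bitVal b)
        exact ⟨numIn_append_of_not_pow _ _ _ _ this, demIn_append_of_not_pow _ _ _ _ this⟩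
      · exact ⟨numIn_append_of_not_mem _ (hother j hj), demIn_append_of_not_mem _ (hother j hj)⟩
    have e1 := h.geo.left
    have e2 : (stateOf lam δ bs).ctr = ((i + 1 : ℕ) : ℝ) * g := by
      rw [h.geo.ctr]; push_cast; ring
    have e3 : (stateOf lam δ bs).right = ((i + 2 : ℕ) : ℝ) * g := by
      rw [h.geo.right]; push_cast; ring
    have e4 : (stateOf lam δ bs).right = (((i + 1 : ℕ) : ℝ) + 1) * g := by
      rw [h.geo.right]; push_cast; ring
    have hsame : SameStats (stateOf lam δ bs).hist
        ((stateOf lam δ bs).histNext lam δ (bitVal b)) (stateOf lam δ bs).left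
        (stateOf lam δ bs).ctr (stateOf lam δ bs).right := by
      refine ⟨⟨?_, ?_, ?_⟩, ⟨?_, ?_, ?_⟩, ⟨?_, ?_⟩, ⟨?_, ?_⟩⟩
      · rw [hnext, e1]; exact numAt_append_of_ne _ (hne i)
      · rw [hnext, e2]; exact numAt_append_of_ne _ (hne (i + 1))
      · rw [hnext, e3]; exact numAt_append_of_ne _ (hne (i + 2))
      · rw [hnext, e1]; exact demAt_append_of_ne _ (hne i)
      · rw [hnext, e2]; exact demAt_append_of_ne _ (hne (i + 1))
      · rw [hnext, e3]; exact demAt_append_of_ne _ (hne (i + 2))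
      · rw [e1, h.geo.ctr]; exact (hstat i).1
      · rw [e4, e2]; exact (hstat (i + 1)).1
      · rw [e1, h.geo.ctr]; exact (hstat i).2
      · rw [e4, e2]; exact (hstat (i + 1)).2
    refine ⟨m, fun j => ?_, Or.inr ⟨?_, harm, hsame.arm⟩, hodd, hlinked, fun hgood j => ?_⟩
    · rw [hpart, hn, hnext]
      split_ifs with hj
      · subst hj
        exact hc.append_partial hab hlt _
      · have := h.cell j
        rw [hpart, if_neg hj] at this
        exact this.append_of_not_mem (hother j hj)
    · rw [hsame.dropLeft, hsame.dropRight]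
      rcases h.fresh with ⟨hk, q, hq, hcount⟩ | hf
      -- In the first period of an epoch a chosen interval has no observation, so 2^(m j₀) = 1 and
      -- the step completes the sweep, contradicting `hlt`.
      · exfalso
        have hle : radAt δ (stateOf lam δ bs).hist (q * g)
            ≤ radIn lam δ (stateOf lam δ bs).hist (j₀ * g) ((j₀ + 1) * g) := by
          rw [← harmRad]
          rcases hq with rfl | rfl | rfl
          · rw [← e1]; exact (stateOf lam δ bs).le_armRad_arm lam δ .l
          · rw [← e2]; exact (stateOf lam δ bs).le_armRad_arm lam δ .c
          · rw [← e3]; exact (stateOf lam δ bs).le_armRad_arm lam δ .r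
        have hq1 : (1 : ℝ) ≤ q := by
          have := h.geo.one_le
          exact_mod_cast (by omega : 1 ≤ q)
        have := numIn_eq_zero_of_radAt_le h0 h1 hL hg (by ring) (by nlinarith) hcount hle
        have hnum := hc.num
        omega
      · exact hf
    · unfold Conf
      rw [(hstat j).1, (hstat j).2]
      exact h.conf (hgood.of_suffix (List.suffix_cons _ _)) j
  · have heq : (stateOf lam δ bs).k + 1 = 2 ^ m j₀ := le_antisymm hc.lt hge
    rw [heq, Nat.mod_self] at hn
    have hc' := hc.append_complete hab heq (bitVal b)
    refine ⟨Function.update m j₀ (m j₀ + 1), fun j => ?_, Or.inl hn, hodd, hlinked,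
      fun hgood j => ?_⟩
    · rw [hn, partOf_zero, hnext]
      by_cases hj : j = j₀
      · subst hj
        rw [Function.update_self]
        exact hc'
      · have := h.cell j
        rw [hpart, if_neg hj] at this
        rw [Function.update_of_ne hj]
        exact this.append_of_not_mem (hother j hj)
    · rw [hnext]
      by_cases hj : j = j₀
      · subst hj
        refine hc'.conf hG hG0 hG1 hab (by linarith) ?_
        -- Depth 0 is the cell itself: its deviation now covers exactly the completed grid.
        have := (hlinked 0 j).abs_devIn_le hgood
        rw [hist_cons, hp] at this
        simpa using this
      · exact (h.conf (hgood.of_suffix (List.suffix_cons _ _)) j).append_of_not_mem (hother j hj)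

theorem Mid.halve (h : Mid lam δ G bs b g i m) (hk : (stateOf lam δ bs).nextK lam δ = 0)
    (hg : 0 < g) : ∃ m' : ℕ → ℕ, ∀ j : ℕ,
      Cell ((stateOf lam δ bs).histNext lam δ (bitVal b)) (j * (g / 2)) ((j + 1) * (g / 2))
        (m' j) 0 := by
  have : ∀ j : ℕ, ∃ m', Cell ((stateOf lam δ bs).histNext lam δ (bitVal b)) (j * (g / 2))
      ((j + 1) * (g / 2)) m' 0 := by
    intro j
    rcases Nat.even_or_odd' j with ⟨r, rfl | rfl⟩
    · have hc := h.cell r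
      rw [hk, partOf_zero] at hc
      obtain ⟨m', hm'⟩ := hc.left_half (c := (r + 1 / 2) * g) (by nlinarith) (by ring)
      refine ⟨m', ?_⟩
      convert hm' using 1 <;> (push_cast; ring)
    · have hc := h.cell r
      rw [hk, partOf_zero] at hc
      obtain ⟨m', hm'⟩ := hc.right_half (c := (r + 1 / 2) * g) (by nlinarith) (by ring)
      refine ⟨m', ?_⟩
      convert hm' using 1 <;> (push_cast; ring)
  choose m' hm' using this
  exact ⟨m', hm'⟩

/-- Odd multiples of the half spacing are interior to cells, where no point is chosen twice. -/
theorem Mid.numAt_half_le (h : Mid lam δ G bs b g i m) (hg : 0 < g) {j : ℕ} (hj : Odd j) :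
    numAt ((stateOf lam δ bs).histNext lam δ (bitVal b)) (j * (g / 2)) ≤ 1 := by
  obtain ⟨r, rfl⟩ := hj
  refine (h.cell r).numAt_le_one ?_ ?_ <;> push_cast <;> nlinarith

/-- The invariant after an epoch change that halves the spacing. -/
theorem Mid.inv_of_halve (h : Mid lam δ G bs b g i m) (hk : (stateOf lam δ bs).nextK lam δ = 0)
    (hL : 49 / 2 ≤ Real.log (2 / δ)) (hG : Antitone G) (hG0 : ∀ x, 0 ≤ G x) (hG1 : ∀ x, G x ≤ 1)
    {S' : State} (hS : stateOf lam δ (b :: bs) = S') (hSk : S'.k = 0)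
    (hSh : S'.hist = (stateOf lam δ bs).histNext lam δ (bitVal b)) (hg : 0 < g) {i' : ℕ}
    (hi : Even i') (hgeo : Geo S' (g / 2) i') : ∃ m', Inv lam δ G (b :: bs) (g / 2) i' m' := by
  obtain ⟨m', hm'⟩ := h.halve hk hg
  have hg2 : 0 < g / 2 := by linarith
  have hlinked : ∀ e j : ℕ,
      Linked lam δ G true (Set.Ioo (j * (g / 2 / 2 ^ e)) ((j + 1) * (g / 2 / 2 ^ e))) (b :: bs) := by
    intro e j
    -- Depth e of the new spacing is depth e + 1 of the old one.
    have := h.linked (e + 1) j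
    rwa [show g / 2 ^ (e + 1) = g / 2 / 2 ^ e by rw [pow_succ]; field_simp] at this
  refine ⟨m', by rwa [hS], fun j => ?_, fun hk' => absurd (by rw [hS, hSk]) hk', Or.inl ?_,
    fun _ j hj _ => ?_, hlinked, fun hgood j => ?_⟩
  · rw [hS, hSk, partOf_zero, hSh]; exact hm' j
  · rw [hS]
    refine ⟨hSk, i' + 1, by simp, ?_⟩
    rw [hSh]
    exact h.numAt_half_le hg hi.add_one
  · rw [hS, hSh]; exact h.numAt_half_le hg hj
  · have hd := (hlinked 0 j).abs_devIn_le hgood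
    rw [hS, hSh] at hd ⊢
    refine (hm' j).conf hG hG0 hG1 (by nlinarith) (by linarith) ?_
    simpa using hd

/-- The invariant after an epoch change that keeps the spacing. -/
theorem Mid.inv_of_keep (h : Mid lam δ G bs b g i m) (hk : (stateOf lam δ bs).nextK lam δ = 0)
    {S' : State} (hS : stateOf lam δ (b :: bs) = S') (hSk : S'.k = 0)
    (hSh : S'.hist = (stateOf lam δ bs).histNext lam δ (bitVal b))
    (he : Even (stateOf lam δ bs).epoch) (hSe : S'.epoch = (stateOf lam δ bs).epoch + 1) {i' q : ℕ}
    (hq : q = i' ∨ q = i' + 1 ∨ q = i' + 2) (hqo : Odd q) (hqi : q ≠ i + 1)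
    (hgeo : Geo S' g i') : Inv lam δ G (b :: bs) g i' m := by
  refine ⟨by rwa [hS], fun j => ?_, fun hk' => absurd (by rw [hS, hSk]) hk', Or.inl ?_,
    fun he' j hj _ => ?_, h.linked, fun hgood j => ?_⟩
  · have := h.cell j
    rw [hk, partOf_zero] at this
    rw [hS, hSk, partOf_zero, hSh]; exact this
  · rw [hS]
    refine ⟨hSk, q, hq, ?_⟩
    rw [hSh]
    exact h.odd he q hqo hqi
  -- The new epoch is odd, so the condition on odd points is vacuous.
  · rw [hS, hSe] at he'
    exact absurd he.add_one (Nat.not_odd_iff_even.2 he')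
  · rw [hS, hSh]; exact h.conf hgood j

/-- By `Mid.keep` a test can pass only when the counter is back to 0, so every cell is a complete
grid at an epoch change and can be halved or handed over. -/
theorem Inv.cons (hI : Inv lam δ G bs g i m) (h0 : 0 < lam) (h1 : lam < 1)
    (hL : 49 / 2 ≤ Real.log (2 / δ)) (hG : Antitone G) (hG0 : ∀ x, 0 ≤ G x) (hG1 : ∀ x, G x ≤ 1)
    (b : Bool) : ∃ g' i' m', Inv lam δ G (b :: bs) g' i' m' := by
  obtain ⟨m', h⟩ := hI.exists_mid h0 h1 hL hG hG0 hG1 b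
  have hg := hI.geo.pos
  have hpar := Nat.even_or_odd (stateOf lam δ bs).epoch
  rcases (stateOf lam δ bs).stepBit_cases lam δ (bitVal b) with ⟨hd, hS⟩ | ⟨hd, hS⟩ | ⟨hd, hS⟩
  · have hk : (stateOf lam δ bs).nextK lam δ = 0 := by
      rcases h.keep with hk | ⟨⟨hk, -⟩, -⟩
      · exact hk
      · exact absurd hd hk
    rcases hpar with he | ho
    -- The new right point has odd index i + 3 and so has been chosen at most once; when the right
    -- part is discarded, i - 1 plays this role.
    · refine ⟨g, i + 1, m', h.inv_of_keep (q := i + 3) hk hS hk rfl he rfl (by simp) ?_ (by omega)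
        (hI.geo.dropLeft_even he _ _)⟩
      rcases hI.geo.shape with ⟨ho, -⟩ | ⟨-, -, hi, -⟩
      · exact absurd ho (Nat.not_odd_iff_even.2 he)
      · exact hi.add_odd (by decide)
    · obtain ⟨m'', h''⟩ := h.inv_of_halve hk hL hG hG0 hG1 hS hk rfl hg ⟨i + 1, by ring⟩
        (hI.geo.dropLeft_odd ho _ _)
      exact ⟨_, _, m'', h''⟩
  · have hk : (stateOf lam δ bs).nextK lam δ = 0 := by
      rcases h.keep with hk | ⟨⟨-, hk⟩, -⟩
      · exact hk
      · exact absurd hd hk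
    rcases hpar with he | ho
    · rcases hI.geo.shape with ⟨ho, -⟩ | ⟨-, hi2, hi, -⟩
      · exact absurd ho (Nat.not_odd_iff_even.2 he)
      refine ⟨g, i - 1, m', h.inv_of_keep (q := i - 1) hk hS hk rfl he rfl (by simp) ?_ (by omega)
        (hI.geo.dropRight_even he _ _)⟩
      exact Nat.Even.sub_odd (by omega) hi (by decide)
    · obtain ⟨m'', h''⟩ := h.inv_of_halve hk hL hG hG0 hG1 hS hk rfl hg ⟨i, by ring⟩
        (hI.geo.dropRight_odd ho _ _)
      exact ⟨_, _, m'', h''⟩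
  · have hS' : stateOf lam δ (b :: bs) = _ := hS
    refine ⟨g, i, m', ?_, fun j => ?_, ?_, ?_, ?_, h.linked, ?_⟩
    · rw [hS']
      exact ⟨hI.geo.pos, hI.geo.shape, hI.geo.hi_le, hI.geo.len⟩
    · have hc := h.cell j
      rw [hS']
      rcases h.keep with hk | ⟨-, -, harm⟩
      · rw [hk, partOf_zero] at hc
        dsimp only
        rw [hk, partOf_zero]; exact hc
      · rw [harm]; exact hc
    · rw [hS']
      intro hk'
      rcases h.keep with hk | ⟨-, harm, harm'⟩
      · exact absurd hk hk'
      · rw [harm']; exact harm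
    · rw [hS']; exact Or.inr hd
    · rw [hS']; exact h.odd
    · rw [hS']; exact h.conf

theorem inv_nil (hL : 49 / 2 ≤ Real.log (2 / δ)) (hG : Antitone G) (hG0 : ∀ x, 0 ≤ G x)
    (hG1 : ∀ x, G x ≤ 1) : Inv lam δ G [] (1 / 4) 1 (fun _ => 0) := by
  have hcell : ∀ j : ℕ, Cell [] (j * (1 / 4 : ℝ)) ((j + 1) * (1 / 4)) 0 0 := by
    intro j
    have hab : (j : ℝ) * (1 / 4) < (j + 1) * (1 / 4) := by linarith
    refine cell_zero_of_count hab fun x h1 h2 => ⟨?_, fun _ => rfl⟩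
    rintro ⟨q, hq⟩
    exfalso
    have hx : x = ((j + q : ℤ) : ℝ) * (1 / 4) := by rw [hq]; push_cast; ring
    rw [hx] at h1 h2
    exact not_mem_cell (g := 1 / 4) (by norm_num) (j + q) j
      ⟨by exact_mod_cast h1, by exact_mod_cast h2⟩
  refine ⟨⟨by norm_num, Or.inl ⟨by simp [stateOf, State.init], le_rfl, ?_, ?_⟩, ?_, ?_⟩,
    fun j => ?_, fun hk => absurd rfl hk, Or.inl ⟨rfl, 1, by simp, by simp [stateOf, State.init, numAt]⟩,
    fun _ j _ _ => by simp [stateOf, State.init, numAt], fun e j => linked_nil _ _ _ _ _,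
    fun _ j => ?_⟩
  · simp [stateOf, State.init]
  · simp [stateOf, State.init]; norm_num
  · simp [stateOf, State.init]
  · simp [stateOf, State.init, epochLen]
  · have : (stateOf lam δ []).k = 0 := rfl
    rw [this, partOf_zero]; exact hcell j
  · refine (hcell j).conf hG hG0 hG1 (by linarith) (by linarith) ?_
    have hd : ∀ U, devIn G U (stateOf lam δ []).hist = 0 := fun U => rfl
    rw [hd, abs_zero]
    exact Real.sqrt_nonneg _

theorem exists_inv (h0 : 0 < lam) (h1 : lam < 1)
    (hL : 49 / 2 ≤ Real.log (2 / δ)) (hG : Antitone G) (hG0 : ∀ x, 0 ≤ G x) (hG1 : ∀ x, G x ≤ 1)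
    (bs : List Bool) : ∃ g i m, Inv lam δ G bs g i m := by
  induction bs with
  | nil => exact ⟨_, _, _, inv_nil hL hG hG0 hG1⟩
  | cons b bs ih =>
    obtain ⟨g, i, m, h⟩ := ih
    exact h.cons h0 h1 hL hG hG0 hG1 b

end

end DyadicSearch

end

/-! ### Concavity, correctness of the tests, and the loss of one period. -/

noncomputable section

namespace DyadicSearch

open MeasureTheory

/-! ### Concavity -/

/-- The chord inequality cleared of denominators, which also covers coinciding points. -/
theorem concave_three_points {W : ℝ → ℝ} {s : Set ℝ} (hW : ConcaveOn ℝ s W) {x y z : ℝ}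
    (hx : x ∈ s) (hz : z ∈ s) (hxy : x ≤ y) (hyz : y ≤ z) :
    (z - y) * W x + (y - x) * W z ≤ (z - x) * W y := by
  rcases eq_or_lt_of_le (hxy.trans hyz) with h | h
  · have h1 : x = y := by linarith
    subst h1
    have h2 : z = x := by linarith
    subst h2
    simp
  · have hzx : 0 < z - x := by linarith
    have := hW.2 hx hz
      (show 0 ≤ (z - y) / (z - x) from div_nonneg (by linarith) hzx.le)
      (show 0 ≤ (y - x) / (z - x) from div_nonneg (by linarith) hzx.le)
      (by field_simp; ring)
    have e : (z - y) / (z - x) * x + (y - x) / (z - x) * z = y := by field_simp; ring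
    simp only [smul_eq_mul] at this
    rw [e, div_mul_eq_mul_div, div_mul_eq_mul_div, ← add_div, div_le_iff₀ hzx] at this
    linarith

/-- If the welfare differences within a triple are small, then no point of an interval around the
triple is much better than the points of the triple. -/
theorem concave_loss_le {W : ℝ → ℝ} (hW : ConcaveOn ℝ (Set.Icc 0 1) W) {l g γ x x' : ℝ}
    (hg : 0 < g) (hl : l ∈ Set.Icc (0 : ℝ) 1) (hr : l + 2 * g ∈ Set.Icc (0 : ℝ) 1)
    (hγ : 0 ≤ γ) (h1 : W (l + g) - W l ≤ 6 * γ) (h2 : W (l + 2 * g) - W l ≤ 8 * γ)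
    (h3 : W (l + g) - W (l + 2 * g) ≤ 6 * γ) (h4 : W l - W (l + 2 * g) ≤ 8 * γ)
    (hx' : x' ∈ Set.Icc (0 : ℝ) 1) (hx1' : l - 2 * g ≤ x') (hx2' : x' ≤ l + 4 * g)
    (hx1 : l ≤ x) (hx2 : x ≤ l + 2 * g) : W x' - W x ≤ 16 * γ := by
  have hx := concave_three_points hW hl hr hx1 hx2
  have hlow : W l - 8 * γ ≤ W x ∧ W (l + g) - 6 * γ ≤ W x ∧ W (l + 2 * g) - 8 * γ ≤ W x := by
    have a1 : 0 ≤ l + 2 * g - x := by linarith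
    have a2 : 0 ≤ x - l := by linarith
    have key : ∀ v, v ≤ W l → v ≤ W (l + 2 * g) → v ≤ W x := by
      intro v v1 v2
      have : 2 * g * v ≤ 2 * g * W x := by nlinarith
      exact le_of_mul_le_mul_left this (by linarith)
    refine ⟨key _ ?_ ?_, key _ ?_ ?_, key _ ?_ ?_⟩ <;> linarith
  obtain ⟨b1, b2, b3⟩ := hlow
  have hc : l + g ∈ Set.Icc (0 : ℝ) 1 := ⟨by linarith [hl.1], by linarith [hr.2]⟩
  -- In each case a chord from x' across one triple point to another bounds the gain of x' over the
  -- middle one: 8γ outside the triple (x' is at most 2g away, with slope taken over 2g), 6γ inside.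
  -- Adding the gap to W x from `hlow` gives 16γ or 12γ.
  rcases le_total x' l with hA | hA
  · have := concave_three_points hW hx' hr hA (by linarith)
    have : 2 * g * (W x' - W l) ≤ 2 * g * (8 * γ) := by nlinarith
    have := le_of_mul_le_mul_left this (by linarith)
    linarith
  rcases le_total x' (l + g) with hB | hB
  · have := concave_three_points hW hx' hr hB (by linarith)
    have : g * (W x' - W (l + g)) ≤ g * (6 * γ) := by nlinarith
    have := le_of_mul_le_mul_left this hg
    linarith
  rcases le_total x' (l + 2 * g) with hC | hC
  · have := concave_three_points hW hl hx' (y := l + g) (by linarith) hB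
    have : g * (W x' - W (l + g)) ≤ g * (6 * γ) := by nlinarith
    have := le_of_mul_le_mul_left this hg
    linarith
  · have := concave_three_points hW hl hx' (y := l + 2 * g) (by linarith) hC
    have : 2 * g * (W x' - W (l + 2 * g)) ≤ 2 * g * (8 * γ) := by nlinarith
    have := le_of_mul_le_mul_left this (by linarith)
    linarith

/-! ### The tests in real terms -/

/-- Real value of the radius at a point that has been chosen. -/
def realRadAt (δ : ℝ) (h : History) (x : ℝ) : ℝ :=
  x * √(1 / (2 * (numAt h x : ℝ)) * Real.log (2 / δ))

/-- Real value of the radius of an interval. -/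
def realRadIn (lam δ : ℝ) (h : History) (a b : ℝ) : ℝ :=
  lam * (b - a) * (√(1 / (2 * ((numIn h a b : ℝ) + 1)) * Real.log (2 / δ))
      + 2 / ((numIn h a b : ℝ) + 1))

theorem radIn_eq (lam δ : ℝ) (h : History) (a b : ℝ) :
    radIn lam δ h a b = (realRadIn lam δ h a b : EReal) := rfl

theorem radAt_of_ne {δ : ℝ} {h : History} {x : ℝ} (hx : numAt h x ≠ 0) :
    radAt δ h x = (realRadAt δ h x : EReal) := if_neg hx

theorem radAt_of_eq {δ : ℝ} {h : History} {x : ℝ} (hx : numAt h x = 0) : radAt δ h x = ⊤ :=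
  if_pos hx

theorem radAdj_of_ne {lam δ : ℝ} {h : History} {a b : ℝ} (ha : numAt h a ≠ 0) (hb : numAt h b ≠ 0) :
    radAdj lam δ h a b
      = ((realRadAt δ h b + realRadAt δ h a + realRadIn lam δ h a b : ℝ) : EReal) := by
  rw [radAdj, radAt_of_ne ha, radAt_of_ne hb, radIn_eq]; push_cast; rfl

theorem radAdj_of_eq {lam δ : ℝ} {h : History} {a b : ℝ} (hab : numAt h a = 0 ∨ numAt h b = 0) :
    radAdj lam δ h a b = ⊤ := by
  unfold radAdj
  rw [radIn_eq]
  rcases hab with ha | hb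
  · rw [radAt_of_eq ha]
    by_cases hb : numAt h b = 0
    · rw [radAt_of_eq hb]; simp
    · rw [radAt_of_ne hb]; simp
  · rw [radAt_of_eq hb]
    by_cases ha : numAt h a = 0
    · rw [radAt_of_eq ha]; simp
    · rw [radAt_of_ne ha]; simp

theorem radOuter_of_ne {lam δ : ℝ} {h : History} {l c r : ℝ} (hl : numAt h l ≠ 0)
    (hr : numAt h r ≠ 0) :
    radOuter lam δ h l c r = ((realRadAt δ h r + realRadAt δ h l + realRadIn lam δ h l c
      + realRadIn lam δ h c r : ℝ) : EReal) := by
  rw [radOuter, radAt_of_ne hl, radAt_of_ne hr, radIn_eq, radIn_eq]; push_cast; rfl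

theorem radOuter_of_eq {lam δ : ℝ} {h : History} {l c r : ℝ}
    (hlr : numAt h l = 0 ∨ numAt h r = 0) : radOuter lam δ h l c r = ⊤ := by
  have := radAdj_of_eq (lam := lam) (δ := δ) hlr
  unfold radOuter
  unfold radAdj at this
  rw [radIn_eq] at this ⊢
  rw [radIn_eq]
  rcases hlr with ha | hb
  · rw [radAt_of_eq ha]
    by_cases hb : numAt h r = 0
    · rw [radAt_of_eq hb]; simp
    · rw [radAt_of_ne hb]; simp
  · rw [radAt_of_eq hb]
    by_cases ha : numAt h l = 0
    · rw [radAt_of_eq ha]; simp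
    · rw [radAt_of_ne ha]; simp

/-- All the estimates that concern a triple are within their radii. -/
structure EstOK (δ : ℝ) (G : ℝ → ℝ) (h : History) (l c r : ℝ) : Prop where
  point : ∀ x, numAt h x ≠ 0 →
    |demAt h x - G x| ≤ √(1 / (2 * (numAt h x : ℝ)) * Real.log (2 / δ))
  lc : Conf δ G h l c
  cr : Conf δ G h c r

section Tests

variable {lam δ : ℝ} {μ : Measure ℝ} [IsProbabilityMeasure μ] {h : History} {l c r : ℝ}

theorem abs_revenue_le {G : ℝ → ℝ} {x : ℝ} (hx : 0 ≤ x)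
    (hd : |demAt h x - G x| ≤ √(1 / (2 * (numAt h x : ℝ)) * Real.log (2 / δ))) :
    |x * demAt h x - x * G x| ≤ realRadAt δ h x := by
  rw [← mul_sub, abs_mul, abs_of_nonneg hx]
  exact mul_le_mul_of_nonneg_left hd hx

theorem Conf.abs_le {G : ℝ → ℝ} {a b : ℝ} (hlam : 0 ≤ lam) (hc : Conf δ G h a b) :
    |lam * (b - a) * demIn h a b - lam * ∫ z in a..b, G z| ≤ realRadIn lam δ h a b := by
  rw [mul_assoc, ← mul_sub, abs_mul, abs_of_nonneg hlam, realRadIn, mul_assoc]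
  exact mul_le_mul_of_nonneg_left hc hlam

theorem abs_diffAdj_sub_le {a b : ℝ} (hlam : 0 ≤ lam) (ha0 : 0 ≤ a) (hb0 : 0 ≤ b)
    (hp : ∀ x, numAt h x ≠ 0 →
      |demAt h x - demand μ x| ≤ √(1 / (2 * (numAt h x : ℝ)) * Real.log (2 / δ)))
    (hc : Conf δ (demand μ) h a b) (ha : numAt h a ≠ 0) (hb : numAt h b ≠ 0) :
    |diffAdj lam h a b - (expWelfare lam μ b - expWelfare lam μ a)|
      ≤ realRadAt δ h b + realRadAt δ h a + realRadIn lam δ h a b := by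
  have h1 := abs_le.1 (abs_revenue_le ha0 (hp a ha))
  have h2 := abs_le.1 (abs_revenue_le hb0 (hp b hb))
  have h3 := abs_le.1 (hc.abs_le hlam)
  rw [expWelfare_sub, diffAdj, abs_le]
  constructor <;> linarith [h1.1, h1.2, h2.1, h2.2, h3.1, h3.2]

theorem abs_diffOuter_sub_le (hlam : 0 ≤ lam) (hl0 : 0 ≤ l) (hr0 : 0 ≤ r)
    (he : EstOK δ (demand μ) h l c r) (hl : numAt h l ≠ 0) (hr : numAt h r ≠ 0) :
    |diffOuter lam h l c r - (expWelfare lam μ r - expWelfare lam μ l)|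
      ≤ realRadAt δ h r + realRadAt δ h l + realRadIn lam δ h l c + realRadIn lam δ h c r := by
  have h1 := abs_le.1 (abs_revenue_le hl0 (he.point l hl))
  have h2 := abs_le.1 (abs_revenue_le hr0 (he.point r hr))
  have h3 := abs_le.1 (he.lc.abs_le hlam)
  have h4 := abs_le.1 (he.cr.abs_le hlam)
  have e : expWelfare lam μ r - expWelfare lam μ l
      = (expWelfare lam μ r - expWelfare lam μ c) + (expWelfare lam μ c - expWelfare lam μ l) := by
    ring
  rw [e, expWelfare_sub, expWelfare_sub, diffOuter, diffAdj, diffAdj, abs_le]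
  constructor <;> linarith [h1.1, h1.2, h2.1, h2.2, h3.1, h3.2, h4.1, h4.2]

/-- The estimate minus its radius is a lower bound for the welfare difference, so a passed test
certifies its sign. A point never chosen makes the radius infinite, and then the test cannot pass.
-/
theorem dropLeft_correct {S : State} (hlam : 0 ≤ lam) (hl0 : 0 ≤ S.left) (hc0 : 0 ≤ S.ctr)
    (hr0 : 0 ≤ S.right) (he : EstOK δ (demand μ) h S.left S.ctr S.right)
    (hd : S.dropLeft lam δ h) :
    expWelfare lam μ S.left ≤ expWelfare lam μ S.ctr ∨
      expWelfare lam μ S.left ≤ expWelfare lam μ S.right := by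
  rcases hd with hd | hd
  · left
    by_cases hn : numAt h S.left = 0 ∨ numAt h S.ctr = 0
    · rw [radAdj_of_eq hn] at hd
      simp at hd
    · push Not at hn
      rw [radAdj_of_ne hn.1 hn.2] at hd
      have hd' : 0 ≤ diffAdj lam h S.left S.ctr - (realRadAt δ h S.ctr + realRadAt δ h S.left
          + realRadIn lam δ h S.left S.ctr) := by exact_mod_cast hd
      have := abs_le.1 (abs_diffAdj_sub_le hlam hl0 hc0 he.point he.lc hn.1 hn.2)
      linarith [this.2]
  · right
    by_cases hn : numAt h S.left = 0 ∨ numAt h S.right = 0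
    · rw [radOuter_of_eq hn] at hd
      simp at hd
    · push Not at hn
      rw [radOuter_of_ne hn.1 hn.2] at hd
      have hd' : 0 ≤ diffOuter lam h S.left S.ctr S.right - (realRadAt δ h S.right
          + realRadAt δ h S.left + realRadIn lam δ h S.left S.ctr
          + realRadIn lam δ h S.ctr S.right) := by exact_mod_cast hd
      have := abs_le.1 (abs_diffOuter_sub_le hlam hl0 hr0 he hn.1 hn.2)
      linarith [this.2]

theorem dropRight_correct {S : State} (hlam : 0 ≤ lam) (hl0 : 0 ≤ S.left) (hc0 : 0 ≤ S.ctr)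
    (hr0 : 0 ≤ S.right) (he : EstOK δ (demand μ) h S.left S.ctr S.right)
    (hd : S.dropRight lam δ h) :
    expWelfare lam μ S.right ≤ expWelfare lam μ S.ctr ∨
      expWelfare lam μ S.right ≤ expWelfare lam μ S.left := by
  rcases hd with hd | hd
  · left
    by_cases hn : numAt h S.ctr = 0 ∨ numAt h S.right = 0
    · rw [radAdj_of_eq hn] at hd
      simp at hd
    · push Not at hn
      rw [radAdj_of_ne hn.1 hn.2] at hd
      have hd' : diffAdj lam h S.ctr S.right + (realRadAt δ h S.right + realRadAt δ h S.ctr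
          + realRadIn lam δ h S.ctr S.right) ≤ 0 := by exact_mod_cast hd
      have := abs_le.1 (abs_diffAdj_sub_le hlam hc0 hr0 he.point he.cr hn.1 hn.2)
      linarith [this.1]
  · right
    by_cases hn : numAt h S.left = 0 ∨ numAt h S.right = 0
    · rw [radOuter_of_eq hn] at hd
      simp at hd
    · push Not at hn
      rw [radOuter_of_ne hn.1 hn.2] at hd
      have hd' : diffOuter lam h S.left S.ctr S.right + (realRadAt δ h S.right
          + realRadAt δ h S.left + realRadIn lam δ h S.left S.ctr
          + realRadIn lam δ h S.ctr S.right) ≤ 0 := by exact_mod_cast hd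
      have := abs_le.1 (abs_diffOuter_sub_le hlam hl0 hr0 he hn.1 hn.2)
      linarith [this.1]

/-- When no test is passed and all radii are at most `γ`, the welfare differences are `O(γ)`. -/
theorem diff_le_of_not_drop {S : State} {γ : ℝ} (hlam : 0 ≤ lam) (hl0 : 0 ≤ S.left)
    (hc0 : 0 ≤ S.ctr) (hr0 : 0 ≤ S.right)
    (he : EstOK δ (demand μ) S.hist S.left S.ctr S.right)
    (hγ : ∀ u, S.armRad lam δ u ≤ (γ : EReal))
    (hL : ¬ S.dropLeft lam δ S.hist) (hR : ¬ S.dropRight lam δ S.hist) :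
    expWelfare lam μ S.ctr - expWelfare lam μ S.left ≤ 6 * γ ∧
    expWelfare lam μ S.right - expWelfare lam μ S.left ≤ 8 * γ ∧
    expWelfare lam μ S.ctr - expWelfare lam μ S.right ≤ 6 * γ ∧
    expWelfare lam μ S.left - expWelfare lam μ S.right ≤ 8 * γ := by
  have hpt : ∀ x, radAt δ S.hist x ≤ (γ : EReal) → numAt S.hist x ≠ 0 ∧ realRadAt δ S.hist x ≤ γ := by
    intro x hx
    by_cases hn : numAt S.hist x = 0
    · rw [radAt_of_eq hn] at hx
      exact absurd (top_le_iff.1 hx) (EReal.coe_ne_top _)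
    · rw [radAt_of_ne hn] at hx
      exact ⟨hn, by exact_mod_cast hx⟩
  obtain ⟨nl, gl⟩ := hpt _ (hγ .l)
  obtain ⟨nc, gc⟩ := hpt _ (hγ .c)
  obtain ⟨nr, gr⟩ := hpt _ (hγ .r)
  have glc : realRadIn lam δ S.hist S.left S.ctr ≤ γ := EReal.coe_le_coe_iff.1 (hγ .lc)
  have gcr : realRadIn lam δ S.hist S.ctr S.right ≤ γ := EReal.coe_le_coe_iff.1 (hγ .cr)
  have a1 := abs_le.1 (abs_diffAdj_sub_le hlam hl0 hc0 he.point he.lc nl nc)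
  have a2 := abs_le.1 (abs_diffAdj_sub_le hlam hc0 hr0 he.point he.cr nc nr)
  have a3 := abs_le.1 (abs_diffOuter_sub_le hlam hl0 hr0 he nl nr)
  unfold State.dropLeft at hL
  unfold State.dropRight at hR
  push Not at hL hR
  rw [radAdj_of_ne nl nc, radOuter_of_ne nl nr] at hL
  rw [radAdj_of_ne nc nr, radOuter_of_ne nl nr] at hR
  -- A failed test bounds the estimate by the sum of its radii, three for neighbours and four for
  -- the outer pair. The estimation error is at most the same sum, hence 6γ and 8γ.
  have l1 : diffAdj lam S.hist S.left S.ctr - (realRadAt δ S.hist S.ctr + realRadAt δ S.hist S.left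
      + realRadIn lam δ S.hist S.left S.ctr) < 0 := by exact_mod_cast hL.1
  have l2 : diffOuter lam S.hist S.left S.ctr S.right - (realRadAt δ S.hist S.right
      + realRadAt δ S.hist S.left + realRadIn lam δ S.hist S.left S.ctr
      + realRadIn lam δ S.hist S.ctr S.right) < 0 := by exact_mod_cast hL.2
  have r1 : 0 < diffAdj lam S.hist S.ctr S.right + (realRadAt δ S.hist S.right
      + realRadAt δ S.hist S.ctr + realRadIn lam δ S.hist S.ctr S.right) := by exact_mod_cast hR.1
  have r2 : 0 < diffOuter lam S.hist S.left S.ctr S.right + (realRadAt δ S.hist S.right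
      + realRadAt δ S.hist S.left + realRadIn lam δ S.hist S.left S.ctr
      + realRadIn lam δ S.hist S.ctr S.right) := by exact_mod_cast hR.2
  refine ⟨?_, ?_, ?_, ?_⟩ <;> linarith [a1.1, a1.2, a2.1, a2.2, a3.1, a3.2]

end Tests

section Run

variable {lam δ : ℝ} {G : ℝ → ℝ} {bs : List Bool} {g : ℝ} {i : ℕ} {m : ℕ → ℕ}

theorem Inv.estOK (h : Inv lam δ G bs g i m) (hg : GoodRun lam δ G bs) :
    EstOK δ G (stateOf lam δ bs).hist (stateOf lam δ bs).left (stateOf lam δ bs).ctr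
      (stateOf lam δ bs).right := by
  refine ⟨fun x hx => abs_demAt_sub_le hg hx, ?_, ?_⟩
  · rw [h.geo.left, h.geo.ctr]; exact h.conf hg i
  · have := h.conf hg (i + 1)
    rw [h.geo.right, h.geo.ctr]
    convert this using 1 <;> (push_cast; ring)

theorem Mid.estOK {b : Bool} (h : Mid lam δ G bs b g i m) (hgeo : Geo (stateOf lam δ bs) g i)
    (hg : GoodRun lam δ G (b :: bs)) :
    EstOK δ G ((stateOf lam δ bs).histNext lam δ (bitVal b)) (stateOf lam δ bs).left
      (stateOf lam δ bs).ctr (stateOf lam δ bs).right := by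
  refine ⟨fun x hx => ?_, ?_, ?_⟩
  · have := abs_demAt_sub_le (x := x) hg
    rw [hist_cons] at this
    exact this hx
  · rw [hgeo.left, hgeo.ctr]; exact h.conf hg i
  · have := h.conf hg (i + 1)
    rw [hgeo.right, hgeo.ctr]
    convert this using 1 <;> (push_cast; ring)

theorem Inv.polOf_mem (h : Inv lam δ G bs g i m) :
    (stateOf lam δ bs).left ≤ polOf lam δ bs ∧ polOf lam δ bs ≤ (stateOf lam δ bs).right := by
  have hg := h.geo.pos
  rw [h.geo.left, h.geo.right]
  rcases h.sample with ⟨q, hq, hp, -⟩ | ⟨j₀, hj, -, hpart, hp, -⟩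
  · rw [hp]
    rcases hq with rfl | rfl | rfl <;> push_cast <;> constructor <;> nlinarith
  · have hc := h.cell j₀
    rw [hpart, if_pos rfl] at hc
    have hx := sweepPt_mem (a := j₀ * g) (b := (j₀ + 1) * g) (by nlinarith) hc.lt
    rw [hp]
    rcases hj with rfl | rfl
    · constructor <;> nlinarith [hx.1, hx.2]
    · have h1 := hx.1
      have h2 := hx.2
      push_cast at h1 h2 ⊢
      constructor <;> nlinarith

theorem Inv.triple_mem (h : Inv lam δ G bs g i m) :
    0 ≤ (stateOf lam δ bs).left ∧ (stateOf lam δ bs).right ≤ 1 :=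
  ⟨by have := h.geo.lo_nonneg; have := h.geo.lo_le.2; have := h.geo.pos; linarith,
    h.geo.right_le_one⟩

theorem Inv.polOf_mem_unit (h : Inv lam δ G bs g i m) : polOf lam δ bs ∈ Set.Icc (0 : ℝ) 1 :=
  ⟨h.triple_mem.1.trans h.polOf_mem.1, h.polOf_mem.2.trans h.triple_mem.2⟩

/-- Loss of a period in which no test would be passed on the present history. -/
theorem Inv.loss_le {μ : Measure ℝ} [IsProbabilityMeasure μ] {γ x' : ℝ}
    (h : Inv lam δ (demand μ) bs g i m)
    (hW : ConcaveOn ℝ (Set.Icc 0 1) (expWelfare lam μ)) (hlam : 0 ≤ lam)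
    (hg : GoodRun lam δ (demand μ) bs)
    (hL : ¬ (stateOf lam δ bs).dropLeft lam δ (stateOf lam δ bs).hist)
    (hR : ¬ (stateOf lam δ bs).dropRight lam δ (stateOf lam δ bs).hist)
    (hγ0 : 0 ≤ γ)
    (hγ : (stateOf lam δ bs).armRad lam δ ((stateOf lam δ bs).arm lam δ) = (γ : EReal))
    (h1 : (stateOf lam δ bs).lo ≤ x') (h2 : x' ≤ (stateOf lam δ bs).hi) :
    expWelfare lam μ x' - expWelfare lam μ (polOf lam δ bs) ≤ 16 * γ := by
  have hgp := h.geo.pos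
  have hlr := h.triple_mem
  have hlo := h.geo.lo_le
  have hhi := h.geo.le_hi
  have hlo0 := h.geo.lo_nonneg
  have hhi1 := h.geo.hi_le
  have hpol := h.polOf_mem
  have ec : (stateOf lam δ bs).ctr = (stateOf lam δ bs).left + g := by
    rw [h.geo.left, h.geo.ctr]; ring
  have er : (stateOf lam δ bs).right = (stateOf lam δ bs).left + 2 * g := by
    rw [h.geo.left, h.geo.right]; ring
  obtain ⟨d1, d2, d3, d4⟩ := diff_le_of_not_drop hlam hlr.1 (by rw [ec]; linarith)
    (by rw [er]; linarith) (h.estOK hg)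
    (fun u => ((stateOf lam δ bs).le_armRad_arm lam δ u).trans hγ.le) hL hR
  rw [ec] at d1 d3
  rw [er] at d2 d3 d4 hlr hhi hpol
  exact concave_loss_le hW hgp ⟨hlr.1, by linarith⟩ ⟨by linarith, hlr.2⟩ hγ0 d1 d2 d3 d4
    ⟨by linarith, by linarith⟩ (by linarith) (by linarith) hpol.1 hpol.2

theorem Inv.interval_subset {b : Bool} (h : Inv lam δ G bs g i m) :
    (stateOf lam δ bs).lo ≤ (stateOf lam δ (b :: bs)).lo ∧
      (stateOf lam δ (b :: bs)).hi ≤ (stateOf lam δ bs).hi := by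
  have hg := h.geo.pos
  have h1 := h.geo.lo_le
  have h2 := h.geo.le_hi
  have hS : stateOf lam δ (b :: bs) = (stateOf lam δ bs).stepBit lam δ (bitVal b) := rfl
  rw [hS]
  rcases (stateOf lam δ bs).stepBit_cases lam δ (bitVal b) with ⟨-, h⟩ | ⟨-, h⟩ | ⟨-, h⟩ <;>
    rw [h] <;> constructor <;> dsimp only <;> linarith

/-- On a good run, the active interval contains a point that is at least as good as any given
point. -/
theorem exists_mem_interval_ge {μ : Measure ℝ} [IsProbabilityMeasure μ]
    (hW : ConcaveOn ℝ (Set.Icc 0 1) (expWelfare lam μ)) (h0 : 0 < lam) (h1 : lam < 1)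
    (hL : 49 / 2 ≤ Real.log (2 / δ)) {x : ℝ} (hx : x ∈ Set.Icc (0 : ℝ) 1) (bs : List Bool)
    (hgood : GoodRun lam δ (demand μ) bs) :
    ∃ x', (stateOf lam δ bs).lo ≤ x' ∧ x' ≤ (stateOf lam δ bs).hi ∧
      expWelfare lam μ x ≤ expWelfare lam μ x' := by
  induction bs with
  | nil => exact ⟨x, hx.1, hx.2, le_rfl⟩
  | cons b bs ih =>
    obtain ⟨x', hx1, hx2, hx3⟩ := ih (hgood.of_suffix (List.suffix_cons _ _))
    obtain ⟨g, i, m, h⟩ := exists_inv h0 h1 hL (demand_antitone μ) (demand_nonneg μ)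
      (demand_le_one μ) bs
    obtain ⟨m', hm⟩ := h.exists_mid h0 h1 hL (demand_antitone μ) (demand_nonneg μ)
      (demand_le_one μ) b
    have hest := hm.estOK h.geo hgood
    have hg := h.geo.pos
    have hlr := h.triple_mem
    have hlo := h.geo.lo_le
    have hhi := h.geo.le_hi
    have hlo0 := h.geo.lo_nonneg
    have hhi1 := h.geo.hi_le
    have ec : (stateOf lam δ bs).ctr = (stateOf lam δ bs).left + g := by
      rw [h.geo.left, h.geo.ctr]; ring
    have er : (stateOf lam δ bs).right = (stateOf lam δ bs).left + 2 * g := by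
      rw [h.geo.left, h.geo.right]; ring
    have hS : stateOf lam δ (b :: bs) = (stateOf lam δ bs).stepBit lam δ (bitVal b) := rfl
    rw [hS]
    have hx01 : x' ∈ Set.Icc (0 : ℝ) 1 := ⟨by linarith, by linarith⟩
    rcases (stateOf lam δ bs).stepBit_cases lam δ (bitVal b) with ⟨hd, h'⟩ | ⟨hd, h'⟩ | ⟨-, h'⟩
    · rw [h']
      dsimp only
      by_cases hxl : (stateOf lam δ bs).left ≤ x'
      · exact ⟨x', hxl, hx2, hx3⟩
      -- If x' is cut off, the endpoint replaces it: W does not decrease from `left` to `ctr` or to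
      -- `right`, so by concavity it is no larger at x' than at `left`.
      · push Not at hxl
        refine ⟨(stateOf lam δ bs).left, le_rfl, by linarith, hx3.trans ?_⟩
        rcases dropLeft_correct h0.le hlr.1 (by linarith) (by linarith) hest hd with hc | hc
        · have := concave_three_points hW hx01 (z := (stateOf lam δ bs).ctr)
            ⟨by linarith, by linarith⟩ hxl.le (by linarith)
          have : g * expWelfare lam μ x' ≤ g * expWelfare lam μ (stateOf lam δ bs).left := by
            rw [ec] at this hc
            nlinarith
          exact le_of_mul_le_mul_left this hg
        · have := concave_three_points hW hx01 (z := (stateOf lam δ bs).right)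
            ⟨by linarith, by linarith⟩ hxl.le (by linarith)
          have : 2 * g * expWelfare lam μ x' ≤ 2 * g * expWelfare lam μ (stateOf lam δ bs).left := by
            rw [er] at this hc
            nlinarith
          exact le_of_mul_le_mul_left this (by linarith)
    · rw [h']
      dsimp only
      by_cases hxl : x' ≤ (stateOf lam δ bs).right
      · exact ⟨x', hx1, hxl, hx3⟩
      · push Not at hxl
        refine ⟨(stateOf lam δ bs).right, by linarith, le_rfl, hx3.trans ?_⟩
        rcases dropRight_correct h0.le hlr.1 (by linarith) (by linarith) hest hd with hc | hc
        · have := concave_three_points hW (x := (stateOf lam δ bs).ctr)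
            ⟨by linarith, by linarith⟩ hx01 (y := (stateOf lam δ bs).right) (by linarith) hxl.le
          have : g * expWelfare lam μ x' ≤ g * expWelfare lam μ (stateOf lam δ bs).right := by
            have e : (stateOf lam δ bs).right - (stateOf lam δ bs).ctr = g := by linarith
            rw [e, show x' - (stateOf lam δ bs).ctr = (x' - (stateOf lam δ bs).right) + g by linarith]
              at this
            nlinarith
          exact le_of_mul_le_mul_left this hg
        · have := concave_three_points hW (x := (stateOf lam δ bs).left)
            ⟨by linarith, by linarith⟩ hx01 (y := (stateOf lam δ bs).right) (by linarith) hxl.le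
          have : 2 * g * expWelfare lam μ x' ≤ 2 * g * expWelfare lam μ (stateOf lam δ bs).right := by
            have e : (stateOf lam δ bs).right - (stateOf lam δ bs).left = 2 * g := by linarith
            rw [e, show x' - (stateOf lam δ bs).left = (x' - (stateOf lam δ bs).right) + 2 * g by
              linarith] at this
            nlinarith
          exact le_of_mul_le_mul_left this (by linarith)
    · rw [h']; exact ⟨x', hx1, hx2, hx3⟩

end Run

end DyadicSearch

end

/-! ### Summation of radii within an epoch, count of epochs, and loss on good runs. -/

noncomputable section

namespace DyadicSearch

open MeasureTheory ProbabilityTheory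
open scoped ENNReal

/-! ### The potential of a triple -/

/-- Sum of the square roots of the numbers of observations of the five sampling options. -/
def psi (h : History) (l c r : ℝ) : ℝ :=
  √(numAt h l) + √(numAt h c) + √(numAt h r) + √(rawNum h l c) + √(rawNum h c r)

theorem psi_nonneg (h : History) (l c r : ℝ) : 0 ≤ psi h l c r := by
  unfold psi; positivity

theorem psi_le (h : History) (l c r : ℝ) : psi h l c r ≤ 5 * √h.length := by
  have h1 : ∀ x, √(numAt h x) ≤ √h.length := fun x =>
    Real.sqrt_le_sqrt (by exact_mod_cast List.countP_le_length)
  have h2 : ∀ a b, √(rawNum h a b) ≤ √h.length := fun a b =>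
    Real.sqrt_le_sqrt (by exact_mod_cast List.countP_le_length)
  unfold psi
  linarith [h1 l, h1 c, h1 r, h2 l c, h2 c r]

theorem sqrt_numAt_le_append (h : History) (p : ℝ × ℝ) (x : ℝ) :
    √(numAt h x) ≤ √(numAt (h ++ [p]) x) :=
  Real.sqrt_le_sqrt (by rw [numAt_append]; push_cast; split_ifs <;> simp)

theorem sqrt_rawNum_le_append (h : History) (p : ℝ × ℝ) (a b : ℝ) :
    √(rawNum h a b) ≤ √(rawNum (h ++ [p]) a b) :=
  Real.sqrt_le_sqrt (by rw [rawNum_append]; push_cast; split_ifs <;> simp)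

/-- Turns a sum of radii into a telescoping sum of square roots. -/
theorem one_div_sqrt_succ_le (n : ℕ) : 1 / √((n : ℝ) + 1) ≤ 2 * (√((n : ℝ) + 1) - √n) := by
  have hn : (0 : ℝ) ≤ n := n.cast_nonneg
  have h1 : 0 < √((n : ℝ) + 1) := Real.sqrt_pos.2 (by linarith)
  have h2 := Real.sq_sqrt (show 0 ≤ (n : ℝ) + 1 by linarith)
  have h3 := Real.sq_sqrt hn
  rw [div_le_iff₀ h1]
  nlinarith [sq_nonneg (√((n : ℝ) + 1) - √n)]

theorem hist_length (lam δ : ℝ) (bs : List Bool) : (stateOf lam δ bs).hist.length = bs.length := by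
  induction bs with
  | nil => rfl
  | cons b bs ih => rw [hist_cons, List.length_append, ih]; rfl

section Run

variable {lam δ : ℝ} {bs : List Bool} {g : ℝ} {i : ℕ} {m : ℕ → ℕ}

theorem realRadAt_le {h : History} {x L : ℝ} (hL : Real.log (2 / δ) = L) (hL0 : 0 ≤ L) (hx0 : 0 ≤ x)
    (hx1 : x ≤ 1) (hn : numAt h x ≠ 0) :
    0 ≤ realRadAt δ h x ∧ realRadAt δ h x ≤ (√L + 4) / √((numAt h x : ℝ) + 1) := by
  have hn1 : (1 : ℝ) ≤ numAt h x := by exact_mod_cast Nat.one_le_iff_ne_zero.2 hn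
  refine ⟨mul_nonneg hx0 (Real.sqrt_nonneg _), ?_⟩
  unfold realRadAt
  rw [hL]
  calc _ ≤ 1 * √(1 / (2 * (numAt h x : ℝ)) * L) :=
        mul_le_mul_of_nonneg_right hx1 (Real.sqrt_nonneg _)
    _ ≤ √(L / ((numAt h x : ℝ) + 1)) := by
        rw [one_mul]
        apply Real.sqrt_le_sqrt
        rw [div_mul_eq_mul_div, one_mul]
        exact div_le_div_of_nonneg_left hL0 (by linarith) (by linarith)
    _ = √L / √((numAt h x : ℝ) + 1) := Real.sqrt_div hL0 _
    _ ≤ _ := by gcongr; linarith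

/-- The frozen count may lag behind the true one, but, by `hn`, by no more than a factor 2; this
only costs a constant. -/
theorem realRadIn_le {h : History} {a b L : ℝ} {n : ℕ} (hL : Real.log (2 / δ) = L) (hL0 : 0 ≤ L)
    (h0 : 0 ≤ lam) (h1 : lam ≤ 1) (hab0 : 0 ≤ b - a) (hab : b - a ≤ 1)
    (hn : n + 1 ≤ 2 * (numIn h a b + 1)) :
    0 ≤ realRadIn lam δ h a b ∧ realRadIn lam δ h a b ≤ (√L + 4) / √((n : ℝ) + 1) := by
  have hn' : (n : ℝ) + 1 ≤ 2 * ((numIn h a b : ℝ) + 1) := by exact_mod_cast hn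
  have hn0 : (0 : ℝ) < n + 1 := by positivity
  have hN0 : (0 : ℝ) < (numIn h a b : ℝ) + 1 := by positivity
  refine ⟨by unfold realRadIn; positivity, ?_⟩
  unfold realRadIn
  rw [hL]
  have hs1 : 1 ≤ √((n : ℝ) + 1) := Real.one_le_sqrt.2 (by linarith [n.cast_nonneg (α := ℝ)])
  have hs2 := Real.sq_sqrt hn0.le
  calc _ ≤ 1 * (√(1 / (2 * ((numIn h a b : ℝ) + 1)) * L) + 2 / ((numIn h a b : ℝ) + 1)) := by
        refine mul_le_mul_of_nonneg_right ?_ (by positivity)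
        nlinarith
    _ ≤ √(L / ((n : ℝ) + 1)) + 4 / √((n : ℝ) + 1) := by
        rw [one_mul]
        refine add_le_add (Real.sqrt_le_sqrt ?_) ?_
        · rw [div_mul_eq_mul_div, one_mul]
          exact div_le_div_of_nonneg_left hL0 hn0 hn'
        · rw [div_le_div_iff₀ hN0 (by linarith)]
          nlinarith
    _ = _ := by rw [Real.sqrt_div hL0, ← add_div]

/-- The radius of the option chosen in a period is controlled by the increase of the potential. -/
theorem Inv.radius {G : ℝ → ℝ} (h : Inv lam δ G bs g i m) (h0 : 0 ≤ lam) (h1 : lam ≤ 1)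
    (hL0 : 0 ≤ Real.log (2 / δ)) (y : ℝ) :
    ∃ n : ℕ, psi (stateOf lam δ bs).hist (stateOf lam δ bs).left (stateOf lam δ bs).ctr
        (stateOf lam δ bs).right + (√((n : ℝ) + 1) - √n)
        ≤ psi ((stateOf lam δ bs).histNext lam δ y) (stateOf lam δ bs).left
          (stateOf lam δ bs).ctr (stateOf lam δ bs).right ∧
      (n = 0 ∨ ∃ γ : ℝ, (stateOf lam δ bs).armRad lam δ ((stateOf lam δ bs).arm lam δ) = (γ : EReal) ∧
        0 ≤ γ ∧ γ ≤ (√(Real.log (2 / δ)) + 4) / √((n : ℝ) + 1)) := by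
  have hg := h.geo.pos
  have e1 := h.geo.left
  have e2 : (stateOf lam δ bs).ctr = ((i + 1 : ℕ) : ℝ) * g := by
    rw [h.geo.ctr]; push_cast; ring
  have e3 : (stateOf lam δ bs).right = ((i + 2 : ℕ) : ℝ) * g := by
    rw [h.geo.right]; push_cast; ring
  have e4 : (stateOf lam δ bs).right = (((i + 1 : ℕ) : ℝ) + 1) * g := by
    rw [h.geo.right]; push_cast; ring
  have hpol := h.polOf_mem_unit
  have hnext : (stateOf lam δ bs).histNext lam δ y
      = (stateOf lam δ bs).hist ++ [(polOf lam δ bs, y)] := rfl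
  rw [hnext]
  set hist := (stateOf lam δ bs).hist
  have m1 := sqrt_numAt_le_append hist (polOf lam δ bs, y)
  have m2 := sqrt_rawNum_le_append hist (polOf lam δ bs, y)
  rcases h.sample with ⟨q, hq, hp, -, -, hrad⟩ | ⟨j₀, hj, -, hpart, hp, -, -, hrad⟩
  · refine ⟨numAt hist (q * g), ?_, ?_⟩
    · have hinc : √(numAt (hist ++ [(polOf lam δ bs, y)]) (q * g) : ℝ)
          = √((numAt hist (q * g) : ℝ) + 1) := by
        rw [numAt_append, if_pos hp]; push_cast; rfl
      unfold psi
      rcases hq with rfl | rfl | rfl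
      · rw [← e1] at hinc ⊢
        linarith [m1 (stateOf lam δ bs).ctr, m1 (stateOf lam δ bs).right,
          m2 (stateOf lam δ bs).left (stateOf lam δ bs).ctr,
          m2 (stateOf lam δ bs).ctr (stateOf lam δ bs).right]
      · rw [← e2] at hinc ⊢
        linarith [m1 (stateOf lam δ bs).left, m1 (stateOf lam δ bs).right,
          m2 (stateOf lam δ bs).left (stateOf lam δ bs).ctr,
          m2 (stateOf lam δ bs).ctr (stateOf lam δ bs).right]
      · rw [← e3] at hinc ⊢
        linarith [m1 (stateOf lam δ bs).ctr, m1 (stateOf lam δ bs).left,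
          m2 (stateOf lam δ bs).left (stateOf lam δ bs).ctr,
          m2 (stateOf lam δ bs).ctr (stateOf lam δ bs).right]
    · rcases eq_or_ne (numAt hist (q * g)) 0 with hn | hn
      · exact Or.inl hn
      · right
        rw [hrad, radAt_of_ne hn]
        rw [hp] at hpol
        exact ⟨_, rfl, realRadAt_le rfl hL0 hpol.1 hpol.2 hn⟩
  · have hc := h.cell j₀
    rw [hpart, if_pos rfl] at hc
    have hx := sweepPt_mem (a := j₀ * g) (b := (j₀ + 1) * g) (by nlinarith) hc.lt
    rw [← hp] at hx
    refine ⟨rawNum hist (j₀ * g) ((j₀ + 1) * g), ?_, Or.inr ?_⟩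
    · have hinc : √(rawNum (hist ++ [(polOf lam δ bs, y)]) (j₀ * g) ((j₀ + 1) * g) : ℝ)
          = √((rawNum hist (j₀ * g) ((j₀ + 1) * g) : ℝ) + 1) := by
        rw [rawNum_append, if_pos hx]; push_cast; rfl
      unfold psi
      rcases hj with rfl | rfl
      · rw [← e1, ← h.geo.ctr] at hinc ⊢
        linarith [m1 (stateOf lam δ bs).ctr, m1 (stateOf lam δ bs).right,
          m1 (stateOf lam δ bs).left,
          m2 (stateOf lam δ bs).ctr (stateOf lam δ bs).right]
      · rw [← e4, ← e2] at hinc ⊢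
        linarith [m1 (stateOf lam δ bs).ctr, m1 (stateOf lam δ bs).right,
          m1 (stateOf lam δ bs).left,
          m2 (stateOf lam δ bs).left (stateOf lam δ bs).ctr]
    · rw [hrad, radIn_eq]
      have hg1 : g ≤ 1 := by
        have := h.geo.right_le_one
        rw [h.geo.right] at this
        have hi : (0 : ℝ) ≤ i := i.cast_nonneg
        nlinarith
      refine ⟨_, rfl, realRadIn_le rfl hL0 h0 h1 (by nlinarith) (by nlinarith) ?_⟩
      have a1 : rawNum hist (j₀ * g) ((j₀ + 1) * g) + 1 = 2 ^ m j₀ + (stateOf lam δ bs).k := hc.raw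
      have a2 : numIn hist (j₀ * g) ((j₀ + 1) * g) + 1 = 2 ^ m j₀ := hc.num
      have a3 := hc.lt
      simp only [hist] at a1 a2 a3 ⊢
      omega

end Run

/-! ### Counting the epochs -/

/-- Bound on the loss of any period of an epoch, when `q` is the distance from the best policy
to `1`. -/
def epochLoss (q : ℝ) (τ : ℕ) : ℝ :=
  epochLen τ + if epochLen τ ≤ 4 * q then epochLen τ / q else 0

theorem epochLen_pos (τ : ℕ) : 0 < epochLen τ := by
  induction τ with
  | zero => norm_num [epochLen]
  | succ n ih => rw [epochLen]; split_ifs <;> positivity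

theorem epochLen_add_le (τ k : ℕ) : epochLen (τ + k) ≤ (3 / 4) ^ k * epochLen τ := by
  induction k with
  | zero => simp
  | succ k ih =>
    have hp := epochLen_pos (τ + k)
    rw [← add_assoc, epochLen, pow_succ]
    split_ifs <;> nlinarith

theorem epochLen_le (τ : ℕ) : epochLen τ ≤ 3 / 2 := by
  have := epochLen_add_le 0 τ
  have h1 : ((3 : ℝ) / 4) ^ τ ≤ 1 := pow_le_one₀ (by norm_num) (by norm_num)
  rw [zero_add] at this
  simp only [epochLen] at this
  linarith

/-- Lengths shrink by at least 3/4 per epoch. If k epochs separate the first and the last one in the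
window, then (3/4)^k > ε/β, and log(3/4) ≤ -1/4 gives k < 4 log(β/ε). -/
theorem card_epochLen_le (n : ℕ) {ε β : ℝ} (hε : 0 < ε) (hβ : ε ≤ β) :
    (((Finset.range n).filter fun τ => ε < epochLen τ ∧ epochLen τ ≤ β).card : ℝ)
      ≤ 1 + 4 * Real.log (β / ε) := by
  set s := (Finset.range n).filter fun τ => ε < epochLen τ ∧ epochLen τ ≤ β with hs
  have hlog : 0 ≤ Real.log (β / ε) := Real.log_nonneg ((one_le_div hε).2 hβ)
  rcases s.eq_empty_or_nonempty with he | hne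
  · rw [he]; simp; linarith
  · have hmin := s.min'_mem hne
    have hmax := s.max'_mem hne
    set a := s.min' hne
    set b := s.max' hne
    have hab : a ≤ b := s.min'_le_max' hne
    have hsub : s ⊆ Finset.Icc a b := fun x hx =>
      Finset.mem_Icc.2 ⟨s.min'_le x hx, s.le_max' x hx⟩
    have hcard := Finset.card_le_card hsub
    rw [Nat.card_Icc] at hcard
    obtain ⟨k, hk⟩ : ∃ k, b = a + k := ⟨b - a, by omega⟩
    have h1 := (Finset.mem_filter.1 hmin).2.2
    have h2 := (Finset.mem_filter.1 hmax).2.1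
    rw [hk] at h2
    have h3 : ε < (3 / 4) ^ k * β :=
      (h2.trans_le (epochLen_add_le a k)).trans_le
        (mul_le_mul_of_nonneg_left h1 (by positivity))
    have hβ0 : 0 < β := by linarith
    have h4 := Real.log_lt_log hε h3
    rw [Real.log_mul (by positivity) hβ0.ne', Real.log_pow] at h4
    have h5 : Real.log (3 / 4) ≤ -(1 / 4) := by
      have := Real.log_le_sub_one_of_pos (show (0 : ℝ) < 3 / 4 by norm_num)
      linarith
    have h6 : (k : ℝ) * Real.log (3 / 4) ≤ k * -(1 / 4) :=
      mul_le_mul_of_nonneg_left h5 k.cast_nonneg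
    rw [Real.log_div hβ0.ne' hε.ne']
    have h7 : (s.card : ℝ) ≤ k + 1 := by exact_mod_cast (by omega : s.card ≤ k + 1)
    linarith

open Classical in
-- One of the two summands of the loss exceeds 1/(2T), so the length lies in one of two windows,
-- with endpoint ratios 3T and 8T. The cutoff at 4q makes the second ratio free of q, and removes
-- that window when q = 0.
theorem card_epochLoss_le (n : ℕ) {q T : ℝ} (hq : 0 ≤ q) (hT : 1 ≤ T) :
    (((Finset.range n).filter fun τ => 1 / T < epochLoss q τ).card : ℝ)
      ≤ 16 * (1 + Real.log T) := by
  have hT0 : 0 < T := by linarith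
  have hlogT : 0 ≤ Real.log T := Real.log_nonneg hT
  have c1 := card_epochLen_le n (ε := 1 / (2 * T)) (β := 3 / 2) (by positivity)
    (by rw [div_le_iff₀ (by positivity)]; linarith)
  have e1 : (3 / 2 : ℝ) / (1 / (2 * T)) = 3 * T := by field_simp
  rw [e1, Real.log_mul (by norm_num) hT0.ne'] at c1
  -- The total is 2 + 4 log 24 + 8 log T, with log 24 ≤ 5 log 2 ≤ 7/2.
  have hl3 : Real.log 3 + Real.log 8 ≤ 7 / 2 := by
    rw [← Real.log_mul (by norm_num) (by norm_num)]
    have h1 : Real.log (3 * 8) ≤ Real.log (2 ^ 5) := Real.log_le_log (by norm_num) (by norm_num)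
    rw [Real.log_pow] at h1
    have h2 : Real.log 2 ≤ 7 / 10 := Real.log_two_lt_d9.le.trans (by norm_num)
    refine h1.trans ?_
    push_cast
    linarith
  have hl8 : 0 ≤ Real.log 8 := Real.log_nonneg (by norm_num)
  rcases eq_or_lt_of_le hq with hq0 | hq0
  · have hsub : ((Finset.range n).filter fun τ => 1 / T < epochLoss q τ) ⊆
        (Finset.range n).filter fun τ => 1 / (2 * T) < epochLen τ ∧ epochLen τ ≤ 3 / 2 := by
      intro τ hτ
      rw [Finset.mem_filter] at hτ ⊢
      refine ⟨hτ.1, ?_, epochLen_le τ⟩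
      have h1 := hτ.2
      rw [epochLoss, ← hq0, if_neg (by have := epochLen_pos τ; linarith)] at h1
      have : 1 / (2 * T) ≤ 1 / T := one_div_le_one_div_of_le hT0 (by linarith)
      linarith
    have : (((Finset.range n).filter fun τ => 1 / T < epochLoss q τ).card : ℝ) ≤ _ :=
      Nat.cast_le.2 (Finset.card_le_card hsub)
    linarith
  · have c2 := card_epochLen_le n (ε := q / (2 * T)) (β := 4 * q) (by positivity)
      (by rw [div_le_iff₀ (by positivity)]; nlinarith)
    have e2 : 4 * q / (q / (2 * T)) = 8 * T := by field_simp; ring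
    rw [e2, Real.log_mul (by norm_num) hT0.ne'] at c2
    have hsub : ((Finset.range n).filter fun τ => 1 / T < epochLoss q τ) ⊆
        ((Finset.range n).filter fun τ => 1 / (2 * T) < epochLen τ ∧ epochLen τ ≤ 3 / 2) ∪
        (Finset.range n).filter fun τ => q / (2 * T) < epochLen τ ∧ epochLen τ ≤ 4 * q := by
      intro τ hτ
      rw [Finset.mem_union, Finset.mem_filter, Finset.mem_filter]
      rw [Finset.mem_filter, epochLoss] at hτ
      by_cases hlt : 1 / (2 * T) < epochLen τ
      · exact Or.inl ⟨hτ.1, hlt, epochLen_le τ⟩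
      · right
        have h1 := hτ.2
        have e3 : 1 / T = 1 / (2 * T) + 1 / (2 * T) := by field_simp; norm_num
        have hp : 0 < 1 / (2 * T) := by positivity
        split_ifs at h1 with hle
        · refine ⟨hτ.1, ?_, hle⟩
          have h2 : 1 / (2 * T) < epochLen τ / q := by linarith
          rw [lt_div_iff₀ hq0] at h2
          calc q / (2 * T) = 1 / (2 * T) * q := by ring
            _ < _ := h2
        · linarith
    have h3 : (((Finset.range n).filter fun τ => 1 / T < epochLoss q τ).card : ℝ) ≤ _ :=
      Nat.cast_le.2 ((Finset.card_le_card hsub).trans (Finset.card_union_le _ _))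
    push_cast at h3
    linarith

/-! ### Regret on good runs -/

section Regret

variable {lam δ : ℝ} {μ : Measure ℝ} [IsProbabilityMeasure μ]

/-- To the left of x' the one-sided Lipschitz bound applies. To the right, compare with the chord
from x' to 1, where W stays in [0, 1]. A policy above x' also leaves room between x' and 1: `right`
is at least a quarter of the active interval away from `hi`, whence the factor 4. -/
theorem Inv.loss_le_epochLoss {bs : List Bool} {g : ℝ} {i : ℕ} {m : ℕ → ℕ}
    (h : Inv lam δ (demand μ) bs g i m) (hμ : μ (Set.Icc (0 : ℝ) 1) = 1)
    (hW : ConcaveOn ℝ (Set.Icc 0 1) (expWelfare lam μ)) (h0 : 0 ≤ lam) (h1 : lam ≤ 1) {x' : ℝ}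
    (hx1 : (stateOf lam δ bs).lo ≤ x') (hx2 : x' ≤ (stateOf lam δ bs).hi) :
    expWelfare lam μ x' - expWelfare lam μ (polOf lam δ bs)
      ≤ epochLoss (1 - x') (stateOf lam δ bs).epoch := by
  have hg := h.geo.pos
  have hlo0 := h.geo.lo_nonneg
  have hhi1 := h.geo.hi_le
  have hlo := h.geo.lo_le
  have hhi := h.geo.le_hi
  have hpol := h.polOf_mem
  have hpol1 := h.polOf_mem_unit
  have hd := h.geo.len
  have hdp := epochLen_pos (stateOf lam δ bs).epoch
  have hx01 : x' ∈ Set.Icc (0 : ℝ) 1 := ⟨by linarith, by linarith⟩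
  unfold epochLoss
  rcases le_or_gt (polOf lam δ bs) x' with hle | hlt
  · have h2 := expWelfare_sub_le h0 μ hpol1.1 hle
    have h3 : 0 ≤ if epochLen (stateOf lam δ bs).epoch ≤ 4 * (1 - x') then
        epochLen (stateOf lam δ bs).epoch / (1 - x') else 0 := by
      split_ifs
      · exact div_nonneg hdp.le (by linarith)
      · exact le_rfl
    linarith
  · have hq : 0 < 1 - x' := by linarith [hpol1.2]
    have hd4 : epochLen (stateOf lam δ bs).epoch ≤ 4 * (1 - x') := by
      rw [← hd]
      have hr := h.geo.right
      rcases h.geo.shape with ⟨-, -, s1, s2⟩ | ⟨-, -, -, s1, s2⟩ <;> nlinarith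
    rw [if_pos hd4]
    have h2 := concave_three_points hW hx01 (z := 1) ⟨zero_le_one, le_rfl⟩ hlt.le hpol1.2
    have w1 := expWelfare_mem hμ h0 h1 (x := 1) ⟨zero_le_one, le_rfl⟩
    have w2 := expWelfare_mem hμ h0 h1 hx01
    have h3 : expWelfare lam μ x' - expWelfare lam μ (polOf lam δ bs)
        ≤ epochLen (stateOf lam δ bs).epoch / (1 - x') := by
      rw [le_div_iff₀ hq]
      have a1 : 0 ≤ (polOf lam δ bs - x') * expWelfare lam μ 1 :=
        mul_nonneg (by linarith) w1.1
      have a2 : (polOf lam δ bs - x') * expWelfare lam μ x' ≤ polOf lam δ bs - x' :=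
        mul_le_of_le_one_right (by linarith) w2.2
      nlinarith
    linarith

theorem interval_subset_of_suffix (h0 : 0 < lam) (h1 : lam < 1)
    (hL : 49 / 2 ≤ Real.log (2 / δ)) {bs cs : List Bool} (hs : bs <:+ cs) :
    (stateOf lam δ bs).lo ≤ (stateOf lam δ cs).lo ∧
      (stateOf lam δ cs).hi ≤ (stateOf lam δ bs).hi := by
  obtain ⟨ds, rfl⟩ := hs
  induction ds with
  | nil => exact ⟨le_rfl, le_rfl⟩
  | cons d ds ih =>
    -- Only the geometry is used, so any antitone function with values in [0, 1] may stand for the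
    -- demand.
    obtain ⟨g, i, m, h⟩ := exists_inv (G := fun _ => 0) h0 h1 hL (fun _ _ _ => le_rfl)
      (fun _ => le_rfl) (fun _ => zero_le_one) (ds ++ bs)
    have := h.interval_subset (b := d)
    exact ⟨ih.1.trans this.1, this.2.trans ih.2⟩

open Classical in
/-- Total budget of the epochs before epoch `n` whose loss is not negligible. -/
def bigBudget (q T K : ℝ) (n : ℕ) : ℝ :=
  ∑ τ ∈ Finset.range n, if 1 / T < epochLoss q τ then K else 0

open Classical in
theorem bigBudget_le {q T K : ℝ} (hq : 0 ≤ q) (hT : 1 ≤ T) (hK : 0 ≤ K) (n : ℕ) :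
    bigBudget q T K n ≤ 16 * (1 + Real.log T) * K := by
  have h1 := card_epochLoss_le n hq hT
  unfold bigBudget
  rw [← Finset.sum_filter, Finset.sum_const, nsmul_eq_mul]
  exact mul_le_mul_of_nonneg_right h1 hK

open Classical in
/-- The cumulative loss on a good run, epoch by epoch. -/
theorem lossSum_le_bigBudget (hμ : μ (Set.Icc (0 : ℝ) 1) = 1)
    (hW : ConcaveOn ℝ (Set.Icc 0 1) (expWelfare lam μ)) (h0 : 0 < lam) (h1 : lam < 1)
    (hL : 49 / 2 ≤ Real.log (2 / δ)) {T : ℕ} (hT : 1 ≤ T) {x' w : ℝ}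
    (hw : w ≤ expWelfare lam μ x') {bs : List Bool} (hlen : bs.length ≤ T)
    (hgood : GoodRun lam δ (demand μ) bs)
    (hx1 : (stateOf lam δ bs).lo ≤ x') (hx2 : x' ≤ (stateOf lam δ bs).hi) {A K : ℝ}
    (hA : A = 32 * (√(Real.log (2 / δ)) + 4)) (hK : K = A * (5 * √T) + 2) :
    lossSum (expWelfare lam μ) w (polOf lam δ) bs
        ≤ bigBudget (1 - x') T K (stateOf lam δ bs).epoch
          + (if 1 / (T : ℝ) < epochLoss (1 - x') (stateOf lam δ bs).epoch then
              A * psi (stateOf lam δ bs).hist (stateOf lam δ bs).left (stateOf lam δ bs).ctr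
                (stateOf lam δ bs).right + 1 else 0) + bs.length / T ∧
      -- The case where the present history would pass a test of a new triple: the 16γ bound is then
      -- unavailable for the next period, but the extra 1 of the current epoch is still unspent.
      (¬ (¬ (stateOf lam δ bs).dropLeft lam δ (stateOf lam δ bs).hist ∧
          ¬ (stateOf lam δ bs).dropRight lam δ (stateOf lam δ bs).hist) →
        lossSum (expWelfare lam μ) w (polOf lam δ) bs
          ≤ bigBudget (1 - x') T K (stateOf lam δ bs).epoch + bs.length / T) := by
  have hT0 : (0 : ℝ) < T := by exact_mod_cast hT
  have hA0 : 0 ≤ A := by rw [hA]; positivity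
  have hA1 : 1 ≤ A := by rw [hA]; linarith [Real.sqrt_nonneg (Real.log (2 / δ))]
  have hK0 : 0 ≤ K := by rw [hK]; positivity
  have hB0 : ∀ n, 0 ≤ bigBudget (1 - x') T K n := fun n =>
    Finset.sum_nonneg fun τ _ => by split_ifs <;> simp [hK0]
  induction bs with
  | nil =>
    have hb := hB0 (stateOf lam δ []).epoch
    have hpsi := psi_nonneg (stateOf lam δ []).hist (stateOf lam δ []).left (stateOf lam δ []).ctr
      (stateOf lam δ []).right
    simp only [lossSum, List.length_nil, Nat.cast_zero, zero_div, add_zero]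
    refine ⟨?_, fun _ => hb⟩
    split_ifs
    · have := mul_nonneg hA0 hpsi
      linarith
    · linarith
  | cons b bs ih =>
    have hsuf : bs <:+ b :: bs := List.suffix_cons _ _
    have hsub := interval_subset_of_suffix h0 h1 hL hsuf (δ := δ)
    have hy1 : (stateOf lam δ bs).lo ≤ x' := hsub.1.trans hx1
    have hy2 : x' ≤ (stateOf lam δ bs).hi := hx2.trans hsub.2
    have hlen' : bs.length + 1 ≤ T := by simpa using hlen
    have hgood' := hgood.of_suffix hsuf
    obtain ⟨ih1, ih2⟩ := ih (by omega) hgood' hy1 hy2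
    obtain ⟨g, i, m, h⟩ := exists_inv h0 h1 hL (demand_antitone μ) (demand_nonneg μ)
      (demand_le_one μ) bs
    have hx01 : x' ∈ Set.Icc (0 : ℝ) 1 :=
      ⟨h.geo.lo_nonneg.trans hy1, hy2.trans h.geo.hi_le⟩
    have l1 : w - expWelfare lam μ (polOf lam δ bs) ≤ 1 := by
      have a1 := expWelfare_mem hμ h0.le h1.le hx01
      have a2 := expWelfare_mem hμ h0.le h1.le h.polOf_mem_unit
      linarith [a1.2, a2.1]
    have l2 : w - expWelfare lam μ (polOf lam δ bs)
        ≤ epochLoss (1 - x') (stateOf lam δ bs).epoch := by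
      have := h.loss_le_epochLoss hμ hW h0.le h1.le hy1 hy2
      linarith
    have hpsi0 := psi_nonneg (stateOf lam δ bs).hist (stateOf lam δ bs).left
      (stateOf lam δ bs).ctr (stateOf lam δ bs).right
    have hlenc : (((b :: bs).length : ℕ) : ℝ) / T = bs.length / T + 1 / T := by
      rw [List.length_cons]; push_cast; ring
    have hinvT : 0 < 1 / (T : ℝ) := by positivity
    -- Closing an epoch: its potential is at most 5√T. The 2 in K pays for the unit already granted
    -- to the epoch and covers the additive constants.
    have hnew : ∀ S' : State, stateOf lam δ (b :: bs) = S' →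
        S'.epoch = (stateOf lam δ bs).epoch + 1 →
        lossSum (expWelfare lam μ) w (polOf lam δ) (b :: bs)
          ≤ bigBudget (1 - x') T K (stateOf lam δ (b :: bs)).epoch + (b :: bs).length / T := by
      intro S' hS he
      rw [hS, he, hlenc]
      simp only [lossSum]
      unfold bigBudget at ih1 ⊢
      rw [Finset.sum_range_succ]
      split_ifs at ih1 ⊢ with hbig
      · have hpsi := psi_le (stateOf lam δ bs).hist (stateOf lam δ bs).left
          (stateOf lam δ bs).ctr (stateOf lam δ bs).right
        rw [hist_length] at hpsi
        have hst : √(bs.length : ℝ) ≤ √(T : ℝ) :=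
          Real.sqrt_le_sqrt (by exact_mod_cast (by omega : bs.length ≤ T))
        have : A * psi (stateOf lam δ bs).hist (stateOf lam δ bs).left
          (stateOf lam δ bs).ctr (stateOf lam δ bs).right ≤ A * (5 * √T) :=
          mul_le_mul_of_nonneg_left (by linarith) hA0
        linarith
      · linarith
    have hS : stateOf lam δ (b :: bs) = (stateOf lam δ bs).stepBit lam δ (bitVal b) := rfl
    have hpsi' := psi_nonneg (stateOf lam δ (b :: bs)).hist (stateOf lam δ (b :: bs)).left
      (stateOf lam δ (b :: bs)).ctr (stateOf lam δ (b :: bs)).right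
    rcases (stateOf lam δ bs).stepBit_cases lam δ (bitVal b) with ⟨-, h'⟩ | ⟨-, h'⟩ | ⟨hd, h'⟩
    · have hn := hnew _ (hS.trans h') rfl
      refine ⟨?_, fun _ => hn⟩
      split_ifs
      · have := mul_nonneg hA0 hpsi'
        linarith
      · linarith
    · have hn := hnew _ (hS.trans h') rfl
      refine ⟨?_, fun _ => hn⟩
      split_ifs
      · have := mul_nonneg hA0 hpsi'
        linarith
      · linarith
    · have hS' := hS.trans h'
      refine ⟨?_, fun hn => absurd (by rw [hS']; exact hd) hn⟩
      have hpe : psi (stateOf lam δ (b :: bs)).hist (stateOf lam δ (b :: bs)).left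
          (stateOf lam δ (b :: bs)).ctr (stateOf lam δ (b :: bs)).right
          = psi ((stateOf lam δ bs).histNext lam δ (bitVal b)) (stateOf lam δ bs).left
            (stateOf lam δ bs).ctr (stateOf lam δ bs).right := by rw [hS']; rfl
      have hee : (stateOf lam δ (b :: bs)).epoch = (stateOf lam δ bs).epoch := by rw [hS']
      rw [hpe] at hpsi' ⊢
      rw [hee, hlenc]
      simp only [lossSum]
      split_ifs at ih1 ⊢ with hbig
      · by_cases htest : ¬ (stateOf lam δ bs).dropLeft lam δ (stateOf lam δ bs).hist ∧
            ¬ (stateOf lam δ bs).dropRight lam δ (stateOf lam δ bs).hist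
        · obtain ⟨n, hn1, hn2⟩ := h.radius h0.le h1.le (by linarith) (bitVal b)
          have hstep : w - expWelfare lam μ (polOf lam δ bs) ≤ A * (√((n : ℝ) + 1) - √n) := by
            -- At a point never chosen the radius is infinite, but the potential grows by 1 and A ≥
            -- 1 covers the whole loss. Otherwise 16γ and the factor 2 of the telescoping give the
            -- 32 in A.
            rcases hn2 with rfl | ⟨γ, hγ, hγ0, hγ1⟩
            · simp only [Nat.cast_zero, zero_add, Real.sqrt_one, Real.sqrt_zero, sub_zero, mul_one]
              linarith
            · have h2 := h.loss_le hW h0.le hgood' htest.1 htest.2 hγ0 hγ hy1 hy2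
              have h3 := one_div_sqrt_succ_le n
              have h4 : (√(Real.log (2 / δ)) + 4) / √((n : ℝ) + 1)
                  ≤ (√(Real.log (2 / δ)) + 4) * (2 * (√((n : ℝ) + 1) - √n)) := by
                rw [div_eq_mul_one_div]
                exact mul_le_mul_of_nonneg_left h3 (by positivity)
              rw [hA]
              linarith
          have h5 := mul_le_mul_of_nonneg_left hn1 hA0
          rw [mul_add] at h5
          linarith
        -- No test was available beforehand, so this period is charged to the extra 1.
        · have := ih2 htest
          have h6 := mul_nonneg hA0 hpsi'
          linarith
      · linarith

theorem lossSum_le_of_goodRun (hμ : μ (Set.Icc (0 : ℝ) 1) = 1)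
    (hW : ConcaveOn ℝ (Set.Icc 0 1) (expWelfare lam μ)) (h0 : 0 < lam) (h1 : lam < 1)
    (hL : 49 / 2 ≤ Real.log (2 / δ)) {T : ℕ} (hT : 1 ≤ T) {x : ℝ} (hx : x ∈ Set.Icc (0 : ℝ) 1)
    {bs : List Bool} (hlen : bs.length = T) (hgood : GoodRun lam δ (demand μ) bs) :
    lossSum (expWelfare lam μ) (expWelfare lam μ x) (polOf lam δ) bs
      ≤ (16 * (1 + Real.log T) + 1) * (32 * (√(Real.log (2 / δ)) + 4) * (5 * √T) + 2) + 1 := by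
  obtain ⟨x', hx1, hx2, hw⟩ := exists_mem_interval_ge hW h0 h1 hL hx bs hgood
  obtain ⟨g, i, m, h⟩ := exists_inv h0 h1 hL (demand_antitone μ) (demand_nonneg μ)
    (demand_le_one μ) bs
  have hmain := (lossSum_le_bigBudget hμ hW h0 h1 hL hT hw hlen.le hgood hx1 hx2 rfl rfl).1
  have hT0 : (0 : ℝ) < T := by exact_mod_cast hT
  have hq : 0 ≤ 1 - x' := by linarith [h.geo.hi_le]
  have hB := bigBudget_le (K := 32 * (√(Real.log (2 / δ)) + 4) * (5 * √T) + 2) hq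
    (show (1 : ℝ) ≤ T by exact_mod_cast hT) (by positivity) (stateOf lam δ bs).epoch
  have hpsi := psi_le (stateOf lam δ bs).hist (stateOf lam δ bs).left
    (stateOf lam δ bs).ctr (stateOf lam δ bs).right
  rw [hist_length, hlen] at hpsi
  have h3 : 32 * (√(Real.log (2 / δ)) + 4) * psi (stateOf lam δ bs).hist (stateOf lam δ bs).left
      (stateOf lam δ bs).ctr (stateOf lam δ bs).right
      ≤ 32 * (√(Real.log (2 / δ)) + 4) * (5 * √T) :=
    mul_le_mul_of_nonneg_left hpsi (by positivity)
  rw [hlen, div_self hT0.ne'] at hmain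
  have hpos : 0 ≤ 32 * (√(Real.log (2 / δ)) + 4) * (5 * √T) := by positivity
  split_ifs at hmain <;> linarith

/-- Most runs are good. -/
theorem measure_not_goodRun_le {Ω : Type*} [MeasurableSpace Ω] {P : Measure Ω}
    [IsProbabilityMeasure P] {v : ℕ → Ω → ℝ} (hv : ∀ i, Measurable (v i)) (hi : iIndepFun v P)
    (hμ : ∀ i, P.map (v i) = μ) (hL : 0 ≤ Real.log (2 / δ)) (T : ℕ) :
    P {ω | ¬ GoodRun lam δ (demand μ) (bits (polOf lam δ) (fun i => v i ω) T)}
      ≤ ENNReal.ofReal (2 * (T * (T * (2 * Real.exp (-Real.log (2 / δ)))))) := by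
  calc _ ≤ P (⋃ κ ∈ (Finset.univ : Finset Bool), ⋃ s ∈ Finset.range T,
        {ω | ∃ bs, bs <:+ bits (polOf lam δ) (fun i => v i ω) T ∧
          ¬ SelGood (polOf lam δ) (demand μ) (Real.log (2 / δ)) (streamSel lam δ κ s) bs}) := by
        refine measure_mono fun ω hω => ?_
        simp only [Set.mem_ofPred_eq, GoodRun] at hω
        push Not at hω
        obtain ⟨κ, s, hs, cs, hcs, hbad⟩ := hω
        rw [bits_length] at hs
        simp only [Set.mem_iUnion, Finset.mem_univ, Finset.mem_range, exists_prop, true_and]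
        exact ⟨κ, s, hs, cs, hcs, hbad⟩
    _ ≤ ∑ κ : Bool, ∑ s ∈ Finset.range T,
        ENNReal.ofReal (T * (2 * Real.exp (-Real.log (2 / δ)))) := by
        refine (measure_biUnion_finset_le _ _).trans (Finset.sum_le_sum fun κ _ => ?_)
        refine (measure_biUnion_finset_le _ _).trans (Finset.sum_le_sum fun s _ => ?_)
        exact measure_not_selGood_le (polOf lam δ) hv hi hμ _ hL T
    _ = _ := by
        rw [Finset.sum_const, Finset.sum_const, Finset.card_range, Finset.card_univ,
          Fintype.card_bool, nsmul_eq_mul, nsmul_eq_mul, ENNReal.ofReal_mul (p := 2) (by norm_num),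
          ENNReal.ofReal_mul (p := (T : ℝ)) (q := T * _) (by positivity), ENNReal.ofReal_natCast,
          ENNReal.ofReal_ofNat, Nat.cast_ofNat]

end Regret

end DyadicSearch

end

/-! ### Choice of the confidence level, short horizons, and numerical constants. -/

noncomputable section

namespace DyadicSearch

open MeasureTheory ProbabilityTheory
open scoped ENNReal

/-! ### The regret bound -/

theorem State.policy_nonneg (lam δ : ℝ) {S : State} (h0 : 0 ≤ S.lo) (h1 : S.lo ≤ S.hi) :
    0 ≤ S.policy lam δ := by
  have hg : 0 ≤ S.gap ∧ S.gap ≤ (S.hi - S.lo) / 4 := by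
    unfold State.gap
    split_ifs <;> constructor <;> linarith
  have hl : 0 ≤ S.left := by unfold State.left State.ctr; linarith
  have hlc : S.left ≤ S.ctr := by unfold State.left; linarith
  have hcr : S.ctr ≤ S.right := by unfold State.right; linarith
  have hsweep : ∀ a b, 0 ≤ a → a ≤ b → 0 ≤ S.sweep a b := fun a b ha hab =>
    add_nonneg ha (mul_nonneg (by linarith) (by positivity))
  unfold State.policy
  cases S.arm lam δ
  · exact hl
  · exact hl.trans hlc
  · exact hl.trans (hlc.trans hcr)
  · exact hsweep _ _ hl hlc
  · exact hsweep _ _ (hl.trans hlc) hcr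

theorem stateOf_interval (lam δ : ℝ) (bs : List Bool) :
    0 ≤ (stateOf lam δ bs).lo ∧ (stateOf lam δ bs).lo ≤ (stateOf lam δ bs).hi := by
  induction bs with
  | nil => simp [stateOf, State.init]
  | cons b bs ih =>
    have hg : 0 ≤ (stateOf lam δ bs).gap ∧
        (stateOf lam δ bs).gap ≤ ((stateOf lam δ bs).hi - (stateOf lam δ bs).lo) / 4 := by
      unfold State.gap
      split_ifs <;> constructor <;> linarith
    have hS : stateOf lam δ (b :: bs) = (stateOf lam δ bs).stepBit lam δ (bitVal b) := rfl
    rw [hS]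
    rcases (stateOf lam δ bs).stepBit_cases lam δ (bitVal b) with ⟨-, h'⟩ | ⟨-, h'⟩ | ⟨-, h'⟩ <;>
      rw [h'] <;> simp only [State.left, State.right, State.ctr] <;> constructor <;> linarith

theorem polOf_nonneg (lam δ : ℝ) (bs : List Bool) : 0 ≤ polOf lam δ bs :=
  State.policy_nonneg lam δ (stateOf_interval lam δ bs).1 (stateOf_interval lam δ bs).2

theorem log_two_div_confidence {T : ℝ} (hT : 0 < T) :
    Real.log (2 / T ^ (-(5 / 2) : ℝ)) = Real.log 2 + 5 / 2 * Real.log T := by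
  rw [Real.log_div two_ne_zero (Real.rpow_pos_of_pos hT _).ne', Real.log_rpow hT]
  ring

/-- Since e^{-L} = δ/2, the left side is 2T³δ; the exponent 5/2 is what makes this 2√T. -/
theorem failure_probability_mul_horizon {T : ℝ} (hT : 0 < T) :
    T * (2 * (T * (T * (2 * Real.exp (-Real.log (2 / T ^ (-(5 / 2) : ℝ))))))) = 2 * √T := by
  have hδ := Real.rpow_pos_of_pos hT (-(5 / 2) : ℝ)
  rw [← Real.log_inv, Real.exp_log (by positivity), inv_div, Real.sqrt_eq_rpow]
  have h3 : T ^ (3 : ℝ) = T * (T * T) := by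
    rw [show (3 : ℝ) = (3 : ℕ) by norm_num, Real.rpow_natCast]; ring
  have : T ^ (1 / 2 : ℝ) = T ^ (3 : ℝ) * T ^ (-(5 / 2) : ℝ) := by
    rw [← Real.rpow_add hT]; norm_num
  rw [this, h3]
  ring

theorem horizon_le_of_log_lt {T : ℝ} (hT : 1 ≤ T) (hlog : Real.log T < 10) :
    T ≤ 20000 * √T * (1 + Real.log T) ^ 2 := by
  have hT0 : 0 < T := by linarith
  have h1 : T ≤ 2.7182818286 ^ 10 := by
    rw [← Real.exp_log hT0]
    calc Real.exp (Real.log T) ≤ Real.exp 10 := Real.exp_le_exp.2 hlog.le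
      _ = Real.exp 1 ^ 10 := by rw [← Real.exp_nat_mul]; norm_num
      _ ≤ _ := pow_le_pow_left₀ (Real.exp_pos 1).le Real.exp_one_lt_d9.le 10
  have h2 : √T ≤ 20000 := by
    rw [Real.sqrt_le_left (by norm_num)]
    exact h1.trans (by norm_num)
  have h3 : (1 : ℝ) ≤ (1 + Real.log T) ^ 2 := one_le_pow₀ (by linarith [Real.log_nonneg hT])
  calc T = √T * √T := (Real.mul_self_sqrt hT0.le).symm
    _ ≤ 20000 * √T * 1 := by rw [mul_one]; exact mul_le_mul_of_nonneg_right h2 (Real.sqrt_nonneg _)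
    _ ≤ _ := mul_le_mul_of_nonneg_left h3 (by positivity)

/-- With y = 1 + log T one has √L ≤ 3y, so √L + 4 ≤ 7y and 32 · 5 · 7 + 2 = 1122. Then 17 · 1122 + 3
< 20000. -/
theorem total_budget_le {T L : ℝ} (hT : 1 ≤ T) (hL : L = Real.log 2 + 5 / 2 * Real.log T) :
    (16 * (1 + Real.log T) + 1) * (32 * (√L + 4) * (5 * √T) + 2) + 1 + 2 * √T
      ≤ 20000 * √T * (1 + Real.log T) ^ 2 := by
  have hlog := Real.log_nonneg hT
  set y := 1 + Real.log T with hy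
  have hy1 : 1 ≤ y := by linarith
  have hs : 1 ≤ √T := Real.one_le_sqrt.2 hT
  have hl2 : Real.log 2 ≤ 1 := Real.log_two_lt_d9.le.trans (by norm_num)
  have hsL : √L ≤ 3 * y := by
    rw [Real.sqrt_le_left (by linarith)]
    nlinarith
  have hys : 1 ≤ y * √T := one_le_mul_of_one_le_of_one_le hy1 hs
  have h1 : 32 * (√L + 4) * (5 * √T) + 2 ≤ 1122 * (y * √T) := by
    have : (√L + 4) * √T ≤ (7 * y) * √T :=
      mul_le_mul_of_nonneg_right (by linarith) (by linarith)
    linarith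
  have h2 : (16 * y + 1) * (32 * (√L + 4) * (5 * √T) + 2) ≤ (17 * y) * (1122 * (y * √T)) :=
    mul_le_mul (by linarith) h1 (by positivity) (by linarith)
  have h3 : √T ≤ y * (y * √T) := by
    have := mul_le_mul hy1 hy1 zero_le_one (by linarith)
    nlinarith
  nlinarith

end DyadicSearch

end

theorem theorem4 :
    ∃ C p : ℝ, 0 < C ∧ 0 ≤ p ∧
      ∀ (lam : ℝ), 0 < lam → lam < 1 →
      ∀ (μ : MeasureTheory.Measure ℝ), MeasureTheory.IsProbabilityMeasure μ →
        μ (Set.Icc (0 : ℝ) 1) = 1 →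
        ConcaveOn ℝ (Set.Icc (0 : ℝ) 1) (DyadicSearch.expWelfare lam μ) →
      ∀ (T : ℕ), 1 ≤ T →
      ∀ (Ω : Type*) (_ : MeasurableSpace Ω) (P : MeasureTheory.Measure Ω),
        MeasureTheory.IsProbabilityMeasure P →
      ∀ (v : ℕ → Ω → ℝ), (∀ i, Measurable (v i)) → ProbabilityTheory.iIndepFun v P →
        (∀ i, MeasureTheory.Measure.map (v i) P = μ) →
        DyadicSearch.regret P lam v
            (fun t ω => DyadicSearch.policy lam ((T : ℝ) ^ (-(5 / 2) : ℝ)) (fun i => v i ω) t) T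
          ≤ C * Real.sqrt (T : ℝ) * (1 + Real.log (T : ℝ)) ^ p := by
  refine ⟨20000, 2, by norm_num, by norm_num, ?_⟩
  intro lam h0 h1 μ _ hμ hW T hT Ω _ P _ v hv hi hmap
  have hT1 : (1 : ℝ) ≤ T := by exact_mod_cast hT
  have hT0 : (0 : ℝ) < T := by linarith
  have hlog := Real.log_nonneg hT1
  rw [Real.rpow_two]
  have : Nonempty (Set.Icc (0 : ℝ) 1) := ⟨⟨0, by simp⟩⟩
  refine ciSup_le fun x => ?_
  simp only [DyadicSearch.policy_eq_polOf]
  set δ : ℝ := (T : ℝ) ^ (-(5 / 2) : ℝ) with hδ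
  -- From log T ≥ 10 on, L ≥ 5/2 · 10 exceeds the threshold 49/2 of the invariant. Below it the
  -- trivial bound T suffices.
  rcases lt_or_ge (Real.log T) 10 with hsmall | hbig
  · exact (DyadicSearch.integral_regret_le_horizon hv hmap hμ h0.le h1.le
      (DyadicSearch.polOf_nonneg lam δ) x.2 T).trans
      (DyadicSearch.horizon_le_of_log_lt hT1 hsmall)
  · have hLeq : Real.log (2 / δ) = Real.log 2 + 5 / 2 * Real.log T :=
      DyadicSearch.log_two_div_confidence hT0
    have hL : 49 / 2 ≤ Real.log (2 / δ) := by
      rw [hLeq]; linarith [Real.log_nonneg one_le_two]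
    refine (DyadicSearch.integral_regret_le_of_good hv hi hmap hμ h0.le h1.le (fun bs => ?_) x.2 T
      (DyadicSearch.GoodRun lam δ (DyadicSearch.demand μ)) ?_ ?_ (fun bs hlen hgood =>
        DyadicSearch.lossSum_le_of_goodRun hμ hW h0 h1 hL hT x.2 hlen hgood)
      (DyadicSearch.measure_not_goodRun_le hv hi hmap (by linarith) T)).trans ?_
    · obtain ⟨g, i, m, h⟩ := DyadicSearch.exists_inv h0 h1 hL (DyadicSearch.demand_antitone μ)
        (DyadicSearch.demand_nonneg μ) (DyadicSearch.demand_le_one μ) bs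
      exact h.polOf_mem_unit
    · positivity
    · positivity
    · rw [DyadicSearch.failure_probability_mul_horizon hT0]
      exact DyadicSearch.total_budget_le hT1 hLeq
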